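/- **Theorem (global reconstruction estimates).** Let $d\in\{1,2\}$ and let $k,m\ge 0$ be integers with $k+1=3(m+1)$. Let $\Omega=\prod_{i=1}^d[a_i,b_i]$ and let $\mathcal T_h$ be a rectangular mesh of $\Omega$: in direction $i$ the interval $[a_i,b_i]$ is divided into $N_i\ge 1$ consecutive intervals $I^i_1,\dots,I^i_{N_i}$ of positive length, and the elements are the products $K_\theta=\prod_i I^i_{\theta_i}$, $1\le\theta_i\le N_i$. Let $h$ and $\underline h$ be the largest and the smallest side length of the elements, and assume $h\le\gamma\underline h$. *Stencils.* The stencil $S(K_\theta)$ is the set of all products $\prod_i J_i$ with $J_i\in S^1(I^i_{\theta_i})$. Either (periodic case) $S^1(I^i_j)=\{I^i_{j-1},I^i_j,I^i_{j+1}\}$ for all $j$, where the mesh is extended periodically with period $b_i-a_i$ in $x_i$; or (biased case) all $N_i\ge3$ and $S^1(I^i_j)=\{I^i_{j-1},I^i_j,I^i_{j+1}\}$ for $1<j<N_i$, $S^1(I^i_1)=\{I^i_1,I^i_2,I^i_3\}$, $S^1(I^i_{N_i})=\{I^i_{N_i-2},I^i_{N_i-1},I^i_{N_i}\}$. *Reconstruction.*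 For a box $K$ with center $x_K$ and side lengths $h_K^i$, and $\alpha\in\mathbb N_0^d$, the Legendre moment of $v$ is $$I_K^\alpha v=\Big(\prod_{i=1}^d\frac{2\alpha_i+1}{h_K^i}\Big)\int_K v(x)\prod_{i=1}^d\widehat L^{\alpha_i}\Big(\frac{2(x_i-x_{K,i})}{h_K^i}\Big)\,dx ,$$ where $\widehat L^n$ is the Legendre polynomial of degree $n$ on $[-1,1]$. For $K\in\mathcal T_h$ the local reconstruction $R_K^ku$ is the polynomial of degree at most $k$ in each variable with $I^\alpha_{K'}R_K^ku=I^\alpha_{K'}u$ for all $K'\in S(K)$ and all $\alpha$ with $0\le\alpha_i\le m$. The global reconstruction $R^ku$ is defined by $(R^ku)|_K=R_K^ku$ for all $K\in\mathcal T_h$. *Claim.* There is a constant $C>0$ that depends only on $d$, $k$ and $\gamma$ such that the following holds for all such $\Omega$ and $\mathcal T_h$, in both cases. Let $u\in H^{k+1}(\Omega)$; in the periodic case assume moreover that $u$ is periodic, i.e. that its periodic extension lies in $H^{k+1}_{\mathrm{loc}}(\mathbb R^d)$. Then $R_K^ku$ exists and is unique for every $K\in\mathcal T_h$, and $$\|u-R^ku\|_{0}\le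 C\,h^{k+1}\,|u|_{k+1},\qquad |u-R^ku|_{1}\le C\,h^{k}\,|u|_{k+1},$$ $$\|u-R^ku\|_{0}+h^{d/2}\,\|u-R^ku\|_{0,\infty}+h^{1/2}\,\|u-R^ku\|_{0,\mathcal E_h}\le C\,h^{k+1}\,|u|_{k+1}.$$ Here $\|\cdot\|_0$ and $\|\cdot\|_{0,\infty}$ are the norms of $L^2(\Omega)$ and $L^\infty(\Omega)$, $|u|_{k+1}=\big(\sum_{|\alpha|=k+1}\|\partial^\alpha u\|_{L^2(\Omega)}^2\big)^{1/2}$, $|v|_1=\big(\sum_{K\in\mathcal T_h}\sum_{i=1}^d\|\partial_i v\|_{L^2(K)}^2\big)^{1/2}$ is the broken seminorm, and $\|v\|_{0,\mathcal E_h}=\big(\sum_{K\in\mathcal T_h}\|v|_K\|_{L^2(\partial K)}^2\big)^{1/2}$ is computed with the traces from inside the elements, so that both one-sided traces count on an interior edge; for $d=1$, $\partial K$ consists of two points with unit mass. -/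

import Mathlib

open MeasureTheory Set
open scoped ENNReal ContDiff

namespace RDG

/-! ### Sobolev spaces through weak derivatives -/

/-- The open box `∏ (l i, r i)`. -/
def openBox {d : ℕ} (l r : Fin d → ℝ) : Set (Fin d → ℝ) :=
  Set.pi Set.univ fun i => Set.Ioo (l i) (r i)

/-- The classical partial derivative `∂ f / ∂ x_i`. -/
noncomputable def partialDeriv {d : ℕ} (i : Fin d) (f : (Fin d → ℝ) → ℝ) : (Fin d → ℝ) → ℝ :=
  fun x => fderiv ℝ f x (Pi.single i 1)

/-- The classical derivative `∂^α f = ∂_1^{α_1} ⋯ ∂_d^{α_d} f`. -/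
noncomputable def multiDeriv {d : ℕ} (α : Fin d → ℕ) (f : (Fin d → ℝ) → ℝ) : (Fin d → ℝ) → ℝ :=
  (List.finRange d).foldr (fun i g => (partialDeriv i)^[α i] g) f

/-- `g` is the weak derivative `∂^α u` on the open set `U`. -/
def IsWeakDeriv {d : ℕ} (U : Set (Fin d → ℝ)) (α : Fin d → ℕ) (u g : (Fin d → ℝ) → ℝ) : Prop :=
  LocallyIntegrableOn u U volume ∧ LocallyIntegrableOn g U volume ∧
    ∀ φ : (Fin d → ℝ) → ℝ, ContDiff ℝ ∞ φ → HasCompactSupport φ → tsupport φ ⊆ U →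
      ∫ x in U, u x * multiDeriv α φ x = (-1) ^ (∑ i, α i) * ∫ x in U, g x * φ x

/-- `u ∈ H^s(U)`. -/
def MemSobolev {d : ℕ} (s : ℕ) (U : Set (Fin d → ℝ)) (u : (Fin d → ℝ) → ℝ) : Prop :=
  MemLp u 2 (volume.restrict U) ∧
    ∀ α : Fin d → ℕ, ∑ i, α i ≤ s →
      ∃ g, MemLp g 2 (volume.restrict U) ∧ IsWeakDeriv U α u g

/-- The `L²(U)` norm of the weak derivative `∂^α u`. Weak derivatives on an open set are unique
almost everywhere, so the infimum runs over a single value; it is `∞` if there is none. -/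
noncomputable def weakDerivNorm {d : ℕ} (U : Set (Fin d → ℝ)) (α : Fin d → ℕ)
    (u : (Fin d → ℝ) → ℝ) : ℝ≥0∞ :=
  ⨅ (g : (Fin d → ℝ) → ℝ) (_ : IsWeakDeriv U α u g), eLpNorm g 2 (volume.restrict U)

/-- The seminorm `|u|_{s,U} = (∑_{|α| = s} ‖∂^α u‖²_{L²(U)})^{1/2}`. -/
noncomputable def sobolevSeminorm {d : ℕ} (s : ℕ) (U : Set (Fin d → ℝ))
    (u : (Fin d → ℝ) → ℝ) : ℝ≥0∞ :=
  (∑ α ∈ Finset.piAntidiag (Finset.univ : Finset (Fin d)) s, weakDerivNorm U α u ^ 2) ^ (1 / 2 : ℝ)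

/-! ### Traces on the boundary of a box -/

/-- Surface measure on the face `{x_i = c}` of the box `∏ [l j, r j]`: the product of the Dirac
mass at `c` in direction `i` with Lebesgue measure on `[l j, r j]` in the other directions.
For `d = 1` it is the unit mass at a point. -/
noncomputable def faceMeasure {d : ℕ} (l r : Fin d → ℝ) (i : Fin d) (c : ℝ) :
    Measure (Fin d → ℝ) :=
  Measure.pi (Function.update (fun j => volume.restrict (Set.Icc (l j) (r j))) i (Measure.dirac c))

/-- Surface measure on the boundary of the box `∏ [l i, r i]`. -/
noncomputable def boundaryMeasure {d : ℕ} (l r : Fin d → ℝ) : Measure (Fin d → ℝ) :=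
  ∑ i, (faceMeasure l r i (l i) + faceMeasure l r i (r i))

/-- The norm `‖v‖_{L²(∂K)}` of the trace, taken from inside `K = ∏ [l i, r i]`, of a function `v`
on `K`. The trace is the restriction to `∂K` of the representative of `v` that is continuous
on the closed box. On `∂K` such a representative is unique, so the infimum runs over a single
value; it is `∞` if there is no such representative. -/
noncomputable def traceNorm {d : ℕ} (l r : Fin d → ℝ) (v : (Fin d → ℝ) → ℝ) : ℝ≥0∞ :=
  ⨅ (w : (Fin d → ℝ) → ℝ)
    (_ : ContinuousOn w (Set.Icc l r) ∧ v =ᵐ[volume.restrict (Set.Icc l r)] w),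
    eLpNorm w 2 (boundaryMeasure l r)

/-! ### Legendre moments on a box -/

/-- The Legendre polynomial of degree `n`, by the Rodrigues formula. -/
noncomputable def legendre (n : ℕ) : Polynomial ℝ :=
  Polynomial.C ((-1) ^ n / (2 ^ n * (n.factorial : ℝ))) *
    Polynomial.derivative^[n] ((1 - Polynomial.X ^ 2) ^ n)

/-- The Legendre basis function `L_K^α` of the box `K = ∏ [l i, r i]`. -/
noncomputable def legendreBasis {d : ℕ} (l r : Fin d → ℝ) (α : Fin d → ℕ) (x : Fin d → ℝ) : ℝ :=
  ∏ i, (legendre (α i)).eval (2 * (x i - (l i + r i) / 2) / (r i - l i))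

/-- The Legendre moment `I_K^α v` on the box `K = ∏ [l i, r i]`. -/
noncomputable def moment {d : ℕ} (l r : Fin d → ℝ) (α : Fin d → ℕ) (v : (Fin d → ℝ) → ℝ) : ℝ :=
  (∏ i, (2 * (α i : ℝ) + 1) / (r i - l i)) *
    ∫ x in Set.Icc l r, legendreBasis l r α x * v x

/-! ### Rectangular meshes, stencils and the reconstruction operator -/

/-- A rectangular mesh of `Ω = ∏ [a i, b i]`: in direction `i` there are `N i ≥ 1` intervals
with the end points `a i = x i 0 < x i 1 < ⋯ < x i (N i) = b i`
(values of `x i` beyond `N i` play no role). -/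
structure RectMesh {d : ℕ} (a b : Fin d → ℝ) where
  N : Fin d → ℕ
  N_pos : ∀ i, 0 < N i
  x : Fin d → ℕ → ℝ
  x_zero : ∀ i, x i 0 = a i
  x_last : ∀ i, x i (N i) = b i
  x_lt : ∀ i, ∀ j < N i, x i j < x i (j + 1)

/-- The two kinds of boundary treatment: periodic stencils and one-sided (biased) stencils. -/
inductive BoundaryKind where
  | periodic : BoundaryKind
  | biased : BoundaryKind

/-- The indices of the three intervals in the one-dimensional stencil of the interval number `j`
among `n` intervals numbered `0, …, n - 1`. In the periodic case the numbers `-1` and `n` denote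
intervals of the periodically extended mesh. -/
def stencil1 (bc : BoundaryKind) (n : ℕ) (j : ℤ) : Finset ℤ :=
  match bc with
  | .periodic => {j - 1, j, j + 1}
  | .biased =>
      if j = 0 then {0, 1, 2}
      else if j = (n : ℤ) - 1 then {(n : ℤ) - 3, (n : ℤ) - 2, (n : ℤ) - 1}
      else {j - 1, j, j + 1}

namespace RectMesh

variable {d : ℕ} {a b : Fin d → ℝ}

/-- Indices of the elements of the mesh. -/
abbrev Index (M : RectMesh a b) : Type := (i : Fin d) → Fin (M.N i)

/-- The maximal mesh size `h`. -/
noncomputable def h (M : RectMesh a b) : ℝ :=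
  ⨆ p : (Σ i : Fin d, Fin (M.N i)), (M.x p.1 ((p.2 : ℕ) + 1) - M.x p.1 (p.2 : ℕ))

/-- The minimal mesh size. -/
noncomputable def hMin (M : RectMesh a b) : ℝ :=
  ⨅ p : (Σ i : Fin d, Fin (M.N i)), (M.x p.1 ((p.2 : ℕ) + 1) - M.x p.1 (p.2 : ℕ))

/-- Regularity of the mesh with parameter `γ`. -/
def Regular (M : RectMesh a b) (γ : ℝ) : Prop := M.h ≤ γ * M.hMin

/-- The nodes of the mesh extended periodically with period `b i - a i` in direction `i`;
for `0 ≤ j ≤ N i` these are the nodes of the mesh itself. -/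
noncomputable def node (M : RectMesh a b) (i : Fin d) (j : ℤ) : ℝ :=
  M.x i (j % (M.N i : ℤ)).toNat + ((j / (M.N i : ℤ) : ℤ) : ℝ) * (b i - a i)

/-- Lower corner of the element with index `θ` of the (periodically extended) mesh. -/
noncomputable def lower (M : RectMesh a b) (θ : Fin d → ℤ) : Fin d → ℝ := fun i => M.node i (θ i)

/-- Upper corner of the element with index `θ` of the (periodically extended) mesh. -/
noncomputable def upper (M : RectMesh a b) (θ : Fin d → ℤ) : Fin d → ℝ :=
  fun i => M.node i (θ i + 1)

/-- An element index as an index of the periodically extended mesh. -/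
def Index.toInt {M : RectMesh a b} (θ : M.Index) : Fin d → ℤ := fun i => ((θ i : ℕ) : ℤ)

/-- The stencil `S(K_θ)`, the tensor product of the one-dimensional stencils. -/
def stencil (M : RectMesh a b) (bc : BoundaryKind) (θ : M.Index) : Finset (Fin d → ℤ) :=
  Fintype.piFinset fun i => stencil1 bc (M.N i) (θ.toInt i)

/-- `p ∈ Q^k` (degree at most `k` in each variable) has the same Legendre moments of order at
most `m` in each variable as `u` on every element of the stencil of `K_θ`. -/
def IsLocalReconstruction (M : RectMesh a b) (bc : BoundaryKind) (k m : ℕ)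
    (u : (Fin d → ℝ) → ℝ) (θ : M.Index) (p : MvPolynomial (Fin d) ℝ) : Prop :=
  (∀ i, p.degreeOf i ≤ k) ∧
    ∀ η ∈ M.stencil bc θ, ∀ α : Fin d → ℕ, (∀ i, α i ≤ m) →
      moment (M.lower η) (M.upper η) α (fun x => MvPolynomial.eval x p) =
        moment (M.lower η) (M.upper η) α u

/-- The local reconstruction `R_K^k u` for `K = K_θ`: the solution of the moment problem. -/
noncomputable def localReconstruction (M : RectMesh a b) (bc : BoundaryKind) (k m : ℕ)
    (u : (Fin d → ℝ) → ℝ) (θ : M.Index) : MvPolynomial (Fin d) ℝ :=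
  Classical.epsilon (M.IsLocalReconstruction bc k m u θ)

/-- The interior of the element `K_θ`. -/
def cell (M : RectMesh a b) (θ : M.Index) : Set (Fin d → ℝ) :=
  openBox (M.lower θ.toInt) (M.upper θ.toInt)

/-- The global reconstruction `R^k u`, equal to `R_K^k u` inside every element `K`
(and to `0` on the null set of all element boundaries, where it is not determined). -/
noncomputable def reconstruction (M : RectMesh a b) (bc : BoundaryKind) (k m : ℕ)
    (u : (Fin d → ℝ) → ℝ) : (Fin d → ℝ) → ℝ :=
  fun x => ∑ θ : M.Index,
    (M.cell θ).indicator (fun y => MvPolynomial.eval y (M.localReconstruction bc k m u θ)) x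

/-- The broken seminorm `|v|_1 = (∑_K |v|²_{1,K})^{1/2}`. -/
noncomputable def brokenSeminorm (M : RectMesh a b) (v : (Fin d → ℝ) → ℝ) : ℝ≥0∞ :=
  (∑ θ : M.Index, sobolevSeminorm 1 (M.cell θ) v ^ 2) ^ (1 / 2 : ℝ)

/-- The `L²` norm over all edges, `(∑_K ‖v‖²_{L²(∂K)})^{1/2}`: on an interior edge the traces
from both sides are counted. -/
noncomputable def edgeNorm (M : RectMesh a b) (v : (Fin d → ℝ) → ℝ) : ℝ≥0∞ :=
  (∑ θ : M.Index, traceNorm (M.lower θ.toInt) (M.upper θ.toInt) v ^ 2) ^ (1 / 2 : ℝ)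

/-- Biased stencils need at least three intervals in every direction. -/
def Admits (M : RectMesh a b) (bc : BoundaryKind) : Prop :=
  match bc with
  | .periodic => True
  | .biased => ∀ i, 3 ≤ M.N i

end RectMesh

/-- The space of data: `H^s(Ω)` for biased stencils. For periodic stencils it is the periodic
space `H^s(Ω)`: the function has period `b i - a i` in `x_i` and lies in `H^s` of every bounded
box. -/
def MemData {d : ℕ} (bc : BoundaryKind) (s : ℕ) (a b : Fin d → ℝ) (u : (Fin d → ℝ) → ℝ) : Prop :=
  match bc with
  | .periodic =>
      (∀ i, Function.Periodic u (Pi.single i (b i - a i))) ∧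
        ∀ l r : Fin d → ℝ, MemSobolev s (openBox l r) u
  | .biased => MemSobolev s (openBox a b) u

end RDG

namespace RDG

/-! ### Calculus of partial derivatives of smooth functions -/

section Calculus

variable {d : ℕ} {f : (Fin d → ℝ) → ℝ}

/-! All the estimates come from one local bound in `W^{1,∞}`. Let `h` be the mesh size and `B` the
seminorm `|u|_{k+1}` on the `3 × ⋯ × 3` patch of cells in the stencil of `K`. Off a null set of the
patch, the error `u - R_K u` is at most a constant times `h^{k+1} h^{-d/2} B`, its first derivatives
are at most a constant times `h^k h^{-d/2} B`, and it is Lipschitz (`exists_patch_estimate`).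
Multiplication by `h^{d/2}`, the square root of a bound for the volume of a cell, gives the local
`L²`, `H¹` and `L^∞` estimates. The Lipschitz property provides a continuous representative up to
the boundary, hence a trace with the same sup bound (`traceNorm_le`).

The local bound has two ingredients. The first is approximation. For smooth `f`, average the Taylor
polynomials of degree `k` over all expansion points in a box. Differentiation turns these into the
Taylor polynomials of `∂_i f` of one order less, so a pointwise remainder estimate for `∂_i f`
controls the gradient of the error. The weight `(1-s)^N` in the integral remainder, with `N ≥ 1`,
absorbs the factor `(1-s)^{-d/2}` by which a contraction towards `x` changes `L²` norms; this is
where `d ≤ 2` and `k ≥ 2` enter (`enorm_sub_average_taylorPoly_le`). Fixing the error to be zero at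
a corner bounds the error itself. A Sobolev function is mollified on slightly smaller boxes, and the
polynomials converge along a subsequence because they are bounded at almost every point
(`exists_poly_approx`).

The second is stability of the moment problem. In one dimension, a polynomial of degree less than
`3M`, with `M = m + 1`, that is orthogonal to degree less than `M` on three adjacent intervals is
the `M`-th derivative of a polynomial of degree less than `4M` with zeros of order `M` at all four
nodes, so it vanishes (`eq_zero_of_orthogonal`). The moment matrix is therefore invertible. After
scaling by `h` the nodes range over a compact set fixed by `γ`, so the inverse is bounded uniformly
(`exists_inv_momentMatrix_bound`). Moments of products factor, so in `d` dimensions the matrix is a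
tensor product. If `q` approximates `u`, then `R_K u - q` has the moments of the small function `u -
q`, and stability makes `R_K u - q` and its gradient small (`exists_patch_stability`).

For the global bound, each cell, counted modulo the periods in the periodic case, lies in a bounded
number of stencils, so the squared local seminorms add up to at most a constant times `|u|²_{k+1}`
(`sum_stencil_le`). -/

theorem contDiff_partialDeriv (hf : ContDiff ℝ ∞ f) (i : Fin d) :
    ContDiff ℝ ∞ (partialDeriv i f) :=
  (hf.fderiv_right (m := ∞) (by simp)).clm_apply contDiff_const

theorem contDiff_iterate_partialDeriv (hf : ContDiff ℝ ∞ f) (i : Fin d) (n : ℕ) :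
    ContDiff ℝ ∞ ((partialDeriv i)^[n] f) := by
  induction n with
  | zero => exact hf
  | succ n ih => rw [Function.iterate_succ_apply']; exact contDiff_partialDeriv ih i

theorem contDiff_foldr_partialDeriv (hf : ContDiff ℝ ∞ f) (α : Fin d → ℕ) (L : List (Fin d)) :
    ContDiff ℝ ∞ (L.foldr (fun i g => (partialDeriv i)^[α i] g) f) := by
  induction L with
  | nil => exact hf
  | cons i L ih => exact contDiff_iterate_partialDeriv ih i _

theorem contDiff_multiDeriv (hf : ContDiff ℝ ∞ f) (α : Fin d → ℕ) :
    ContDiff ℝ ∞ (multiDeriv α f) :=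
  contDiff_foldr_partialDeriv hf α _

theorem partialDeriv_comm (hf : ContDiff ℝ ∞ f) (i j : Fin d) :
    partialDeriv i (partialDeriv j f) = partialDeriv j (partialDeriv i f) := by
  ext x
  have hd : DifferentiableAt ℝ (fderiv ℝ f) x :=
    ((hf.fderiv_right (m := ∞) (by simp)).differentiable (by simp)) x
  have hsymm : IsSymmSndFDerivAt ℝ f x :=
    hf.contDiffAt.isSymmSndFDerivAt (by simpa using WithTop.coe_le_coe.2 (le_top : (2 : ℕ∞) ≤ ⊤))
  have key : ∀ v w : Fin d → ℝ,
      fderiv ℝ (fun y => fderiv ℝ f y v) x w = fderiv ℝ (fderiv ℝ f) x w v := by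
    intro v w
    rw [fderiv_clm_apply hd (differentiableAt_const v)]
    simp
  unfold partialDeriv
  rw [key, key]
  exact hsymm.eq _ _

theorem partialDeriv_iterate_comm (hf : ContDiff ℝ ∞ f) (i j : Fin d) (n : ℕ) :
    partialDeriv i ((partialDeriv j)^[n] f) = (partialDeriv j)^[n] (partialDeriv i f) := by
  induction n with
  | zero => rfl
  | succ n ih =>
    rw [Function.iterate_succ_apply', Function.iterate_succ_apply',
      partialDeriv_comm (contDiff_iterate_partialDeriv hf j n), ih]

theorem partialDeriv_foldr (hf : ContDiff ℝ ∞ f) (α : Fin d → ℕ) (i : Fin d) (L : List (Fin d)) :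
    partialDeriv i (L.foldr (fun i g => (partialDeriv i)^[α i] g) f) =
      L.foldr (fun i g => (partialDeriv i)^[α i] g) (partialDeriv i f) := by
  induction L with
  | nil => rfl
  | cons j L ih =>
    simp only [List.foldr_cons]
    rw [partialDeriv_iterate_comm (contDiff_foldr_partialDeriv hf α L), ih]

/-- Smooth partial derivatives commute, so the additional `∂_i` can be moved through the fold to the
innermost position. A list without repetitions meets `i` at most once, hence at most one derivative
is added. -/
theorem foldr_partialDeriv_add_single (hf : ContDiff ℝ ∞ f) (α : Fin d → ℕ) (i : Fin d)
    (L : List (Fin d)) (hL : L.Nodup) :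
    L.foldr (fun j g => (partialDeriv j)^[(α + Pi.single i 1 : Fin d → ℕ) j] g) f =
      L.foldr (fun j g => (partialDeriv j)^[α j] g) (if i ∈ L then partialDeriv i f else f) := by
  induction L with
  | nil => simp
  | cons j L ih =>
    rw [List.nodup_cons] at hL
    simp only [List.foldr_cons]
    rw [ih hL.2]
    by_cases hij : i = j
    · subst hij
      simp only [hL.1, if_false, List.mem_cons, true_or, if_true, Pi.add_apply, Pi.single_eq_same]
      rw [Function.iterate_succ_apply, partialDeriv_foldr hf]
    · have : (α + Pi.single i 1 : Fin d → ℕ) j = α j := by simp [Ne.symm hij]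
      rw [this]
      simp [hij]

theorem multiDeriv_add_single (hf : ContDiff ℝ ∞ f) (α : Fin d → ℕ) (i : Fin d) :
    multiDeriv (α + Pi.single i 1) f = multiDeriv α (partialDeriv i f) := by
  unfold multiDeriv
  rw [foldr_partialDeriv_add_single hf α i _ (List.nodup_finRange d)]
  simp

theorem partialDeriv_multiDeriv (hf : ContDiff ℝ ∞ f) (α : Fin d → ℕ) (i : Fin d) :
    partialDeriv i (multiDeriv α f) = multiDeriv (α + Pi.single i 1) f := by
  rw [multiDeriv_add_single hf]
  exact partialDeriv_foldr hf α i _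

@[simp] theorem multiDeriv_zero (f : (Fin d → ℝ) → ℝ) : multiDeriv 0 f = f := by
  unfold multiDeriv
  induction List.finRange d with
  | nil => rfl
  | cons i L ih => simp

theorem multiDeriv_single (hf : ContDiff ℝ ∞ f) (i : Fin d) :
    multiDeriv (Pi.single i 1) f = partialDeriv i f := by
  have := multiDeriv_add_single hf 0 i
  rwa [zero_add, multiDeriv_zero] at this

/-- Induction on multi-indices by raising one entry at a time. -/
theorem multiIndex_induction {P : (Fin d → ℕ) → Prop} (zero : P 0)
    (add : ∀ α i, P α → P (α + Pi.single i 1)) (α : Fin d → ℕ) : P α := by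
  induction hn : ∑ i, α i generalizing α with
  | zero =>
    have : α = 0 := by
      ext i
      simpa using (Finset.sum_eq_zero_iff.mp hn) i (Finset.mem_univ i)
    rwa [this]
  | succ n ih =>
    obtain ⟨i, hi⟩ : ∃ i, α i ≠ 0 := by
      by_contra! h
      simp [h] at hn
    have h1 : α - Pi.single i 1 + Pi.single i 1 = α := by
      ext j
      by_cases hj : j = i
      · subst hj; simp; omega
      · simp [hj]
    rw [← h1]
    refine add _ _ (ih _ ?_)
    have h2 := congrArg (fun β : Fin d → ℕ => ∑ j, β j) h1
    simp only [Pi.add_apply, Finset.sum_add_distrib, Finset.sum_pi_single', Finset.mem_univ,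
      if_true, hn] at h2
    simpa using h2

theorem sum_add_single (α : Fin d → ℕ) (i : Fin d) :
    ∑ j, (α + Pi.single i 1 : Fin d → ℕ) j = ∑ j, α j + 1 := by
  simp [Finset.sum_add_distrib]

theorem partialDeriv_reflect (hf : ContDiff ℝ ∞ f) (i : Fin d) (x : Fin d → ℝ) :
    partialDeriv i (fun y => f (x - y)) = fun y => -partialDeriv i f (x - y) := by
  ext y
  unfold partialDeriv
  have h1 : HasFDerivAt (fun y : Fin d → ℝ => x - y) (-ContinuousLinearMap.id ℝ _) y := by
    simpa using (hasFDerivAt_id (𝕜 := ℝ) y).const_sub x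
  have h2 := ((hf.differentiable (by simp)) (x - y)).hasFDerivAt.comp y h1
  have h3 : fderiv ℝ (fun y => f (x - y)) y = _ := h2.fderiv
  rw [h3]
  simp

theorem partialDeriv_const_mul (hf : ContDiff ℝ ∞ f) (i : Fin d) (c : ℝ) :
    partialDeriv i (fun y => c * f y) = fun y => c * partialDeriv i f y := by
  ext y
  unfold partialDeriv
  rw [fderiv_const_mul ((hf.differentiable (by simp)) y)]
  simp

/-- The chain rule gives a factor `-1` for each derivative. A convolution tests `u` against the
reflected kernel, and this sign cancels the one in the definition of weak derivatives. -/
theorem multiDeriv_reflect (hf : ContDiff ℝ ∞ f) (α : Fin d → ℕ) (x : Fin d → ℝ) :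
    multiDeriv α (fun y => f (x - y)) = fun y => (-1) ^ (∑ i, α i) * multiDeriv α f (x - y) := by
  have hg : ContDiff ℝ ∞ (fun y => f (x - y)) := hf.comp (contDiff_const.sub contDiff_id)
  induction α using multiIndex_induction with
  | zero => simp
  | add α i ih =>
    have hm := contDiff_multiDeriv hf α
    rw [← partialDeriv_multiDeriv hg, ih, partialDeriv_const_mul
      (f := fun y => multiDeriv α f (x - y)) (hm.comp (contDiff_const.sub contDiff_id)),
      partialDeriv_reflect hm, partialDeriv_multiDeriv hf, sum_add_single]
    ext y
    ring

theorem tsupport_partialDeriv_subset (i : Fin d) (f : (Fin d → ℝ) → ℝ) :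
    tsupport (partialDeriv i f) ⊆ tsupport f :=
  tsupport_fderiv_apply_subset ℝ _

theorem tsupport_multiDeriv_subset (hf : ContDiff ℝ ∞ f) (α : Fin d → ℕ) :
    tsupport (multiDeriv α f) ⊆ tsupport f := by
  induction α using multiIndex_induction with
  | zero => simp
  | add α i ih =>
    rw [← partialDeriv_multiDeriv hf]
    exact (tsupport_partialDeriv_subset i _).trans ih

theorem hasCompactSupport_multiDeriv (hf : ContDiff ℝ ∞ f) (hc : HasCompactSupport f)
    (α : Fin d → ℕ) : HasCompactSupport (multiDeriv α f) :=
  hc.of_isClosed_subset (isClosed_tsupport _) (tsupport_multiDeriv_subset hf α)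

theorem fderiv_apply_eq_sum_partialDeriv (f : (Fin d → ℝ) → ℝ) (x v : Fin d → ℝ) :
    fderiv ℝ f x v = ∑ i, v i * partialDeriv i f x := by
  conv_lhs => rw [pi_eq_sum_univ' v]
  rw [map_sum]
  refine Finset.sum_congr rfl fun i _ => ?_
  rw [map_smul, smul_eq_mul, partialDeriv]

end Calculus

end RDG

namespace RDG

/-! ### Polynomials of bounded degree in each variable -/

section QPoly

variable {d k : ℕ}

/-- The polynomial with the coefficient vector `c` in the monomial basis of `Q^k`. -/
noncomputable def coeffPoly (d k : ℕ) :
    ((Fin d → Fin (k + 1)) → ℝ) →ₗ[ℝ] MvPolynomial (Fin d) ℝ where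
  toFun c := ∑ β, MvPolynomial.monomial (Finsupp.equivFunOnFinite.symm fun i => (β i : ℕ)) (c β)
  map_add' c c' := by simp [Finset.sum_add_distrib]
  map_smul' a c := by simp [Finset.smul_sum, MvPolynomial.smul_monomial]

theorem coeffPoly_apply (c : (Fin d → Fin (k + 1)) → ℝ) :
    coeffPoly d k c =
      ∑ β, MvPolynomial.monomial (Finsupp.equivFunOnFinite.symm fun i => (β i : ℕ)) (c β) := rfl

theorem eval_coeffPoly (c : (Fin d → Fin (k + 1)) → ℝ) (x : Fin d → ℝ) :
    MvPolynomial.eval x (coeffPoly d k c) = ∑ β, c β * ∏ i, x i ^ (β i : ℕ) := by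
  rw [coeffPoly_apply, map_sum]
  refine Finset.sum_congr rfl fun β _ => ?_
  rw [MvPolynomial.eval_monomial, Finsupp.prod_fintype _ _ (by simp)]
  rfl

theorem degreeOf_coeffPoly_le (c : (Fin d → Fin (k + 1)) → ℝ) (i : Fin d) :
    (coeffPoly d k c).degreeOf i ≤ k := by
  refine (MvPolynomial.degreeOf_sum_le _ _ _).trans (Finset.sup_le fun β _ => ?_)
  rw [MvPolynomial.degreeOf_le_iff]
  intro s hs
  have := MvPolynomial.support_monomial_subset hs
  rw [Finset.mem_singleton] at this
  subst this
  exact Nat.lt_succ_iff.mp (β i).2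

/-- The coefficient vector of a polynomial in the monomial basis of `Q^k`. -/
noncomputable def qCoeff (k : ℕ) (p : MvPolynomial (Fin d) ℝ) : (Fin d → Fin (k + 1)) → ℝ :=
  fun β => p.coeff (Finsupp.equivFunOnFinite.symm fun i => (β i : ℕ))

theorem coeffPoly_qCoeff {p : MvPolynomial (Fin d) ℝ} (hp : ∀ i, p.degreeOf i ≤ k) :
    coeffPoly d k (qCoeff k p) = p := by
  conv_rhs => rw [p.as_sum]
  rw [coeffPoly_apply]
  symm
  -- Truncation at `k` only serves to land in `Fin (k + 1)`; on the support of `p` it changes no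
  -- exponent, by the degree bounds.
  refine Finset.sum_of_injOn
    (fun s i => (⟨s i ⊓ k, by omega⟩ : Fin (k + 1))) ?_ (fun _ _ => by simp) ?_ ?_
  · intro s hs t ht hst
    ext i
    have h := congrArg (fun g : Fin d → Fin (k + 1) => (g i : ℕ)) hst
    have h1 := MvPolynomial.degreeOf_le_iff.mp (hp i) s hs
    have h2 := MvPolynomial.degreeOf_le_iff.mp (hp i) t ht
    simp only at h
    omega
  · intro β _ hβ
    rw [MvPolynomial.monomial_eq_zero]
    by_contra hne
    refine hβ ⟨Finsupp.equivFunOnFinite.symm fun i => (β i : ℕ), ?_, ?_⟩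
    · exact MvPolynomial.mem_support_iff.mpr hne
    · ext i
      have := (β i).2
      simp
      omega
  · intro s hs
    have : (Finsupp.equivFunOnFinite.symm fun i => s i ⊓ k) = s := by
      ext i
      have h1 := MvPolynomial.degreeOf_le_iff.mp (hp i) s hs
      simpa using h1
    simp [qCoeff, this]

theorem linearMap_coeffPoly (Λ : MvPolynomial (Fin d) ℝ →ₗ[ℝ] ℝ)
    (c : (Fin d → Fin (k + 1)) → ℝ) :
    Λ (coeffPoly d k c) = ∑ β, c β *
      Λ (MvPolynomial.monomial (Finsupp.equivFunOnFinite.symm fun i => (β i : ℕ)) 1) := by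
  rw [coeffPoly_apply, map_sum]
  refine Finset.sum_congr rfl fun β _ => ?_
  rw [← smul_eq_mul, ← map_smul, MvPolynomial.smul_monomial, smul_eq_mul, mul_one]

/-- Evaluation at a point as a linear functional. -/
noncomputable def evalₗ (x : Fin d → ℝ) : MvPolynomial (Fin d) ℝ →ₗ[ℝ] ℝ :=
  (MvPolynomial.aeval x).toLinearMap

theorem evalₗ_apply (x : Fin d → ℝ) (p : MvPolynomial (Fin d) ℝ) :
    evalₗ x p = MvPolynomial.eval x p := by
  simp [evalₗ, MvPolynomial.aeval_eq_eval]

/-- Evaluation of a partial derivative at a point as a linear functional. -/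
noncomputable def evalPderivₗ (i : Fin d) (x : Fin d → ℝ) : MvPolynomial (Fin d) ℝ →ₗ[ℝ] ℝ :=
  evalₗ x ∘ₗ (MvPolynomial.pderiv i).toLinearMap

theorem evalPderivₗ_apply (i : Fin d) (x : Fin d → ℝ) (p : MvPolynomial (Fin d) ℝ) :
    evalPderivₗ i x p = MvPolynomial.eval x (MvPolynomial.pderiv i p) := by
  simp [evalPderivₗ, evalₗ_apply]

theorem contDiff_eval (p : MvPolynomial (Fin d) ℝ) :
    ContDiff ℝ ∞ fun x : Fin d → ℝ => MvPolynomial.eval x p := by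
  induction p using MvPolynomial.induction_on with
  | C a => simpa using contDiff_const
  | add p q hp hq => simpa using hp.add hq
  | mul_X p i hp => simpa using hp.mul (contDiff_apply ℝ ℝ i)

theorem partialDeriv_eval (i : Fin d) (p : MvPolynomial (Fin d) ℝ) :
    partialDeriv i (fun x => MvPolynomial.eval x p) =
      fun x => MvPolynomial.eval x (MvPolynomial.pderiv i p) := by
  ext x
  have hdiff : ∀ q : MvPolynomial (Fin d) ℝ,
      DifferentiableAt ℝ (fun x : Fin d → ℝ => MvPolynomial.eval x q) x :=
    fun q => (contDiff_eval q).differentiable (by simp) x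
  unfold partialDeriv
  induction p using MvPolynomial.induction_on with
  | C a => simp
  | add p q hp hq =>
    simp only [map_add]
    rw [← hp, ← hq, fderiv_fun_add (hdiff p) (hdiff q)]
    rfl
  | mul_X p j hp =>
    simp only [map_mul, MvPolynomial.eval_X, Derivation.leibniz, smul_eq_mul, map_add]
    rw [← hp, fderiv_fun_mul (hdiff p) (differentiableAt_apply j x)]
    have : fderiv ℝ (fun y : Fin d → ℝ => y j) x = ContinuousLinearMap.proj j :=
      (ContinuousLinearMap.proj (R := ℝ) (φ := fun _ : Fin d => ℝ) j).fderiv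
    rw [this]
    by_cases hij : i = j
    · subst hij; simp
    · simp [MvPolynomial.pderiv_X, Ne.symm hij]

theorem degreeOf_prod_pow_le (P : Fin d → MvPolynomial (Fin d) ℝ)
    (hP : ∀ i j, (P j).degreeOf i ≤ if i = j then 1 else 0) (e : Fin d → ℕ) (i : Fin d) :
    (∏ j, P j ^ e j).degreeOf i ≤ e i := by
  refine (MvPolynomial.degreeOf_prod_le _ _ _).trans ?_
  calc ∑ j, (P j ^ e j).degreeOf i ≤ ∑ j, if i = j then e j else 0 := by
        refine Finset.sum_le_sum fun j _ => ?_
        refine (MvPolynomial.degreeOf_pow_le _ _ _).trans ?_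
        refine (Nat.mul_le_mul_left _ (hP i j)).trans ?_
        split_ifs <;> simp
    _ = e i := by simp

/-- Averaging a continuous family of polynomials over a compact box. -/
theorem exists_average_poly (l r : Fin d → ℝ) (P : (Fin d → ℝ) → MvPolynomial (Fin d) ℝ)
    (hdeg : ∀ y i, (P y).degreeOf i ≤ k) (hP : ∀ s, Continuous fun y => (P y).coeff s) :
    ∃ q : MvPolynomial (Fin d) ℝ, (∀ i, q.degreeOf i ≤ k) ∧
      ∀ Λ : MvPolynomial (Fin d) ℝ →ₗ[ℝ] ℝ, Λ q = ⨍ y in Icc l r, Λ (P y) := by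
  -- The average is taken coefficient by coefficient. A linear functional on `Q^k` is a finite
  -- combination of coefficients, so it commutes with the integral.
  refine ⟨coeffPoly d k fun β => ⨍ y in Icc l r, qCoeff k (P y) β, degreeOf_coeffPoly_le _,
    fun Λ => ?_⟩
  have h : ∀ y, Λ (P y) = _ := fun y =>
    (congrArg Λ (coeffPoly_qCoeff (hdeg y)).symm).trans (linearMap_coeffPoly Λ _)
  simp_rw [h]
  rw [linearMap_coeffPoly, setAverage_eq, integral_finsetSum, Finset.smul_sum]
  · refine Finset.sum_congr rfl fun β _ => ?_
    rw [integral_mul_const, setAverage_eq]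
    simp only [smul_eq_mul]
    ring
  · intro β _
    exact ((hP _).mul continuous_const).continuousOn.integrableOn_Icc

end QPoly

/-! ### Taylor polynomials -/

section Taylor

variable {d : ℕ} {f : (Fin d → ℝ) → ℝ}

theorem mem_piAntidiag_univ {n : ℕ} {α : Fin d → ℕ} :
    α ∈ Finset.piAntidiag (Finset.univ : Finset (Fin d)) n ↔ ∑ i, α i = n := by
  simp [Finset.mem_piAntidiag]

/-- The shift by `e_i` maps the multi-indices of order `n` bijectively onto those of order `n + 1`
with nonzero `i`-th entry, and the remaining terms are zero. It handles the index shift that comes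
with each differentiation below. -/
theorem sum_piAntidiag_succ {V : Type*} [AddCommMonoid V] (i : Fin d) (n : ℕ)
    (F : (Fin d → ℕ) → V) (hF : ∀ α, α i = 0 → F α = 0) :
    ∑ α ∈ Finset.piAntidiag (Finset.univ : Finset (Fin d)) (n + 1), F α =
      ∑ α ∈ Finset.piAntidiag (Finset.univ : Finset (Fin d)) n, F (α + Pi.single i 1) := by
  symm
  refine Finset.sum_of_injOn (fun α => α + Pi.single i 1) (fun a _ b _ h => by simpa using h)
    ?_ ?_ (fun _ _ => rfl)
  · intro α hα
    rw [Finset.mem_coe, mem_piAntidiag_univ] at hα ⊢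
    rw [sum_add_single, hα]
  · intro α hα hn
    by_contra hne
    have hi : α i ≠ 0 := fun h => hne (hF α h)
    have h1 : α - Pi.single i 1 + Pi.single i 1 = α := by
      ext j
      by_cases hj : j = i
      · subst hj; simp; omega
      · simp [hj]
    refine hn ⟨α - Pi.single i 1, ?_, h1⟩
    rw [mem_piAntidiag_univ] at hα
    rw [Finset.mem_coe, mem_piAntidiag_univ]
    rw [← h1, sum_add_single] at hα
    omega

/-- The Taylor polynomial of `f` at `y` with the terms of order less than `N`. -/
noncomputable def taylorPoly (N : ℕ) (f : (Fin d → ℝ) → ℝ) (y : Fin d → ℝ) :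
    MvPolynomial (Fin d) ℝ :=
  ∑ j ∈ Finset.range N, ∑ α ∈ Finset.piAntidiag (Finset.univ : Finset (Fin d)) j,
    MvPolynomial.C (multiDeriv α f y / ∏ i, ((α i).factorial : ℝ)) *
      ∏ i, (MvPolynomial.X i - MvPolynomial.C (y i)) ^ α i

theorem eval_taylorPoly (N : ℕ) (f : (Fin d → ℝ) → ℝ) (x y : Fin d → ℝ) :
    MvPolynomial.eval x (taylorPoly N f y) =
      ∑ j ∈ Finset.range N, ∑ α ∈ Finset.piAntidiag (Finset.univ : Finset (Fin d)) j,
        multiDeriv α f y * ∏ i, ((x i - y i) ^ α i / ((α i).factorial : ℝ)) := by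
  simp only [taylorPoly, map_sum, map_mul, MvPolynomial.eval_C, map_prod, map_pow, map_sub,
    MvPolynomial.eval_X, Finset.prod_div_distrib]
  refine Finset.sum_congr rfl fun j _ => Finset.sum_congr rfl fun α _ => ?_
  ring

theorem degreeOf_taylorPoly_le (N : ℕ) (f : (Fin d → ℝ) → ℝ) (y : Fin d → ℝ) (i : Fin d) :
    (taylorPoly (N + 1) f y).degreeOf i ≤ N := by
  refine (MvPolynomial.degreeOf_sum_le _ _ _).trans (Finset.sup_le fun j hj => ?_)
  refine (MvPolynomial.degreeOf_sum_le _ _ _).trans (Finset.sup_le fun α hα => ?_)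
  refine (MvPolynomial.degreeOf_C_mul_le _ _ _).trans ?_
  refine (degreeOf_prod_pow_le _ ?_ α i).trans ?_
  · intro i j
    refine (MvPolynomial.degreeOf_sub_le _ _ _).trans ?_
    simp [MvPolynomial.degreeOf_X, MvPolynomial.degreeOf_C]
  · rw [mem_piAntidiag_univ] at hα
    have h1 := Finset.single_le_sum (f := α) (fun _ _ => Nat.zero_le _) (Finset.mem_univ i)
    have h2 := Finset.mem_range.mp hj
    omega

theorem continuous_coeff_mul {Y : Type*} [TopologicalSpace Y] {P Q : Y → MvPolynomial (Fin d) ℝ}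
    (hP : ∀ s, Continuous fun y => (P y).coeff s) (hQ : ∀ s, Continuous fun y => (Q y).coeff s)
    (s : Fin d →₀ ℕ) : Continuous fun y => (P y * Q y).coeff s := by
  simp only [MvPolynomial.coeff_mul]
  exact continuous_finsetSum _ fun a _ => (hP _).mul (hQ _)

theorem continuous_coeff_C {Y : Type*} [TopologicalSpace Y] {g : Y → ℝ} (hg : Continuous g)
    (s : Fin d →₀ ℕ) :
    Continuous fun y => (MvPolynomial.C (g y) : MvPolynomial (Fin d) ℝ).coeff s := by
  simp only [MvPolynomial.coeff_C]
  split_ifs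
  · exact hg
  · exact continuous_const

theorem continuous_coeff_taylorPoly (hf : ContDiff ℝ ∞ f) (N : ℕ) (s : Fin d →₀ ℕ) :
    Continuous fun y => (taylorPoly N f y).coeff s := by
  simp only [taylorPoly, MvPolynomial.coeff_sum]
  refine continuous_finsetSum _ fun j _ => continuous_finsetSum _ fun α _ => ?_
  refine continuous_coeff_mul (continuous_coeff_C
    ((contDiff_multiDeriv hf α).continuous.div_const _)) ?_ s
  have hpow : ∀ (i : Fin d) (n : ℕ) (s : Fin d →₀ ℕ), Continuous fun y : Fin d → ℝ =>
      ((MvPolynomial.X i - MvPolynomial.C (y i) : MvPolynomial (Fin d) ℝ) ^ n).coeff s := by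
    intro i n
    induction n with
    | zero => intro s; simpa using continuous_const
    | succ n ih =>
      intro s
      simp only [pow_succ]
      refine continuous_coeff_mul ih (fun t => ?_) s
      simp only [MvPolynomial.coeff_sub]
      exact continuous_const.sub (continuous_coeff_C (continuous_apply i) t)
  induction (Finset.univ : Finset (Fin d)) using Finset.induction_on with
  | empty => intro s; simpa using continuous_const
  | insert i S hi ih =>
    intro s
    simp only [Finset.prod_insert hi]
    exact continuous_coeff_mul (hpow i _) ih s

theorem pderiv_prod_eq_zero (i : Fin d) (S : Finset (Fin d)) (P : Fin d → MvPolynomial (Fin d) ℝ)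
    (hP : ∀ j ∈ S, MvPolynomial.pderiv i (P j) = 0) : MvPolynomial.pderiv i (∏ j ∈ S, P j) = 0 := by
  induction S using Finset.induction_on with
  | empty => simp
  | insert j S hj ih =>
    rw [Finset.prod_insert hj, Derivation.leibniz, hP j (Finset.mem_insert_self _ _),
      ih fun t ht => hP t (Finset.mem_insert_of_mem ht)]
    simp

theorem pderiv_prod_sub_pow (i : Fin d) (y : Fin d → ℝ) (α : Fin d → ℕ) :
    MvPolynomial.pderiv i (∏ j, (MvPolynomial.X j - MvPolynomial.C (y j) :
      MvPolynomial (Fin d) ℝ) ^ α j) =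
      MvPolynomial.C (α i : ℝ) * ((MvPolynomial.X i - MvPolynomial.C (y i)) ^ (α i - 1) *
        ∏ j ∈ Finset.univ.erase i, (MvPolynomial.X j - MvPolynomial.C (y j)) ^ α j) := by
  rw [← Finset.mul_prod_erase _ _ (Finset.mem_univ i), Derivation.leibniz,
    pderiv_prod_eq_zero, Derivation.leibniz_pow]
  · simp
    ring
  · intro j hj
    rw [Derivation.leibniz_pow]
    simp [MvPolynomial.pderiv_X, (Finset.ne_of_mem_erase hj).symm]

/-- The factor `α_i` from the power rule turns `1/α!` into `1/(α - e_i)!`. Through this identity a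
single averaged polynomial approximates `f` together with all its first derivatives. -/
theorem pderiv_taylorPoly (hf : ContDiff ℝ ∞ f) (N : ℕ) (y : Fin d → ℝ) (i : Fin d) :
    MvPolynomial.pderiv i (taylorPoly (N + 1) f y) = taylorPoly N (partialDeriv i f) y := by
  unfold taylorPoly
  rw [map_sum, Finset.sum_range_succ']
  have h0 : (MvPolynomial.pderiv i) (∑ α ∈ Finset.piAntidiag (Finset.univ : Finset (Fin d)) 0,
      MvPolynomial.C (multiDeriv α f y / ∏ i, ((α i).factorial : ℝ)) *
      ∏ i, (MvPolynomial.X i - MvPolynomial.C (y i)) ^ α i) = 0 := by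
    rw [map_sum]
    refine Finset.sum_eq_zero fun α hα => ?_
    rw [mem_piAntidiag_univ] at hα
    have : α i = 0 := Finset.sum_eq_zero_iff.mp hα i (Finset.mem_univ i)
    rw [MvPolynomial.pderiv_C_mul, pderiv_prod_sub_pow, this]
    simp
  rw [h0, add_zero]
  refine Finset.sum_congr rfl fun j _ => ?_
  rw [map_sum, sum_piAntidiag_succ i]
  · refine Finset.sum_congr rfl fun α _ => ?_
    rw [MvPolynomial.pderiv_C_mul, pderiv_prod_sub_pow, multiDeriv_add_single hf]
    rw [← Finset.mul_prod_erase _ (fun i => (MvPolynomial.X i - MvPolynomial.C (y i)) ^ α i)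
      (Finset.mem_univ i)]
    have h1 : ∏ j ∈ Finset.univ.erase i, (MvPolynomial.X j - MvPolynomial.C (y j) :
        MvPolynomial (Fin d) ℝ) ^ (α + Pi.single i 1 : Fin d → ℕ) j =
        ∏ j ∈ Finset.univ.erase i, (MvPolynomial.X j - MvPolynomial.C (y j)) ^ α j := by
      refine Finset.prod_congr rfl fun j hj => ?_
      simp [Finset.ne_of_mem_erase hj]
    have h2 : (∏ j, (((α + Pi.single i 1 : Fin d → ℕ) j).factorial : ℝ)) =
        (α i + 1) * ∏ j, ((α j).factorial : ℝ) := by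
      rw [← Finset.mul_prod_erase _ _ (Finset.mem_univ i),
        ← Finset.mul_prod_erase _ (fun j => ((α j).factorial : ℝ)) (Finset.mem_univ i), ← mul_assoc]
      congr 1
      · simp [Nat.factorial_succ]
      · refine Finset.prod_congr rfl fun j hj => ?_
        simp [Finset.ne_of_mem_erase hj]
    rw [h1, h2]
    have h3 : (∏ j, ((α j).factorial : ℝ)) ≠ 0 :=
      Finset.prod_ne_zero_iff.mpr fun j _ => by positivity
    simp only [Pi.add_apply, Pi.single_eq_same, Nat.add_sub_cancel]
    rw [← mul_assoc, ← MvPolynomial.C_mul]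
    congr 2
    have h4 : (α i : ℝ) + 1 ≠ 0 := by positivity
    push_cast
    field_simp
  · intro α hα
    rw [MvPolynomial.pderiv_C_mul, pderiv_prod_sub_pow, hα]
    simp

/-- The term of order `j` in the Taylor expansion of `f` in direction `v`, at the point `z`. -/
noncomputable def taylorTerm (j : ℕ) (f : (Fin d → ℝ) → ℝ) (v z : Fin d → ℝ) : ℝ :=
  ∑ α ∈ Finset.piAntidiag (Finset.univ : Finset (Fin d)) j,
    multiDeriv α f z * ∏ i, (v i ^ α i / ((α i).factorial : ℝ))

theorem hasDerivAt_comp_line (hf : ContDiff ℝ ∞ f) (y v : Fin d → ℝ) (s : ℝ) :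
    HasDerivAt (fun s : ℝ => f (y + s • v)) (∑ i, v i * partialDeriv i f (y + s • v)) s := by
  rw [← fderiv_apply_eq_sum_partialDeriv]
  have h1 : HasDerivAt (fun s : ℝ => y + s • v) v s := by
    simpa using ((hasDerivAt_id s).smul_const v).const_add y
  exact ((hf.differentiable (by simp)) _).hasFDerivAt.comp_hasDerivAt s h1

/-- Differentiation along `v` produces each `β` of order `j + 1` once from every `β - e_i` with `β_i
> 0`, with the weight `β_i v^β / β!`. The factor `j + 1` is the sum of the `β_i`. -/
theorem hasDerivAt_taylorTerm (hf : ContDiff ℝ ∞ f) (j : ℕ) (y v : Fin d → ℝ) (s : ℝ) :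
    HasDerivAt (fun s : ℝ => taylorTerm j f v (y + s • v))
      ((j + 1) * taylorTerm (j + 1) f v (y + s • v)) s := by
  have h1 : HasDerivAt (fun s : ℝ => taylorTerm j f v (y + s • v))
      (∑ α ∈ Finset.piAntidiag (Finset.univ : Finset (Fin d)) j,
        (∑ i, v i * multiDeriv (α + Pi.single i 1) f (y + s • v)) *
          ∏ i, (v i ^ α i / ((α i).factorial : ℝ))) s := by
    refine HasDerivAt.fun_sum fun α _ => HasDerivAt.mul_const ?_ _
    simp_rw [← partialDeriv_multiDeriv hf]
    exact hasDerivAt_comp_line (contDiff_multiDeriv hf α) y v s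
  convert h1 using 1
  simp_rw [Finset.sum_mul]
  rw [Finset.sum_comm]
  have h2 : ∀ i, ∑ α ∈ Finset.piAntidiag (Finset.univ : Finset (Fin d)) j,
      v i * multiDeriv (α + Pi.single i 1) f (y + s • v) *
          ∏ i, (v i ^ α i / ((α i).factorial : ℝ)) =
      ∑ α ∈ Finset.piAntidiag (Finset.univ : Finset (Fin d)) (j + 1),
        α i * (multiDeriv α f (y + s • v) * ∏ i, (v i ^ α i / ((α i).factorial : ℝ))) := by
    intro i
    rw [sum_piAntidiag_succ i _ _ (fun α hα => by simp [hα])]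
    refine Finset.sum_congr rfl fun α _ => ?_
    obtain ⟨β, hβ⟩ : ∃ β, β = α + Pi.single i 1 := ⟨_, rfl⟩
    have hi : β i = α i + 1 := by simp [hβ]
    have hj : ∀ j ∈ Finset.univ.erase i, β j = α j := fun j hj => by
      simp [hβ, Finset.ne_of_mem_erase hj]
    rw [← hβ, ← Finset.mul_prod_erase _ (fun j => v j ^ α j / ((α j).factorial : ℝ))
        (Finset.mem_univ i), ← Finset.mul_prod_erase _ (fun j => v j ^ β j / ((β j).factorial : ℝ))
        (Finset.mem_univ i),
      Finset.prod_congr rfl fun j h => show v j ^ β j / ((β j).factorial : ℝ) =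
        v j ^ α j / ((α j).factorial : ℝ) by rw [hj j h], hi, Nat.factorial_succ]
    have h4 : (α i : ℝ) + 1 ≠ 0 := by positivity
    push_cast
    field_simp
    ring
  rw [Finset.sum_congr rfl fun i _ => h2 i, Finset.sum_comm, taylorTerm, Finset.mul_sum]
  refine Finset.sum_congr rfl fun α hα => ?_
  rw [mem_piAntidiag_univ] at hα
  rw [← Finset.sum_mul, ← Nat.cast_sum, hα]
  push_cast
  ring

theorem eval_taylorPoly_add_smul (N : ℕ) (f : (Fin d → ℝ) → ℝ) (x y : Fin d → ℝ) :
    MvPolynomial.eval x (taylorPoly N f y) =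
      ∑ j ∈ Finset.range N, taylorTerm j f (x - y) y := by
  rw [eval_taylorPoly]
  rfl

theorem continuous_taylorTerm (hf : ContDiff ℝ ∞ f) (j : ℕ) :
    Continuous fun p : (Fin d → ℝ) × (Fin d → ℝ) => taylorTerm j f p.1 p.2 := by
  refine continuous_finsetSum _ fun α _ => ?_
  refine ((contDiff_multiDeriv hf α).continuous.comp continuous_snd).mul ?_
  exact continuous_finsetProd _ fun i _ =>
    (((continuous_apply i).comp continuous_fst).pow _).div_const _

/-- Taylor's formula with integral remainder. -/
theorem taylor_formula (hf : ContDiff ℝ ∞ f) (N : ℕ) (x y : Fin d → ℝ) :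
    f x - MvPolynomial.eval x (taylorPoly (N + 1) f y) =
      ∫ s in (0 : ℝ)..1, (N + 1) * (1 - s) ^ N * taylorTerm (N + 1) f (x - y) (y + s • (x - y)) := by
  -- This sum is the Taylor polynomial expanded at the moving point `y + s(x - y)` and evaluated at
  -- `x`. It equals `f x` at `s = 1`, where only `j = 0` survives, and the Taylor polynomial at `y`
  -- for `s = 0`. Its derivative telescopes to the last term.
  have hder : ∀ s : ℝ, HasDerivAt
      (fun s : ℝ => ∑ j ∈ Finset.range (N + 1),
        (1 - s) ^ j * taylorTerm j f (x - y) (y + s • (x - y)))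
      ((N + 1) * (1 - s) ^ N * taylorTerm (N + 1) f (x - y) (y + s • (x - y))) s := by
    intro s
    have h1 : ∀ j : ℕ, HasDerivAt (fun s : ℝ => (1 - s) ^ j) (j * (1 - s) ^ (j - 1) * -1) s := by
      intro j
      simpa using ((hasDerivAt_id s).const_sub 1).fun_pow j
    have h2 := HasDerivAt.fun_sum (u := Finset.range (N + 1))
      fun j _ => (h1 j).fun_mul (hasDerivAt_taylorTerm hf j y (x - y) s)
    have h3 : ∀ n : ℕ, ∑ j ∈ Finset.range (n + 1), (↑j * (1 - s) ^ (j - 1) * -1 *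
        taylorTerm j f (x - y) (y + s • (x - y)) + (1 - s) ^ j * ((↑j + 1) *
        taylorTerm (j + 1) f (x - y) (y + s • (x - y)))) =
        (n + 1) * (1 - s) ^ n * taylorTerm (n + 1) f (x - y) (y + s • (x - y)) := by
      intro n
      induction n with
      | zero => simp
      | succ n ih =>
        rw [Finset.sum_range_succ, ih]
        push_cast
        ring
    exact h2.congr_deriv (h3 N)
  rw [intervalIntegral.integral_eq_sub_of_hasDerivAt (fun s _ => hder s)]
  · rw [eval_taylorPoly_add_smul, Finset.sum_range_succ']
    simp [taylorTerm, Finset.sum_range_succ']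
  · refine Continuous.intervalIntegrable ?_ _ _
    refine (by fun_prop : Continuous fun s : ℝ => ((N : ℝ) + 1) * (1 - s) ^ N).mul ?_
    exact (continuous_taylorTerm hf (N + 1)).comp
      (continuous_const.prodMk (by fun_prop : Continuous fun s : ℝ => y + s • (x - y)))

end Taylor

end RDG

namespace RDG

/-! ### Averaged Taylor polynomials -/

section AveragedTaylor

variable {d : ℕ} {f : (Fin d → ℝ) → ℝ}

theorem map_homothety_volume (x : Fin d → ℝ) {t : ℝ} (ht : 0 < t) :
    Measure.map (fun y : Fin d → ℝ => y + (1 - t) • (x - y)) volume =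
      ENNReal.ofReal ((t ^ d)⁻¹) • (volume : Measure (Fin d → ℝ)) := by
  have h1 : (fun y : Fin d → ℝ => y + (1 - t) • (x - y)) =
      (fun y => y + (1 - t) • x) ∘ fun y => t • y := by
    ext y i
    simp
    ring
  rw [h1, ← Measure.map_map (measurable_add_const _) (measurable_const_smul t),
    Measure.map_addHaar_smul _ ht.ne', Measure.map_smul, map_add_right_eq_self]
  simp [abs_of_pos ht]

/-- The map `y ↦ y + s(x - y)` sends the convex box into itself and contracts volume by `(1-s)^d`,
so the `L²` norm grows by at most `(1-s)^{-d/2}`. For `d ≤ 2` one factor `1 - s` compensates for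
this. -/
theorem eLpNorm_comp_homothety_le (hd : d ≤ 2) (l r x : Fin d → ℝ) (hx : x ∈ Icc l r)
    {g : (Fin d → ℝ) → ℝ} (hg : Continuous g) {s : ℝ} (hs0 : 0 ≤ s) (hs1 : s < 1) :
    ENNReal.ofReal (1 - s) *
        eLpNorm (fun y => g (y + s • (x - y))) 2 (volume.restrict (Icc l r)) ≤
      eLpNorm g 2 (volume.restrict (Icc l r)) := by
  set φ : (Fin d → ℝ) → (Fin d → ℝ) := fun y => y + s • (x - y) with hφ
  have ht : 0 < 1 - s := by linarith
  have hφm : Measurable φ := by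
    have : Continuous φ := by fun_prop
    exact this.measurable
  have hsub : Icc l r ⊆ φ ⁻¹' Icc l r := by
    intro y hy
    exact (convex_Icc l r).add_smul_sub_mem hy hx ⟨hs0, hs1.le⟩
  have hmap : Measure.map φ (volume.restrict (φ ⁻¹' Icc l r)) =
      ENNReal.ofReal (((1 - s) ^ d)⁻¹) • volume.restrict (Icc l r) := by
    rw [← Measure.restrict_map hφm measurableSet_Icc, ← Measure.restrict_smul,
      ← map_homothety_volume x ht]
    simp [hφ]
  calc ENNReal.ofReal (1 - s) * eLpNorm (g ∘ φ) 2 (volume.restrict (Icc l r))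
      ≤ ENNReal.ofReal (1 - s) * eLpNorm (g ∘ φ) 2 (volume.restrict (φ ⁻¹' Icc l r)) := by
        gcongr
    _ = ENNReal.ofReal (1 - s) * (ENNReal.ofReal (((1 - s) ^ d)⁻¹) ^ (1 / 2 : ℝ) *
          eLpNorm g 2 (volume.restrict (Icc l r))) := by
        rw [← eLpNorm_map_measure hg.aestronglyMeasurable hφm.aemeasurable, hmap,
          eLpNorm_smul_measure_of_ne_top (by simp)]
        simp
    _ ≤ 1 * eLpNorm g 2 (volume.restrict (Icc l r)) := by
        rw [← mul_assoc]
        gcongr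
        rw [ENNReal.ofReal_rpow_of_nonneg (by positivity) (by norm_num),
          ← ENNReal.ofReal_mul ht.le, ← ENNReal.ofReal_one]
        refine ENNReal.ofReal_le_ofReal ?_
        rw [← Real.sqrt_eq_rpow]
        have h1 : 1 - s ≤ 1 := by linarith
        have h2 : (1 - s) ^ 2 ≤ (1 - s) ^ d := pow_le_pow_of_le_one ht.le h1 hd
        calc (1 - s) * √((1 - s) ^ d)⁻¹ = √((1 - s) ^ 2 * ((1 - s) ^ d)⁻¹) := by
              rw [Real.sqrt_mul (by positivity), Real.sqrt_sq ht.le]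
          _ ≤ √1 := by
              refine Real.sqrt_le_sqrt ?_
              rw [← div_eq_mul_inv]
              exact div_le_one_of_le₀ h2 (by positivity)
          _ = 1 := Real.sqrt_one
    _ = _ := one_mul _

/-- After exchanging the integrals, Cauchy–Schwarz on the box and the contraction estimate give a
bound independent of `s`. The end point `s = 1`, where the contraction degenerates, has weight zero.
-/
theorem lintegral_homothety_le (hd : d ≤ 2) (l r x : Fin d → ℝ) (hx : x ∈ Icc l r)
    {g : (Fin d → ℝ) → ℝ} (hg : Continuous g) :
    ∫⁻ y in Icc l r, ∫⁻ s in Ioc (0 : ℝ) 1, ENNReal.ofReal (1 - s) * ‖g (y + s • (x - y))‖ₑ ≤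
      volume (Icc l r) ^ (1 / 2 : ℝ) * eLpNorm g 2 (volume.restrict (Icc l r)) := by
  rw [lintegral_lintegral_swap]
  · have h : ∀ s ∈ Ioc (0 : ℝ) 1,
        ∫⁻ y in Icc l r, ENNReal.ofReal (1 - s) * ‖g (y + s • (x - y))‖ₑ ≤
          volume (Icc l r) ^ (1 / 2 : ℝ) * eLpNorm g 2 (volume.restrict (Icc l r)) := by
      intro s hs
      rcases hs.2.eq_or_lt with rfl | hs1
      · simp
      have hcont : Continuous fun y => g (y + s • (x - y)) := hg.comp (by fun_prop)
      rw [lintegral_const_mul' _ _ ENNReal.ofReal_ne_top, ← eLpNorm_one_eq_lintegral_enorm]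
      calc _ ≤ ENNReal.ofReal (1 - s) *
            (eLpNorm (fun y => g (y + s • (x - y))) 2 (volume.restrict (Icc l r)) *
              (volume.restrict (Icc l r)) univ ^ (1 / (1 : ℝ≥0∞).toReal - 1 / (2 : ℝ≥0∞).toReal)) := by
            gcongr
            exact eLpNorm_le_eLpNorm_mul_rpow_measure_univ (by norm_num) hcont.aestronglyMeasurable
        _ = (ENNReal.ofReal (1 - s) *
            eLpNorm (fun y => g (y + s • (x - y))) 2 (volume.restrict (Icc l r))) *
              volume (Icc l r) ^ (1 / 2 : ℝ) := by
            rw [Measure.restrict_apply_univ, mul_assoc]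
            norm_num
        _ ≤ _ := by
            rw [mul_comm]
            gcongr
            exact eLpNorm_comp_homothety_le hd l r x hx hg hs.1.le hs1
    refine (setLIntegral_mono measurable_const h).trans ?_
    simp
  · refine Measurable.aemeasurable ?_
    have h1 : Continuous fun p : (Fin d → ℝ) × ℝ => g (p.1 + p.2 • (x - p.1)) :=
      hg.comp (by fun_prop)
    have h2 : Continuous fun p : (Fin d → ℝ) × ℝ => 1 - p.2 := by fun_prop
    exact (ENNReal.measurable_ofReal.comp h2.measurable).mul h1.measurable.enorm

theorem abs_taylorTerm_le (j : ℕ) (f : (Fin d → ℝ) → ℝ) {v : Fin d → ℝ} (z : Fin d → ℝ) {ρ : ℝ}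
    (hv : ∀ i, |v i| ≤ ρ) :
    |taylorTerm j f v z| ≤ ρ ^ j * ∑ α ∈ Finset.piAntidiag (Finset.univ : Finset (Fin d)) j,
      |multiDeriv α f z| := by
  rw [Finset.mul_sum]
  refine (Finset.abs_sum_le_sum_abs _ _).trans (Finset.sum_le_sum fun α hα => ?_)
  rw [abs_mul, mul_comm]
  refine mul_le_mul_of_nonneg_right ?_ (abs_nonneg _)
  rw [Finset.abs_prod]
  rw [mem_piAntidiag_univ] at hα
  calc (∏ i, (|v i ^ α i / ((α i).factorial : ℝ)|)) ≤ ∏ i, ρ ^ α i := by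
        refine Finset.prod_le_prod (fun i _ => abs_nonneg _) fun i _ => ?_
        rw [abs_div, abs_pow, Nat.abs_cast]
        have h1 : (1 : ℝ) ≤ (α i).factorial := by
          exact_mod_cast Nat.factorial_pos (α i)
        exact (div_le_self (by positivity) h1).trans (pow_le_pow_left₀ (abs_nonneg _) (hv i) _)
    _ = ρ ^ j := by rw [Finset.prod_pow_eq_pow_sum, hα]

/-- The remainder formula is integrated over the expansion point `y` as well. Since `N ≥ 1`, the
weight satisfies `(1-s)^N ≤ 1 - s`, which is what the contraction estimate needs. Each of the
finitely many derivatives of order `N + 1` then contributes at most `B`, and the powers of the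
volume cancel. -/
theorem enorm_sub_average_taylorPoly_le (hf : ContDiff ℝ ∞ f) (hd : d ≤ 2) {N : ℕ} (hN : 1 ≤ N)
    {l r : Fin d → ℝ} (hlr : ∀ i, l i < r i) {ρ : ℝ} (hρ : ∀ i, r i - l i ≤ ρ) (hρ0 : 0 ≤ ρ)
    {B : ℝ≥0∞} (hB : ∀ α : Fin d → ℕ, ∑ i, α i = N + 1 →
      eLpNorm (multiDeriv α f) 2 (volume.restrict (Icc l r)) ≤ B)
    {x : Fin d → ℝ} (hx : x ∈ Icc l r) :
    volume (Icc l r) ^ (1 / 2 : ℝ) *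
        ‖f x - ⨍ y in Icc l r, MvPolynomial.eval x (taylorPoly (N + 1) f y)‖ₑ ≤
      ENNReal.ofReal ((N + 1) * ρ ^ (N + 1) *
        (Finset.piAntidiag (Finset.univ : Finset (Fin d)) (N + 1)).card) * B := by
  have hV0 : volume (Icc l r) ≠ 0 := by
    rw [Real.volume_Icc_pi]
    exact Finset.prod_ne_zero_iff.mpr fun i _ => by simpa using hlr i
  have hVt : volume (Icc l r) ≠ ⊤ := isCompact_Icc.measure_lt_top.ne
  have hcont : Continuous fun y => MvPolynomial.eval x (taylorPoly (N + 1) f y) := by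
    simp_rw [eval_taylorPoly]
    refine continuous_finsetSum _ fun j _ => continuous_finsetSum _ fun α _ =>
      (contDiff_multiDeriv hf α).continuous.mul ?_
    fun_prop
  have havg : f x - ⨍ y in Icc l r, MvPolynomial.eval x (taylorPoly (N + 1) f y) =
      (volume.real (Icc l r))⁻¹ * ∫ y in Icc l r,
        (f x - MvPolynomial.eval x (taylorPoly (N + 1) f y)) := by
    have hr : volume.real (Icc l r) ≠ 0 := by
      rw [Measure.real, ENNReal.toReal_ne_zero]; exact ⟨hV0, hVt⟩
    rw [integral_sub (integrableOn_const (C := f x) hVt).integrable hcont.continuousOn.integrableOn_Icc, setAverage_eq]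
    simp only [integral_const, smul_eq_mul, measureReal_restrict_apply_univ]
    field_simp
  set c : ℝ := (N + 1) * ρ ^ (N + 1) with hc
  have hc0 : 0 ≤ c := by positivity
  set A := Finset.piAntidiag (Finset.univ : Finset (Fin d)) (N + 1) with hA
  have hpt : ∀ y ∈ Icc l r, ‖f x - MvPolynomial.eval x (taylorPoly (N + 1) f y)‖ₑ ≤
      ∑ α ∈ A, ENNReal.ofReal c * ∫⁻ s in Ioc (0 : ℝ) 1,
        ENNReal.ofReal (1 - s) * ‖multiDeriv α f (y + s • (x - y))‖ₑ := by
    intro y hy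
    rw [taylor_formula hf, intervalIntegral.integral_of_le zero_le_one]
    refine (enorm_integral_le_lintegral_enorm _).trans ?_
    have hm : ∀ α, Measurable fun s : ℝ =>
        ENNReal.ofReal (1 - s) * ‖multiDeriv α f (y + s • (x - y))‖ₑ := by
      intro α
      have h1 : Continuous fun s : ℝ => multiDeriv α f (y + s • (x - y)) :=
        (contDiff_multiDeriv hf α).continuous.comp (by fun_prop)
      exact (ENNReal.measurable_ofReal.comp (by fun_prop)).mul h1.measurable.enorm
    simp_rw [← lintegral_const_mul _ (hm _)]
    rw [← lintegral_finsetSum _ fun α _ => (hm α).const_mul _]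
    refine setLIntegral_mono (Finset.measurable_sum _ fun α _ => (hm α).const_mul _)
      fun s hs => ?_
    have hs1 : 0 ≤ 1 - s := by linarith [hs.2]
    have hpow : (1 - s) ^ N ≤ 1 - s := by
      simpa using pow_le_pow_of_le_one hs1 (by linarith [hs.1] : 1 - s ≤ 1) hN
    have hv : ∀ i, |(x - y) i| ≤ ρ := fun i => by
      have h1 := hx.1 i; have h2 := hx.2 i; have h3 := hy.1 i; have h4 := hy.2 i
      have h5 := hρ i
      rw [Pi.sub_apply, abs_le]
      constructor <;> linarith
    have h1 : |(N + 1) * (1 - s) ^ N * taylorTerm (N + 1) f (x - y) (y + s • (x - y))| ≤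
        ∑ α ∈ A, c * ((1 - s) * |multiDeriv α f (y + s • (x - y))|) := by
      rw [abs_mul, abs_of_nonneg (by positivity : 0 ≤ ((N : ℝ) + 1) * (1 - s) ^ N),
        ← Finset.mul_sum, ← Finset.mul_sum]
      have h2 := abs_taylorTerm_le (N + 1) f (y + s • (x - y)) hv
      calc _ ≤ ((N : ℝ) + 1) * (1 - s) * (ρ ^ (N + 1) * ∑ α ∈ A,
            |multiDeriv α f (y + s • (x - y))|) := by gcongr
        _ = _ := by rw [hc]; ring
    rw [Real.enorm_eq_ofReal_abs]
    refine (ENNReal.ofReal_le_ofReal h1).trans_eq ?_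
    rw [ENNReal.ofReal_sum_of_nonneg fun α _ => by positivity]
    refine Finset.sum_congr rfl fun α _ => ?_
    rw [ENNReal.ofReal_mul hc0, ENNReal.ofReal_mul hs1, Real.enorm_eq_ofReal_abs]
  have hint : ‖∫ y in Icc l r, (f x - MvPolynomial.eval x (taylorPoly (N + 1) f y))‖ₑ ≤
      A.card * (ENNReal.ofReal c * (volume (Icc l r) ^ (1 / 2 : ℝ) * B)) := by
    refine (enorm_integral_le_lintegral_enorm _).trans ?_
    have hm : ∀ α, Measurable fun y => ∫⁻ s in Ioc (0 : ℝ) 1,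
        ENNReal.ofReal (1 - s) * ‖multiDeriv α f (y + s • (x - y))‖ₑ := by
      intro α
      refine Measurable.lintegral_prod_right' (f := fun p : (Fin d → ℝ) × ℝ =>
        ENNReal.ofReal (1 - p.2) * ‖multiDeriv α f (p.1 + p.2 • (x - p.1))‖ₑ) ?_
      have h1 : Continuous fun p : (Fin d → ℝ) × ℝ => multiDeriv α f (p.1 + p.2 • (x - p.1)) :=
        (contDiff_multiDeriv hf α).continuous.comp (by fun_prop)
      have h2 : Continuous fun p : (Fin d → ℝ) × ℝ => 1 - p.2 := by fun_prop
      exact (ENNReal.measurable_ofReal.comp h2.measurable).mul h1.measurable.enorm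
    refine (setLIntegral_mono (Finset.measurable_sum _ fun α _ => (hm α).const_mul _) hpt).trans ?_
    rw [lintegral_finsetSum _ fun α _ => (hm α).const_mul _, ← nsmul_eq_mul]
    refine Finset.sum_le_card_nsmul _ _ _ fun α hα => ?_
    rw [lintegral_const_mul _ (hm α)]
    gcongr
    refine (lintegral_homothety_le hd l r x hx (contDiff_multiDeriv hf α).continuous).trans ?_
    gcongr
    exact hB α (mem_piAntidiag_univ.mp hα)
  rw [havg, enorm_mul]
  have hVinv : ‖(volume.real (Icc l r))⁻¹‖ₑ = (volume (Icc l r))⁻¹ := by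
    have hpos : 0 < volume.real (Icc l r) := ENNReal.toReal_pos hV0 hVt
    rw [Real.enorm_eq_ofReal_abs, abs_of_pos (by positivity), ENNReal.ofReal_inv_of_pos hpos,
      Measure.real, ENNReal.ofReal_toReal hVt]
  rw [hVinv]
  calc _ ≤ volume (Icc l r) ^ (1 / 2 : ℝ) * ((volume (Icc l r))⁻¹ *
        (A.card * (ENNReal.ofReal c * (volume (Icc l r) ^ (1 / 2 : ℝ) * B)))) := by gcongr
    _ = (volume (Icc l r) ^ (1 / 2 : ℝ) * volume (Icc l r) ^ (1 / 2 : ℝ)) *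
        (volume (Icc l r))⁻¹ * (ENNReal.ofReal c * A.card * B) := by ring
    _ = ENNReal.ofReal c * A.card * B := by
        rw [← ENNReal.rpow_add _ _ hV0 hVt]
        norm_num
        rw [ENNReal.mul_inv_cancel hV0 hVt, one_mul]
    _ = _ := by
        rw [ENNReal.ofReal_mul hc0, ENNReal.ofReal_natCast]

theorem abs_sub_le_of_abs_partialDeriv_le {w : (Fin d → ℝ) → ℝ} (hw : ContDiff ℝ ∞ w)
    {l r : Fin d → ℝ} {E : ℝ} (hE : ∀ x ∈ Icc l r, ∀ i, |partialDeriv i w x| ≤ E) (hE0 : 0 ≤ E)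
    {x y : Fin d → ℝ} (hx : x ∈ Icc l r) (hy : y ∈ Icc l r) :
    |w x - w y| ≤ d * E * ‖x - y‖ := by
  refine (convex_Icc l r).norm_image_sub_le_of_norm_fderiv_le (𝕜 := ℝ) (f := w)
    (fun z _ => hw.differentiable (by simp) z) (fun z hz => ?_) hy hx
  refine ContinuousLinearMap.opNorm_le_bound _ (by positivity) fun v => ?_
  rw [fderiv_apply_eq_sum_partialDeriv, Real.norm_eq_abs]
  refine (Finset.abs_sum_le_sum_abs _ _).trans ?_
  calc ∑ i, |v i * partialDeriv i w z| ≤ ∑ _i : Fin d, ‖v‖ * E := by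
        refine Finset.sum_le_sum fun i _ => ?_
        rw [abs_mul]
        exact mul_le_mul (norm_le_pi_norm v i) (hE z hz i) (abs_nonneg _) (norm_nonneg _)
    _ = d * E * ‖v‖ := by simp; ring

/-- A constant for the approximation by averaged Taylor polynomials. -/
noncomputable def taylorConst (d k : ℕ) : ℝ :=
  k * (Finset.piAntidiag (Finset.univ : Finset (Fin d)) k).card

theorem taylorConst_nonneg (d k : ℕ) : 0 ≤ taylorConst d k := by
  unfold taylorConst; positivity

/-- Approximation of a smooth function by a polynomial on a box. -/
theorem exists_poly_approx_of_contDiff (hf : ContDiff ℝ ∞ f) (hd : d ≤ 2) {k : ℕ} (hk : 2 ≤ k)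
    {l r : Fin d → ℝ} (hlr : ∀ i, l i < r i) {ρ : ℝ} (hρ : ∀ i, r i - l i ≤ ρ) (hρ0 : 0 ≤ ρ)
    {B : ℝ} (hB0 : 0 ≤ B) (hB : ∀ α : Fin d → ℕ, ∑ i, α i = k + 1 →
      eLpNorm (multiDeriv α f) 2 (volume.restrict (Icc l r)) ≤ ENNReal.ofReal B)
    {E : ℝ} (hE : taylorConst d k * ρ ^ k * B ≤ E * √(∏ i, (r i - l i))) :
    ∃ q : MvPolynomial (Fin d) ℝ, (∀ i, q.degreeOf i ≤ k) ∧
      (∀ x ∈ Icc l r, ∀ i, |partialDeriv i f x - MvPolynomial.eval x (MvPolynomial.pderiv i q)| ≤ E) ∧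
      (∀ x ∈ Icc l r, |f x - MvPolynomial.eval x q| ≤ d * E * ρ) ∧
      ∀ x ∈ Icc l r, ∀ y ∈ Icc l r, |(f x - MvPolynomial.eval x q) -
        (f y - MvPolynomial.eval y q)| ≤ d * E * ‖x - y‖ := by
  obtain ⟨N, rfl⟩ : ∃ N, k = N + 1 := ⟨k - 1, by omega⟩
  -- Terms of order at most `N + 1 = k` are kept. The derivative of `q` then averages the Taylor
  -- polynomials of `∂_i f` with terms of order at most `N`, whose remainder involves derivatives of
  -- `f` of order `k + 1`.
  obtain ⟨q, hqd, hq⟩ := exists_average_poly l r (taylorPoly (N + 2) f)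
    (fun y i => degreeOf_taylorPoly_le (N + 1) f y i) (continuous_coeff_taylorPoly hf _)
  have hVpos : 0 < ∏ i, (r i - l i) := Finset.prod_pos fun i _ => by linarith [hlr i]
  have hV : volume (Icc l r) ^ (1 / 2 : ℝ) = ENNReal.ofReal √(∏ i, (r i - l i)) := by
    rw [Real.volume_Icc_pi, ← ENNReal.ofReal_prod_of_nonneg fun i _ => by linarith [hlr i],
      ENNReal.ofReal_rpow_of_nonneg hVpos.le (by norm_num), ← Real.sqrt_eq_rpow]
  have hgrad : ∀ x ∈ Icc l r, ∀ i,
      |partialDeriv i f x - MvPolynomial.eval x (MvPolynomial.pderiv i q)| ≤ E := by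
    intro x hx i
    have h1 := enorm_sub_average_taylorPoly_le (contDiff_partialDeriv hf i) hd
      (by omega : 1 ≤ N) hlr hρ hρ0 (B := ENNReal.ofReal B) (fun α hα => by
        rw [← multiDeriv_add_single hf]
        exact hB _ (by rw [sum_add_single, hα])) hx
    have h2 : ⨍ y in Icc l r, MvPolynomial.eval x (taylorPoly (N + 1) (partialDeriv i f) y) =
        MvPolynomial.eval x (MvPolynomial.pderiv i q) := by
      rw [← evalPderivₗ_apply, hq]
      simp_rw [evalPderivₗ_apply, pderiv_taylorPoly hf]
    rw [h2, hV, Real.enorm_eq_ofReal_abs, ← ENNReal.ofReal_mul (Real.sqrt_nonneg _),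
      ← ENNReal.ofReal_mul (by positivity), ENNReal.ofReal_le_ofReal_iff (by positivity)] at h1
    have hs : 0 < √(∏ i, (r i - l i)) := Real.sqrt_pos.mpr hVpos
    refine le_of_mul_le_mul_left ?_ hs
    refine h1.trans ((le_of_eq ?_).trans (hE.trans_eq (mul_comm _ _)))
    simp only [taylorConst]
    push_cast
    ring
  by_cases hbox : (Icc l r).Nonempty
  swap
  · rw [not_nonempty_iff_eq_empty] at hbox
    exact ⟨q, hqd, hgrad, by simp [hbox], by simp [hbox]⟩
  have hl : l ∈ Icc l r := left_mem_Icc.mpr (nonempty_Icc.mp hbox)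
  -- A constant makes the error vanish at the corner `l` without affecting the gradient. The bound
  -- on the values then follows from the Lipschitz bound and the diameter of the box.
  set q' := q + MvPolynomial.C (f l - MvPolynomial.eval l q) with hq'
  have hgrad' : ∀ x ∈ Icc l r, ∀ i,
      |partialDeriv i f x - MvPolynomial.eval x (MvPolynomial.pderiv i q')| ≤ E := by
    simpa [hq'] using hgrad
  have hw : ContDiff ℝ ∞ fun x => f x - MvPolynomial.eval x q' := hf.sub (contDiff_eval q')
  have hlip : ∀ x ∈ Icc l r, ∀ y ∈ Icc l r, |(f x - MvPolynomial.eval x q') -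
        (f y - MvPolynomial.eval y q')| ≤ d * E * ‖x - y‖ := by
    intro x hx y hy
    have hpd : ∀ z i, partialDeriv i (fun x => f x - MvPolynomial.eval x q') z =
        partialDeriv i f z - MvPolynomial.eval z (MvPolynomial.pderiv i q') := by
      intro z i
      have := congrFun (partialDeriv_eval i q') z
      rw [← this]
      unfold partialDeriv
      rw [fderiv_fun_sub (hf.differentiable (by simp) z)
        ((contDiff_eval q').differentiable (by simp) z)]
      rfl
    have hE0 : 0 ≤ E := by
      by_contra hneg
      have h3 := mul_nonneg (mul_nonneg (taylorConst_nonneg d (N + 1))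
        (pow_nonneg hρ0 (N + 1))) hB0
      have h4 := mul_neg_of_neg_of_pos (not_le.mp hneg) (Real.sqrt_pos.mpr hVpos)
      linarith
    exact abs_sub_le_of_abs_partialDeriv_le hw
      (fun z hz i => by rw [hpd]; exact hgrad' z hz i) hE0 hx hy
  refine ⟨q', fun i => ?_, hgrad', fun x hx => ?_, hlip⟩
  · refine (MvPolynomial.degreeOf_add_le _ _ _).trans (max_le (hqd i) ?_)
    rw [MvPolynomial.degreeOf_C]
    exact Nat.zero_le _
  · have h5 := hlip x hx l hl
    have h6 : f l - MvPolynomial.eval l q' = 0 := by simp [hq']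
    rw [h6, sub_zero] at h5
    have h0 : 0 ≤ d * E := by
      rcases Nat.eq_zero_or_pos d with rfl | hdp
      · simp
      · have := (abs_nonneg _).trans (hgrad' x hx ⟨0, hdp⟩)
        positivity
    refine h5.trans (mul_le_mul_of_nonneg_left ?_ h0)
    refine (pi_norm_le_iff_of_nonneg hρ0).mpr fun i => ?_
    have h7 := hx.1 i
    have h8 := hx.2 i
    have h9 := hρ i
    rw [Pi.sub_apply, Real.norm_eq_abs, abs_le]
    constructor <;> linarith

end AveragedTaylor

end RDG

namespace RDG

/-! ### Mollification -/

section Mollify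

variable {d : ℕ} {f g : (Fin d → ℝ) → ℝ}

/-- The convolution of a kernel `f` with a function `g`. -/
noncomputable def mollify (f g : (Fin d → ℝ) → ℝ) : (Fin d → ℝ) → ℝ :=
  convolution f g (ContinuousLinearMap.lsmul ℝ ℝ) volume

theorem mollify_apply (f g : (Fin d → ℝ) → ℝ) (x : Fin d → ℝ) :
    mollify f g x = ∫ t, f t * g (x - t) := rfl

theorem mollify_apply_swap (f g : (Fin d → ℝ) → ℝ) (x : Fin d → ℝ) :
    mollify f g x = ∫ t, f (x - t) * g t := convolution_lsmul_swap

theorem contDiff_mollify (hf : ContDiff ℝ ∞ f) (hc : HasCompactSupport f)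
    (hg : LocallyIntegrable g volume) : ContDiff ℝ ∞ (mollify f g) :=
  hc.contDiff_convolution_left (n := ⊤) _ hf hg

theorem partialDeriv_mollify (hf : ContDiff ℝ ∞ f) (hc : HasCompactSupport f)
    (hg : LocallyIntegrable g volume) (i : Fin d) :
    partialDeriv i (mollify f g) = mollify (partialDeriv i f) g := by
  ext x
  have h1 := hc.hasFDerivAt_convolution_left (ContinuousLinearMap.lsmul ℝ ℝ)
    (hf.of_le (by simp)) hg x
  have h2 : fderiv ℝ (mollify f g) x = _ := h1.fderiv
  have hcont : Continuous (fderiv ℝ f) := hf.continuous_fderiv (by simp)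
  have h3 := (hc.fderiv ℝ).convolutionExists_left
    (ContinuousLinearMap.precompL (Fin d → ℝ) (ContinuousLinearMap.lsmul ℝ ℝ)) hcont hg x
  rw [partialDeriv, h2, convolution_def, ContinuousLinearMap.integral_apply h3.integrable]
  rfl

theorem multiDeriv_mollify (hf : ContDiff ℝ ∞ f) (hc : HasCompactSupport f)
    (hg : LocallyIntegrable g volume) (α : Fin d → ℕ) :
    multiDeriv α (mollify f g) = mollify (multiDeriv α f) g := by
  induction α using multiIndex_induction with
  | zero => simp
  | add α i ih =>
    rw [← partialDeriv_multiDeriv (contDiff_mollify hf hc hg), ih,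
      partialDeriv_mollify (contDiff_multiDeriv hf α) (hasCompactSupport_multiDeriv hf hc α) hg,
      partialDeriv_multiDeriv hf]

/-- Mollification commutes with weak derivatives away from the boundary. -/
theorem multiDeriv_mollify_indicator (hf : ContDiff ℝ ∞ f) (hc : HasCompactSupport f)
    {U : Set (Fin d → ℝ)} (hU : MeasurableSet U) {u w : (Fin d → ℝ) → ℝ} {α : Fin d → ℕ}
    (hu : LocallyIntegrable (U.indicator u) volume) (hw : IsWeakDeriv U α u w)
    {x : Fin d → ℝ} (hx : ∀ y, x - y ∈ tsupport f → y ∈ U) :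
    multiDeriv α (mollify f (U.indicator u)) x = mollify f (U.indicator w) x := by
  rw [multiDeriv_mollify hf hc hu, mollify_apply_swap, mollify_apply_swap]
  have hind : ∀ (p v : (Fin d → ℝ) → ℝ), ∫ t, p (x - t) * U.indicator v t =
      ∫ t in U, v t * p (x - t) := by
    intro p v
    rw [← integral_indicator hU]
    congr 1
    ext t
    by_cases ht : t ∈ U <;> simp [ht, mul_comm]
  rw [hind, hind]
  have hsm : ContDiff ℝ ∞ fun y => f (x - y) := hf.comp (contDiff_const.sub contDiff_id)
  have hts : tsupport (fun y => f (x - y)) ⊆ (fun y => x - y) ⁻¹' tsupport f :=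
    tsupport_comp_subset_preimage f (by fun_prop)
  have hcs : HasCompactSupport fun y => f (x - y) :=
    hc.comp_homeomorph (Homeomorph.subLeft x)
  -- The reflected kernel `y ↦ f (x - y)` is an admissible test function precisely because `x` stays
  -- away from the boundary.
  have h := hw.2.2 _ hsm hcs (hts.trans fun y hy => hx y hy)
  rw [multiDeriv_reflect hf] at h
  have hsgn : ((-1 : ℝ) ^ ∑ i, α i) * (-1) ^ ∑ i, α i = 1 := by
    rw [← mul_pow]; simp
  calc _ = ((-1 : ℝ) ^ ∑ i, α i) *
        ∫ t in U, u t * ((-1) ^ (∑ i, α i) * multiDeriv α f (x - t)) := by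
        rw [← integral_const_mul]
        congr 1
        ext t
        linear_combination (-(u t * multiDeriv α f (x - t))) * hsgn
    _ = _ := by rw [h, ← mul_assoc, hsgn, one_mul]

/-- Mollification with a probability density does not increase the `L²` norm. -/
theorem eLpNorm_mollify_le_of_measurable (hf : Continuous f) (hc : HasCompactSupport f)
    (hf0 : ∀ x, 0 ≤ f x) (hf1 : ∫ x, f x = 1) (hg : Measurable g) :
    eLpNorm (mollify f g) 2 volume ≤ eLpNorm g 2 volume := by
  have hone : ∫⁻ x, ENNReal.ofReal (f x) = 1 := by
    rw [← ofReal_integral_eq_lintegral_ofReal (hf.integrable_of_hasCompactSupport hc)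
      (Filter.Eventually.of_forall hf0), hf1, ENNReal.ofReal_one]
  have hfm : Measurable fun x => ENNReal.ofReal (f x) := hf.measurable.ennreal_ofReal
  have hpt : ∀ x, ‖mollify f g x‖ₑ ^ (2 : ℝ) ≤
      ∫⁻ t, ENNReal.ofReal (f t) * ‖g (x - t)‖ₑ ^ (2 : ℝ) := by
    intro x
    have hgx : Measurable fun t => ‖g (x - t)‖ₑ :=
      (hg.comp (measurable_const.sub measurable_id)).enorm
    have h1 : ‖mollify f g x‖ₑ ≤ ∫⁻ t, ENNReal.ofReal (f t) * ‖g (x - t)‖ₑ := by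
      rw [mollify_apply]
      refine (enorm_integral_le_lintegral_enorm _).trans_eq ?_
      refine lintegral_congr fun t => ?_
      rw [enorm_mul, Real.enorm_eq_ofReal (hf0 t)]
    -- Cauchy–Schwarz with the kernel split as `f^{1/2} · f^{1/2}`; the first factor integrates to
    -- `1`. Tonelli and translation invariance then finish the estimate.
    have h2 : ∫⁻ t, ENNReal.ofReal (f t) * ‖g (x - t)‖ₑ ≤
        (∫⁻ t, ENNReal.ofReal (f t) * ‖g (x - t)‖ₑ ^ (2 : ℝ)) ^ (1 / 2 : ℝ) := by
      have h3 := ENNReal.lintegral_mul_le_Lp_mul_Lq volume Real.HolderConjugate.two_two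
        (hfm.pow_const (1 / 2 : ℝ)).aemeasurable
        ((hfm.pow_const (1 / 2 : ℝ)).mul hgx).aemeasurable
      have h4 : ∀ a : ℝ≥0∞, (a ^ (1 / 2 : ℝ)) ^ (2 : ℝ) = a := fun a => by
        rw [← ENNReal.rpow_mul]; norm_num
      have h5 : ∀ a : ℝ≥0∞, a ^ (1 / 2 : ℝ) * a ^ (1 / 2 : ℝ) = a := fun a => by
        conv_rhs => rw [← h4 a]
        rw [ENNReal.rpow_two, sq]
      simp only [Pi.mul_apply, ← mul_assoc, h5] at h3
      simpa only [ENNReal.mul_rpow_of_nonneg _ _ (by norm_num : (0 : ℝ) ≤ 2), h4, hone,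
        ENNReal.one_rpow, one_mul] using h3
    calc ‖mollify f g x‖ₑ ^ (2 : ℝ) ≤
        ((∫⁻ t, ENNReal.ofReal (f t) * ‖g (x - t)‖ₑ ^ (2 : ℝ)) ^ (1 / 2 : ℝ)) ^ (2 : ℝ) := by
          gcongr; exact h1.trans h2
      _ = _ := by rw [← ENNReal.rpow_mul]; norm_num
  have hsq : ∫⁻ x, ‖mollify f g x‖ₑ ^ (2 : ℝ) ≤ ∫⁻ x, ‖g x‖ₑ ^ (2 : ℝ) := by
    calc _ ≤ ∫⁻ x, ∫⁻ t, ENNReal.ofReal (f t) * ‖g (x - t)‖ₑ ^ (2 : ℝ) := lintegral_mono hpt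
      _ = ∫⁻ t, ∫⁻ x, ENNReal.ofReal (f t) * ‖g (x - t)‖ₑ ^ (2 : ℝ) := by
          refine lintegral_lintegral_swap (Measurable.aemeasurable ?_)
          exact (hfm.comp measurable_snd).mul
            ((hg.comp (measurable_fst.sub measurable_snd)).enorm.pow_const _)
      _ = ∫⁻ t, ENNReal.ofReal (f t) * ∫⁻ x, ‖g x‖ₑ ^ (2 : ℝ) := by
          refine lintegral_congr fun t => ?_
          rw [lintegral_const_mul' _ _ ENNReal.ofReal_ne_top,
            lintegral_sub_right_eq_self (fun x => ‖g x‖ₑ ^ (2 : ℝ)) t]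
      _ = _ := by rw [lintegral_mul_const _ hfm, hone, one_mul]
  rw [eLpNorm_eq_lintegral_rpow_enorm_toReal (by simp) (by simp),
    eLpNorm_eq_lintegral_rpow_enorm_toReal (by simp) (by simp)]
  simp only [ENNReal.toReal_ofNat]
  gcongr

theorem eLpNorm_mollify_le (hf : Continuous f) (hc : HasCompactSupport f)
    (hf0 : ∀ x, 0 ≤ f x) (hf1 : ∫ x, f x = 1) (hg : AEStronglyMeasurable g volume) :
    eLpNorm (mollify f g) 2 volume ≤ eLpNorm g 2 volume := by
  have h1 : mollify f g = mollify f (hg.mk g) :=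
    convolution_congr _ (Filter.EventuallyEq.refl _ _) hg.ae_eq_mk
  rw [h1, eLpNorm_congr_ae hg.ae_eq_mk]
  exact eLpNorm_mollify_le_of_measurable hf hc hf0 hf1 hg.stronglyMeasurable_mk.measurable

end Mollify

/-! ### Weak derivatives on boxes -/

section Boxes

variable {d : ℕ}

theorem isOpen_openBox (l r : Fin d → ℝ) : IsOpen (openBox l r) :=
  isOpen_set_pi finite_univ fun _ _ => isOpen_Ioo

theorem measurableSet_openBox (l r : Fin d → ℝ) : MeasurableSet (openBox l r) :=
  (isOpen_openBox l r).measurableSet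

theorem mem_openBox {l r x : Fin d → ℝ} : x ∈ openBox l r ↔ ∀ i, l i < x i ∧ x i < r i := by
  simp [openBox, Set.mem_pi]

theorem openBox_subset_Icc (l r : Fin d → ℝ) : openBox l r ⊆ Icc l r := fun _ hx =>
  ⟨fun i => (mem_openBox.mp hx i).1.le, fun i => (mem_openBox.mp hx i).2.le⟩

theorem openBox_ae_eq_Icc (l r : Fin d → ℝ) :
    (openBox l r : Set (Fin d → ℝ)) =ᵐ[volume] Icc l r :=
  Measure.univ_pi_Ioo_ae_eq_Icc

theorem volume_openBox_lt_top (l r : Fin d → ℝ) : volume (openBox l r) < ⊤ :=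
  (measure_mono (openBox_subset_Icc l r)).trans_lt isCompact_Icc.measure_lt_top

theorem locallyIntegrable_indicator_of_memLp {l r : Fin d → ℝ} {u : (Fin d → ℝ) → ℝ}
    (hu : MemLp u 2 (volume.restrict (openBox l r))) :
    LocallyIntegrable ((openBox l r).indicator u) volume := by
  have : IsFiniteMeasure (volume.restrict (openBox l r)) :=
    ⟨by simpa using volume_openBox_lt_top l r⟩
  have h1 : IntegrableOn u (openBox l r) volume := hu.integrable (by norm_num)
  exact ((integrable_indicator_iff (measurableSet_openBox l r)).mpr h1).locallyIntegrable

theorem isWeakDeriv_mono {U V : Set (Fin d → ℝ)} (hVU : V ⊆ U) (hU : MeasurableSet U)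
    {α : Fin d → ℕ} {u g : (Fin d → ℝ) → ℝ} (h : IsWeakDeriv U α u g) :
    IsWeakDeriv V α u g := by
  refine ⟨h.1.mono_set hVU, h.2.1.mono_set hVU, fun φ hφ hc hs => ?_⟩
  have key : ∀ (v ψ : (Fin d → ℝ) → ℝ), tsupport ψ ⊆ tsupport φ →
      ∫ x in V, v x * ψ x = ∫ x in U, v x * ψ x := by
    intro v ψ hψ
    refine (setIntegral_eq_of_subset_of_forall_sdiff_eq_zero hU hVU fun x hx => ?_).symm
    have : x ∉ tsupport ψ := fun hx' => hx.2 (hs (hψ hx'))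
    rw [image_eq_zero_of_notMem_tsupport this, mul_zero]
  rw [key u _ (tsupport_multiDeriv_subset hφ α), key g φ subset_rfl]
  exact h.2.2 φ hφ hc (hs.trans hVU)

/-- This is the fundamental lemma of the calculus of variations, applied to `g - g'`. It makes the
infimum in `weakDerivNorm` equal to the norm of any weak derivative. -/
theorem IsWeakDeriv.ae_eq {U : Set (Fin d → ℝ)} (hU : IsOpen U) {α : Fin d → ℕ}
    {u g g' : (Fin d → ℝ) → ℝ} (h : IsWeakDeriv U α u g) (h' : IsWeakDeriv U α u g') :
    g =ᵐ[volume.restrict U] g' := by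
  have h0 : ∀ᵐ x, x ∈ U → (g - g') x = 0 := by
    refine hU.ae_eq_zero_of_integral_contDiff_smul_eq_zero (h.2.1.sub h'.2.1)
      fun φ hφ hc hs => ?_
    have hint : ∀ w : (Fin d → ℝ) → ℝ, LocallyIntegrableOn w U volume →
        Integrable (fun x => w x * φ x) volume := by
      intro w hw
      have h1 : IntegrableOn w (tsupport φ) volume :=
        hw.integrableOn_compact_subset hs hc
      have h2 : IntegrableOn (fun x => w x * φ x) (tsupport φ) volume :=
        h1.mul_continuousOn hφ.continuous.continuousOn hc
      refine (integrableOn_iff_integrable_of_support_subset ?_).mp h2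
      exact (Function.support_mul_subset_right _ _).trans (subset_tsupport φ)
    have hres : ∀ w : (Fin d → ℝ) → ℝ, ∫ x, w x * φ x = ∫ x in U, w x * φ x := by
      intro w
      refine (setIntegral_eq_integral_of_forall_compl_eq_zero fun x hx => ?_).symm
      rw [image_eq_zero_of_notMem_tsupport fun h => hx (hs h), mul_zero]
    have e1 := h.2.2 φ hφ hc hs
    have e2 := h'.2.2 φ hφ hc hs
    rw [e1] at e2
    have e3 : ∫ x in U, g x * φ x = ∫ x in U, g' x * φ x :=
      mul_left_cancel₀ (pow_ne_zero _ (by norm_num)) e2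
    calc ∫ x, φ x • (g - g') x = ∫ x, (g x * φ x - g' x * φ x) := by
          congr 1; ext x; simp; ring
      _ = 0 := by
          rw [integral_sub (hint g h.2.1) (hint g' h'.2.1), hres, hres, e3, sub_self]
  rw [Filter.EventuallyEq, ae_restrict_iff' hU.measurableSet]
  filter_upwards [h0] with x hx hxU
  exact sub_eq_zero.mp (hx hxU)

theorem weakDerivNorm_eq {U : Set (Fin d → ℝ)} (hU : IsOpen U) {α : Fin d → ℕ}
    {u g : (Fin d → ℝ) → ℝ} (h : IsWeakDeriv U α u g) :
    weakDerivNorm U α u = eLpNorm g 2 (volume.restrict U) := by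
  refine le_antisymm (iInf₂_le g h) (le_iInf₂ fun g' h' => ?_)
  exact (eLpNorm_congr_ae (h.ae_eq hU h')).le

end Boxes

end RDG

namespace RDG

/-! ### Polynomial approximation of Sobolev functions -/

section Approximation

variable {d k : ℕ}

theorem qCoeff_coeffPoly (c : (Fin d → Fin (k + 1)) → ℝ) : qCoeff k (coeffPoly d k c) = c := by
  ext β
  simp only [qCoeff, coeffPoly_apply, MvPolynomial.coeff_sum, MvPolynomial.coeff_monomial,
    EmbeddingLike.apply_eq_iff_eq]
  rw [Finset.sum_eq_single β]
  · simp
  · intro γ _ hγ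
    rw [if_neg]
    intro h
    exact hγ (funext fun i => Fin.ext (congrFun h i))
  · simp

/-- By continuity the polynomial vanishes on all of `U`. A ball in the sup norm is a product of
intervals, and a polynomial that vanishes on a product of infinite sets is zero. -/
theorem eq_zero_of_eval_eq_zero {U X : Set (Fin d → ℝ)} (hU : IsOpen U) (hne : U.Nonempty)
    (hX : ∀ᵐ x ∂volume.restrict U, x ∈ X) {p : MvPolynomial (Fin d) ℝ}
    (hp : ∀ x ∈ X, MvPolynomial.eval x p = 0) : p = 0 := by
  have hzero : ∀ x ∈ U, MvPolynomial.eval x p = 0 := by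
    have h1 : (fun x => MvPolynomial.eval x p) =ᵐ[volume.restrict U] fun _ => 0 := by
      filter_upwards [hX] with x hx using hp x hx
    have h2 := Measure.eqOn_open_of_ae_eq h1 hU (contDiff_eval p).continuous.continuousOn
      continuousOn_const
    exact fun x hx => h2 hx
  obtain ⟨x, hx⟩ := hne
  obtain ⟨ε, hε, hb⟩ := Metric.isOpen_iff.mp hU x hx
  refine MvPolynomial.funext_set (fun i => Metric.ball (x i) ε) (fun i => ?_) fun y hy => ?_
  · rw [Real.ball_eq_Ioo]
    exact Ioo_infinite (by linarith)
  · rw [map_zero]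
    refine hzero y (hb ?_)
    rw [ball_pi x hε]
    exact hy

/-- Coefficient vectors of polynomials that are bounded at almost every point are bounded. -/
theorem eventually_norm_le_of_pointwise {U X : Set (Fin d → ℝ)} (hU : IsOpen U) (hne : U.Nonempty)
    (hX : ∀ᵐ x ∂volume.restrict U, x ∈ X) (c : ℕ → (Fin d → Fin (k + 1)) → ℝ)
    (hc : ∀ x ∈ X, ∃ M : ℝ, ∀ᶠ j in Filter.atTop, |MvPolynomial.eval x (coeffPoly d k (c j))| ≤ M) :
    ∃ M : ℝ, ∀ᶠ j in Filter.atTop, ‖c j‖ ≤ M := by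
  let W := (Fin d → Fin (k + 1)) → ℝ
  let S : Set (Module.Dual ℝ W) := (fun x => evalₗ x ∘ₗ coeffPoly d k) '' X
  -- Evaluations at the points of `X` separate coefficient vectors, so they span the
  -- finite-dimensional dual. Boundedness passes from the evaluations to their span and thus to
  -- every coordinate.
  have hS : Submodule.span ℝ S = ⊤ := by
    refine Submodule.span_eq_top_of_ne_zero fun w hw => ?_
    by_contra! hcon
    refine hw ?_
    have h0 : coeffPoly d k w = 0 := by
      refine eq_zero_of_eval_eq_zero hU hne hX fun x hx => ?_
      have := hcon _ ⟨x, hx, rfl⟩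
      simpa [evalₗ_apply] using this
    rw [← qCoeff_coeffPoly w, h0]
    ext β
    simp only [qCoeff, MvPolynomial.coeff_zero]
    rfl
  have hall : ∀ Λ : Module.Dual ℝ W, ∃ M : ℝ, ∀ᶠ j in Filter.atTop, |Λ (c j)| ≤ M := by
    intro Λ
    have hΛ : Λ ∈ Submodule.span ℝ S := by rw [hS]; trivial
    induction hΛ using Submodule.span_induction with
    | mem Λ h =>
      obtain ⟨x, hx, rfl⟩ := h
      obtain ⟨M, hM⟩ := hc x hx
      exact ⟨M, by simpa [evalₗ_apply] using hM⟩
    | zero => exact ⟨0, by simp⟩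
    | add Λ Λ' _ _ h h' =>
      obtain ⟨M, hM⟩ := h
      obtain ⟨M', hM'⟩ := h'
      refine ⟨M + M', ?_⟩
      filter_upwards [hM, hM'] with j hj hj'
      exact (abs_add_le _ _).trans (add_le_add hj hj')
    | smul a Λ _ h =>
      obtain ⟨M, hM⟩ := h
      refine ⟨|a| * M, ?_⟩
      filter_upwards [hM] with j hj
      rw [LinearMap.smul_apply, smul_eq_mul, abs_mul]
      exact mul_le_mul_of_nonneg_left hj (abs_nonneg a)
  choose M hM using fun β : Fin d → Fin (k + 1) => hall (LinearMap.proj β)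
  refine ⟨∑ β, |M β|, ?_⟩
  filter_upwards [Filter.eventually_all.mpr hM] with j hj
  refine (pi_norm_le_iff_of_nonneg (by positivity)).mpr fun β => ?_
  refine ((hj β).trans (le_abs_self _)).trans ?_
  exact Finset.single_le_sum (f := fun β => |M β|) (fun _ _ => abs_nonneg _) (Finset.mem_univ β)

/-- A bump function of radius `ε` around the origin. -/
noncomputable def bump (d : ℕ) {ε : ℝ} (hε : 0 < ε) : ContDiffBump (0 : Fin d → ℝ) :=
  ⟨ε / 2, ε, by positivity, by linarith⟩

/-- Approximation of a Sobolev function by a polynomial on a box, with uniform control of the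
error and of its first derivatives. -/
theorem exists_poly_approx (hd : d ≤ 2) (hk : 2 ≤ k) {l r : Fin d → ℝ} (hlr : ∀ i, l i < r i)
    {ρ : ℝ} (hρ : ∀ i, r i - l i ≤ ρ) (hρ0 : 0 ≤ ρ) {u : (Fin d → ℝ) → ℝ}
    (hu : MemSobolev (k + 1) (openBox l r) u) {B : ℝ} (hB0 : 0 ≤ B)
    (hB : ∀ α : Fin d → ℕ, ∑ i, α i = k + 1 →
      weakDerivNorm (openBox l r) α u ≤ ENNReal.ofReal B)
    {E : ℝ} (hE0 : 0 ≤ E) (hE : taylorConst d k * ρ ^ k * B ≤ E * (√(∏ i, (r i - l i)) / 2)) :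
    ∃ q : MvPolynomial (Fin d) ℝ, (∀ i, q.degreeOf i ≤ k) ∧
      ∃ X ⊆ openBox l r, (∀ᵐ x ∂volume.restrict (openBox l r), x ∈ X) ∧
        (∀ x ∈ X, |u x - MvPolynomial.eval x q| ≤ d * E * ρ) ∧
        (∀ x ∈ X, ∀ y ∈ X, |(u x - MvPolynomial.eval x q) -
          (u y - MvPolynomial.eval y q)| ≤ d * E * ‖x - y‖) ∧
        ∀ i, ∃ g, IsWeakDeriv (openBox l r) (Pi.single i 1) u g ∧
          ∀ x ∈ X, |g x - MvPolynomial.eval x (MvPolynomial.pderiv i q)| ≤ E := by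
  set U := openBox l r with hUdef
  have hUo : IsOpen U := isOpen_openBox l r
  have hUm : MeasurableSet U := hUo.measurableSet
  have hUne : U.Nonempty := ⟨fun i => (l i + r i) / 2, mem_openBox.mpr fun i =>
    ⟨by linarith [hlr i], by linarith [hlr i]⟩⟩
  have hVpos : 0 < ∏ i, (r i - l i) := Finset.prod_pos fun i _ => by linarith [hlr i]
  choose g hgL hg using fun i : Fin d => hu.2 (Pi.single i 1) (by simp)
  have hε : ∀ j : ℕ, (0 : ℝ) < 1 / (j + 1) := fun j => by positivity
  have hεt : Filter.Tendsto (fun j : ℕ => (1 : ℝ) / (j + 1)) Filter.atTop (nhds 0) :=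
    tendsto_one_div_add_atTop_nhds_zero_nat
  let φ : ℕ → ContDiffBump (0 : Fin d → ℝ) := fun j => bump d (hε j)
  let ψ : ℕ → (Fin d → ℝ) → ℝ := fun j => (φ j).normed volume
  have hψs : ∀ j, ContDiff ℝ ∞ (ψ j) := fun j => (φ j).contDiff_normed
  have hψc : ∀ j, HasCompactSupport (ψ j) := fun j => (φ j).hasCompactSupport_normed
  have hψt : ∀ j, tsupport (ψ j) = Metric.closedBall 0 (1 / ((j : ℝ) + 1)) := fun j =>
    (φ j).tsupport_normed_eq
  have hconv : ∀ w : (Fin d → ℝ) → ℝ, MemLp w 2 (volume.restrict U) →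
      ∀ᵐ x ∂volume.restrict U, Filter.Tendsto (fun j => mollify (ψ j) (U.indicator w) x)
        Filter.atTop (nhds (w x)) := by
    intro w hw
    have h1 := ContDiffBump.ae_convolution_tendsto_right_of_locallyIntegrable
      (φ := φ) (l := Filter.atTop) (K := 2) (μ := volume) hεt
      (Filter.Eventually.of_forall fun j => by simp only [φ, bump]; linarith)
      (locallyIntegrable_indicator_of_memLp hw)
    filter_upwards [ae_restrict_of_ae h1, ae_restrict_mem hUm] with x hx hxU
    rwa [indicator_of_mem hxU] at hx
  -- The full-measure set where the mollifications of `u` and of its first weak derivatives converge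
  -- to the chosen representatives. All pointwise limits are taken there.
  let X : Set (Fin d → ℝ) := {x | x ∈ U ∧
    Filter.Tendsto (fun j => mollify (ψ j) (U.indicator u) x) Filter.atTop (nhds (u x)) ∧
    ∀ i, Filter.Tendsto (fun j => mollify (ψ j) (U.indicator (g i)) x) Filter.atTop
      (nhds (g i x))}
  have hX : ∀ᵐ x ∂volume.restrict U, x ∈ X := by
    filter_upwards [hconv u hu.1, ae_all_iff.mpr fun i => hconv (g i) (hgL i),
      ae_restrict_mem hUm] with x h1 h2 h3 using ⟨h3, h1, h2⟩
  -- The box is shrunk by twice the mollification radius, so that every closed ball of that radius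
  -- around a point of the smaller box lies in the open box.
  let lj : ℕ → Fin d → ℝ := fun j i => l i + 2 * (1 / ((j : ℝ) + 1))
  let rj : ℕ → Fin d → ℝ := fun j i => r i - 2 * (1 / ((j : ℝ) + 1))
  have hlj : ∀ i, Filter.Tendsto (fun j => lj j i) Filter.atTop (nhds (l i)) := fun i => by
    simpa [lj] using (hεt.const_mul 2).const_add (l i)
  have hrj : ∀ i, Filter.Tendsto (fun j => rj j i) Filter.atTop (nhds (r i)) := fun i => by
    simpa [rj] using (hεt.const_mul 2).const_sub (r i)
  have hin : ∀ x ∈ U, ∀ᶠ j in Filter.atTop, x ∈ Icc (lj j) (rj j) := by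
    intro x hx
    have h1 := Filter.eventually_all.mpr fun i => (hlj i).eventually_lt_const (mem_openBox.mp hx i).1
    have h2 := Filter.eventually_all.mpr fun i => (hrj i).eventually_const_lt (mem_openBox.mp hx i).2
    filter_upwards [h1, h2] with j hj1 hj2 using ⟨fun i => (hj1 i).le, fun i => (hj2 i).le⟩
  have hsm : ∀ j, ContDiff ℝ ∞ (mollify (ψ j) (U.indicator u)) := fun j =>
    contDiff_mollify (hψs j) (hψc j) (locallyIntegrable_indicator_of_memLp hu.1)
  have hder : ∀ j (α : Fin d → ℕ) (w : (Fin d → ℝ) → ℝ), IsWeakDeriv U α u w →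
      ∀ x ∈ Icc (lj j) (rj j), multiDeriv α (mollify (ψ j) (U.indicator u)) x =
        mollify (ψ j) (U.indicator w) x := by
    intro j α w hw x hx
    refine multiDeriv_mollify_indicator (hψs j) (hψc j) hUm
      (locallyIntegrable_indicator_of_memLp hu.1) hw fun y hy => ?_
    rw [hψt, mem_closedBall_zero_iff, pi_norm_le_iff_of_nonneg (hε j).le] at hy
    refine mem_openBox.mpr fun i => ?_
    have h1 := abs_le.mp (hy i)
    have h2 := hx.1 i
    have h3 := hx.2 i
    have h4 := hε j
    simp only [lj, rj, Pi.sub_apply] at h1 h2 h3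
    constructor <;> linarith
  have hex : ∀ᶠ j in Filter.atTop, ∃ q : MvPolynomial (Fin d) ℝ, (∀ i, q.degreeOf i ≤ k) ∧
      (∀ x ∈ Icc (lj j) (rj j), ∀ i, |mollify (ψ j) (U.indicator (g i)) x -
        MvPolynomial.eval x (MvPolynomial.pderiv i q)| ≤ E) ∧
      (∀ x ∈ Icc (lj j) (rj j),
        |mollify (ψ j) (U.indicator u) x - MvPolynomial.eval x q| ≤ d * E * ρ) ∧
      ∀ x ∈ Icc (lj j) (rj j), ∀ y ∈ Icc (lj j) (rj j),
        |(mollify (ψ j) (U.indicator u) x - MvPolynomial.eval x q) -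
          (mollify (ψ j) (U.indicator u) y - MvPolynomial.eval y q)| ≤ d * E * ‖x - y‖ := by
    have hvol : Filter.Tendsto (fun j => √(∏ i, (rj j i - lj j i))) Filter.atTop
        (nhds √(∏ i, (r i - l i))) :=
      (Real.continuous_sqrt.tendsto _).comp
        (tendsto_finsetProd _ fun i _ => (hrj i).sub (hlj i))
    have hspos : 0 < √(∏ i, (r i - l i)) := Real.sqrt_pos.mpr hVpos
    -- The factor `1/2` in `hE` is spent here: eventually the square root of the volume of the
    -- shrunken box exceeds half of the original one.
    filter_upwards [hvol.eventually_const_lt (half_lt_self hspos), Filter.eventually_all.mpr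
      fun i => (hlj i).eventually_lt (hrj i) (hlr i)] with j hj1 hj2
    obtain ⟨q, h1, h2, h3, h4⟩ := exists_poly_approx_of_contDiff (hsm j) hd hk (l := lj j)
      (r := rj j) hj2 (ρ := ρ) (fun i => by
        have := hε j
        have := hρ i
        simp only [lj, rj]
        linarith) hρ0 hB0 (fun α hα => by
        obtain ⟨w, hwL, hw⟩ := hu.2 α hα.le
        calc eLpNorm (multiDeriv α (mollify (ψ j) (U.indicator u))) 2
              (volume.restrict (Icc (lj j) (rj j)))
            = eLpNorm (mollify (ψ j) (U.indicator w)) 2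
              (volume.restrict (Icc (lj j) (rj j))) := by
              refine eLpNorm_congr_ae ?_
              filter_upwards [ae_restrict_mem measurableSet_Icc] with x hx
                using hder j α w hw x hx
          _ ≤ eLpNorm (mollify (ψ j) (U.indicator w)) 2 volume :=
              eLpNorm_mono_measure _ Measure.restrict_le_self
          _ ≤ eLpNorm (U.indicator w) 2 volume :=
              eLpNorm_mollify_le (hψs j).continuous (hψc j) (fun x => (φ j).nonneg_normed x)
                ((φ j).integral_normed) ((aestronglyMeasurable_indicator_iff hUm).mpr hwL.1)
          _ = eLpNorm w 2 (volume.restrict U) := eLpNorm_indicator_eq_eLpNorm_restrict hUm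
          _ ≤ ENNReal.ofReal B := by
              rw [← weakDerivNorm_eq hUo hw]
              exact hB α hα)
      (hE.trans (mul_le_mul_of_nonneg_left hj1.le hE0))
    refine ⟨q, h1, fun x hx i => ?_, h3, h4⟩
    rw [← hder j _ _ (hg i) x hx, multiDeriv_single (hsm j)]
    exact h2 x hx i
  obtain ⟨J, hJ⟩ := Filter.eventually_atTop.mp hex
  choose q hq1 hq2 hq3 hq4 using fun n : ℕ => hJ (n + J) (Nat.le_add_left _ _)
  have hshift : Filter.Tendsto (fun n : ℕ => n + J) Filter.atTop Filter.atTop :=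
    Filter.tendsto_add_atTop_nat J
  let c : ℕ → (Fin d → Fin (k + 1)) → ℝ := fun n => qCoeff k (q n)
  have hc : ∀ n, coeffPoly d k (c n) = q n := fun n => coeffPoly_qCoeff (hq1 n)
  -- Each mollification comes with its own polynomial. At a point of `X` the mollifications converge
  -- and the errors are bounded, so the polynomials are bounded there; hence the coefficients are
  -- bounded and a subsequence converges.
  obtain ⟨M, hM⟩ := eventually_norm_le_of_pointwise hUo hUne hX c (by
    intro x hx
    have hb := (hx.2.1.comp hshift).abs
    refine ⟨|u x| + 1 + d * E * ρ, ?_⟩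
    filter_upwards [hb.eventually_lt_const (lt_add_one |u x|), hshift.eventually (hin x hx.1)]
      with n hn1 hn2
    have h1 := hq3 n x hn2
    rw [hc]
    simp only [Function.comp] at hn1
    rw [abs_le] at h1 ⊢
    have h2 := abs_lt.mp hn1
    constructor <;> linarith)
  obtain ⟨c₀, -, σ, hσ, hlim⟩ := tendsto_subseq_of_frequently_bounded
    (Metric.isBounded_closedBall (x := (0 : (Fin d → Fin (k + 1)) → ℝ)) (r := M))
    ((hM.mono fun n hn => by simpa using hn).frequently)
  have hΛ : ∀ Λ : MvPolynomial (Fin d) ℝ →ₗ[ℝ] ℝ, Filter.Tendsto (fun n => Λ (q (σ n)))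
      Filter.atTop (nhds (Λ (coeffPoly d k c₀))) := by
    intro Λ
    simp_rw [← hc]
    have : Continuous fun c : (Fin d → Fin (k + 1)) → ℝ => Λ (coeffPoly d k c) := by
      simp_rw [linearMap_coeffPoly]
      fun_prop
    exact (this.tendsto c₀).comp hlim
  have hev : ∀ x, Filter.Tendsto (fun n => MvPolynomial.eval x (q (σ n)))
      Filter.atTop (nhds (MvPolynomial.eval x (coeffPoly d k c₀))) := fun x => by
    simpa only [evalₗ_apply] using hΛ (evalₗ x)
  have hsub : Filter.Tendsto (fun n => σ n + J) Filter.atTop Filter.atTop :=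
    hshift.comp hσ.tendsto_atTop
  refine ⟨coeffPoly d k c₀, degreeOf_coeffPoly_le _, X, fun x hx => hx.1, hX, ?_, ?_, ?_⟩
  · intro x hx
    refine le_of_tendsto ((hx.2.1.comp hsub).sub (hev x)).abs ?_
    filter_upwards [hsub.eventually (hin x hx.1)] with n hn using hq3 (σ n) x hn
  · intro x hx y hy
    refine le_of_tendsto (((hx.2.1.comp hsub).sub (hev x)).sub
      ((hy.2.1.comp hsub).sub (hev y))).abs ?_
    filter_upwards [hsub.eventually (hin x hx.1), hsub.eventually (hin y hy.1)] with n hn hn'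
      using hq4 (σ n) x hn y hn'
  · intro i
    refine ⟨g i, hg i, fun x hx => ?_⟩
    have hpe : Filter.Tendsto (fun n => MvPolynomial.eval x (MvPolynomial.pderiv i (q (σ n))))
        Filter.atTop (nhds (MvPolynomial.eval x (MvPolynomial.pderiv i (coeffPoly d k c₀)))) := by
      simpa only [evalPderivₗ_apply] using hΛ (evalPderivₗ i x)
    refine le_of_tendsto (((hx.2.2 i).comp hsub).sub hpe).abs ?_
    filter_upwards [hsub.eventually (hin x hx.1)] with n hn using hq2 (σ n) x hn i

end Approximation

end RDG

namespace RDG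

/-! ### Unisolvence of the moment problem on three adjacent intervals -/

section Unisolvence

open Polynomial in
-- In Rodrigues' formula the coefficient of `X^n` comes from the leading term `(-1)^n X^{2n}` of `(1
-- - X²)^n`.
theorem coeff_legendre_self_ne_zero (n : ℕ) : (legendre n).coeff n ≠ 0 := by
  have h1 : ((1 - X ^ 2 : ℝ[X]) ^ n).coeff (n + n) = (-1) ^ n := by
    have h2 : (1 - X ^ 2 : ℝ[X]).natDegree ≤ 2 := by compute_degree
    rw [← two_mul, mul_comm 2 n, coeff_pow_of_natDegree_le h2]
    congr 1
    simp [coeff_one]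
  rw [legendre, coeff_C_mul, coeff_iterate_derivative, h1]
  have h3 : (n + n).descFactorial n ≠ 0 := by
    rw [Ne, Nat.descFactorial_eq_zero_iff_lt]; omega
  simp only [nsmul_eq_mul]
  have : (n.factorial : ℝ) ≠ 0 := by positivity
  have h4 : (((n + n).descFactorial n : ℕ) : ℝ) ≠ 0 := by exact_mod_cast h3
  have h5 : ((-1 : ℝ)) ^ n ≠ 0 := pow_ne_zero _ (by norm_num)
  positivity

open Polynomial in
theorem natDegree_legendre_le (n : ℕ) : (legendre n).natDegree ≤ n := by
  refine (natDegree_C_mul_le _ _).trans ((natDegree_iterate_derivative _ _).trans ?_)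
  have h2 : (1 - X ^ 2 : ℝ[X]).natDegree ≤ 2 := by compute_degree
  have := (natDegree_pow_le (p := (1 - X ^ 2 : ℝ[X])) (n := n))
  have h3 : n * (1 - X ^ 2 : ℝ[X]).natDegree ≤ n * 2 := Nat.mul_le_mul_left _ h2
  omega

open Polynomial in
/-- A linear functional that vanishes on the Legendre polynomials of degree less than `M`
vanishes on all polynomials of degree less than `M`. -/
theorem linearMap_eq_zero_of_legendre (Φ : ℝ[X] →ₗ[ℝ] ℝ) {M : ℕ}
    (hΦ : ∀ n < M, Φ (legendre n) = 0) : ∀ q : ℝ[X], q.degree < M → Φ q = 0 := by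
  induction M with
  | zero =>
    intro q hq
    have : q = 0 := by simpa using hq
    rw [this, map_zero]
  | succ M ih =>
    intro q hq
    -- Subtracting this multiple of `legendre M` removes the term of degree `M`.
    set a := q.coeff M / (legendre M).coeff M with ha
    have h1 : (q - C a * legendre M).degree < M := by
      rw [degree_lt_iff_coeff_zero]
      intro n hn
      rcases hn.eq_or_lt with rfl | hn
      · rw [coeff_sub, coeff_C_mul, ha, div_mul_cancel₀ _ (coeff_legendre_self_ne_zero M), sub_self]
      · rw [coeff_sub, coeff_C_mul, coeff_eq_zero_of_natDegree_lt
          ((natDegree_legendre_le M).trans_lt hn),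
          coeff_eq_zero_of_degree_lt (hq.trans_le (by exact_mod_cast hn))]
        simp
    have h2 := ih (fun n hn => hΦ n (by omega)) _ h1
    rw [← smul_eq_C_mul, map_sub, map_smul, hΦ M (by omega)] at h2
    simpa using h2

open Polynomial in
theorem exists_antiderivative (p : ℝ[X]) (a : ℝ) :
    ∃ P : ℝ[X], derivative P = p ∧ P.natDegree ≤ p.natDegree + 1 ∧ P.eval a = 0 := by
  set Q : ℝ[X] := ∑ n ∈ Finset.range (p.natDegree + 1), C (p.coeff n / (n + 1)) * X ^ (n + 1)
    with hQ
  refine ⟨Q - C (Q.eval a), ?_, ?_, by simp⟩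
  · rw [derivative_sub, derivative_C, sub_zero, hQ, derivative_sum]
    conv_rhs => rw [p.as_sum_range_C_mul_X_pow]
    refine Finset.sum_congr rfl fun n _ => ?_
    rw [derivative_C_mul_X_pow, Nat.add_sub_cancel]
    congr 2
    have : (n : ℝ) + 1 ≠ 0 := by positivity
    push_cast
    field_simp
  · rw [natDegree_sub_C]
    refine natDegree_sum_le_of_forall_le _ _ fun n hn => ?_
    refine (natDegree_C_mul_X_pow_le _ _).trans ?_
    have := Finset.mem_range.mp hn
    omega

open Polynomial in
theorem integral_derivative_eq (P : ℝ[X]) (a b : ℝ) :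
    ∫ x in a..b, (derivative P).eval x = P.eval b - P.eval a :=
  intervalIntegral.integral_eq_sub_of_hasDerivAt (fun x _ => P.hasDerivAt x)
    ((derivative P).continuous.intervalIntegrable _ _)

open Polynomial in
-- Testing with `q = 1` shows that the antiderivative vanishing at the first node vanishes at all
-- four. Integration by parts, now free of boundary terms, makes it orthogonal to degree one less on
-- each interval, so the step can be repeated `M` times.
theorem exists_iterated_antiderivative {t : Fin 4 → ℝ} (M : ℕ) (p : ℝ[X])
    (hp : ∀ j : Fin 3, ∀ q : ℝ[X], q.degree < M →
      ∫ x in (t j.castSucc)..(t j.succ), p.eval x * q.eval x = 0) :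
    ∃ P : ℝ[X], derivative^[M] P = p ∧ P.natDegree ≤ p.natDegree + M ∧
      ∀ j : Fin 4, ∀ i < M, (derivative^[i] P).eval (t j) = 0 := by
  induction M generalizing p with
  | zero => exact ⟨p, rfl, le_rfl, by simp⟩
  | succ M ih =>
    obtain ⟨P₁, hP₁, hdeg₁, h0⟩ := exists_antiderivative p (t 0)
    have hstep : ∀ j : Fin 3, P₁.eval (t j.castSucc) = P₁.eval (t j.succ) := by
      intro j
      have h1 := hp j 1 (by
        rw [degree_one]; exact_mod_cast Nat.succ_pos M)
      simp only [eval_one, mul_one] at h1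
      rw [← hP₁, integral_derivative_eq] at h1
      linarith
    have hv : ∀ j : Fin 4, P₁.eval (t j) = 0 := by
      intro j
      have e1 := hstep 0
      have e2 := hstep 1
      have e3 := hstep 2
      simp at e1 e2 e3
      fin_cases j
      · exact h0
      · simpa [h0] using e1.symm
      · simpa [h0, ← e1] using e2.symm
      · have : P₁.eval (t 3) = 0 := by
          have : P₁.eval (t 2) = P₁.eval (t 3) := e3
          rw [← this]
          have : P₁.eval (t 1) = P₁.eval (t 2) := e2
          rw [← this, ← e1, h0]
        exact this
    obtain ⟨P, hP, hdeg, hz⟩ := ih P₁ (by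
      intro j q hq
      obtain ⟨Q, hQ, hQd, -⟩ := exists_antiderivative q 0
      have hQdeg : Q.degree < (M + 1 : ℕ) := by
        by_cases hq0 : q = 0
        · have : Q.natDegree ≤ 0 := by
            rw [hq0] at hQ
            exact (derivative_eq_zero.mp hQ).le
          refine (degree_le_natDegree.trans ?_).trans_lt (by exact_mod_cast Nat.succ_pos M :
            ((0 : ℕ) : WithBot ℕ) < (M + 1 : ℕ))
          exact_mod_cast this
        · have h1 : q.natDegree < M := (natDegree_lt_iff_degree_lt hq0).mpr hq
          refine degree_le_natDegree.trans_lt ?_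
          exact_mod_cast (by omega : Q.natDegree < M + 1)
      have h1 := hp j Q hQdeg
      -- Integration by parts with an antiderivative `Q` of `q`: the boundary terms vanish with `P₁`
      -- at the nodes, and the integral of `p Q` vanishes by hypothesis.
      have h2 := integral_derivative_eq (P₁ * Q) (t j.castSucc) (t j.succ)
      rw [eval_mul, eval_mul, hv, hv, derivative_mul, hP₁, hQ] at h2
      simp only [eval_add, eval_mul, zero_mul, sub_zero] at h2
      rw [intervalIntegral.integral_add
        (f := fun x => p.eval x * Q.eval x) (g := fun x => P₁.eval x * q.eval x)
        ((p.continuous.mul Q.continuous).intervalIntegrable _ _)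
        ((P₁.continuous.mul q.continuous).intervalIntegrable _ _), h1, zero_add] at h2
      exact h2)
    refine ⟨P, ?_, by omega, fun j i hi => ?_⟩
    · rw [Function.iterate_succ_apply', hP, hP₁]
    · rcases Nat.lt_succ_iff_lt_or_eq.mp hi with hi | rfl
      · exact hz j i hi
      · rw [hP]; exact hv j

open Polynomial in
/-- A polynomial of degree less than `3M` that is orthogonal to the polynomials of degree less
than `M` on three adjacent intervals vanishes. -/
theorem eq_zero_of_orthogonal {t : Fin 4 → ℝ} (ht : StrictMono t) {M : ℕ} {p : ℝ[X]}
    (hdeg : p.natDegree < 3 * M)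
    (hp : ∀ j : Fin 3, ∀ q : ℝ[X], q.degree < M →
      ∫ x in (t j.castSucc)..(t j.succ), p.eval x * q.eval x = 0) : p = 0 := by
  obtain ⟨P, hP, hPd, hz⟩ := exists_iterated_antiderivative M p hp
  by_cases hP0 : P = 0
  · rw [← hP, hP0, iterate_derivative_zero]
  exfalso
  obtain ⟨M, rfl⟩ : ∃ M', M = M' + 1 := ⟨M - 1, by omega⟩
  -- Four zeros of multiplicity `M + 1` force degree at least `4(M + 1)`, whereas `P` has degree
  -- below `3(M + 1) + (M + 1)`.
  have hdvd : ∀ j : Fin 4, (X - C (t j)) ^ (M + 1) ∣ P := by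
    intro j
    rw [← le_rootMultiplicity_iff hP0, Nat.succ_le_iff]
    refine lt_rootMultiplicity_of_isRoot_iterate_derivative hP0 fun i hi => ?_
    exact hz j i (by omega)
  have hprod : (∏ j : Fin 4, (X - C (t j)) ^ (M + 1)) ∣ P := by
    refine Finset.prod_dvd_of_coprime (fun i _ j _ hij => ?_) fun j _ => hdvd j
    exact (pairwise_coprime_X_sub_C ht.injective hij).pow
  have h1 := natDegree_le_of_dvd hprod hP0
  rw [natDegree_prod_of_monic _ _ fun j _ => (monic_X_sub_C _).pow _] at h1
  simp only [natDegree_pow, natDegree_X_sub_C, mul_one, Finset.sum_const, Finset.card_univ,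
    Fintype.card_fin, smul_eq_mul] at h1
  omega

end Unisolvence

/-! ### Legendre moments in one dimension -/

section Moments

/-- The Legendre moment of `F` on `[s, t]`, as an integral over the reference interval. -/
noncomputable def refMoment (s t : ℝ) (n : ℕ) (F : ℝ → ℝ) : ℝ :=
  (2 * n + 1) / 2 * ∫ ξ in (-1 : ℝ)..1, (legendre n).eval ξ * F ((s + t) / 2 + (t - s) / 2 * ξ)

theorem moment_interval_eq_refMoment {s t : ℝ} (hst : s < t) (n : ℕ) (F : ℝ → ℝ) :
    (2 * n + 1) / (t - s) *
      ∫ x in s..t, (legendre n).eval (2 * (x - (s + t) / 2) / (t - s)) * F x =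
    refMoment s t n F := by
  have hne : t - s ≠ 0 := by linarith
  have h := intervalIntegral.smul_integral_comp_add_mul (a := -1) (b := 1)
    (fun x => (legendre n).eval (2 * (x - (s + t) / 2) / (t - s)) * F x) ((t - s) / 2) ((s + t) / 2)
  have e1 : (s + t) / 2 + (t - s) / 2 * (-1) = s := by ring
  have e2 : (s + t) / 2 + (t - s) / 2 * 1 = t := by ring
  rw [e1, e2] at h
  rw [← h, refMoment, smul_eq_mul, ← mul_assoc]
  congr 1
  · field_simp
  · congr 1
    ext ξ
    congr 2
    field_simp
    ring

theorem moment_prod {d : ℕ} {l r : Fin d → ℝ} (hlr : ∀ i, l i < r i) (α : Fin d → ℕ)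
    (F : Fin d → ℝ → ℝ) :
    moment l r α (fun x => ∏ i, F i (x i)) = ∏ i, refMoment (l i) (r i) (α i) (F i) := by
  unfold moment legendreBasis
  simp_rw [← Finset.prod_mul_distrib]
  rw [← pi_univ_Icc, volume_pi, Measure.restrict_pi_pi,
    integral_fintype_prod_eq_prod (fun i x => Polynomial.eval
      (2 * (x - (l i + r i) / 2) / (r i - l i)) (legendre (α i)) * F i x), ← Finset.prod_mul_distrib]
  refine Finset.prod_congr rfl fun i _ => ?_
  rw [integral_Icc_eq_integral_Ioc, ← intervalIntegral.integral_of_le (hlr i).le,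
    moment_interval_eq_refMoment (hlr i)]

theorem refMoment_pow_scale (s t x₀ : ℝ) {h : ℝ} (n β : ℕ) :
    refMoment s t n (fun x => ((x - x₀) / h) ^ β) =
      refMoment ((s - x₀) / h) ((t - x₀) / h) n (fun x => x ^ β) := by
  unfold refMoment
  congr 2
  ext ξ
  congr 2
  ring

/-- On the reference interval the end points enter only through the affine map, with no division by
the length. This continuity feeds the compactness argument for the inverse moment matrix. -/
theorem continuous_refMoment_pow (n β : ℕ) :
    Continuous fun p : ℝ × ℝ => refMoment p.1 p.2 n (fun x => x ^ β) := by
  unfold refMoment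
  refine continuous_const.mul ?_
  refine intervalIntegral.continuous_parametric_intervalIntegral_of_continuous' ?_ _ _
  have := (legendre n).continuous
  unfold Function.uncurry
  fun_prop

end Moments

/-! ### The one-dimensional moment matrix -/

section MomentMatrix

variable {k m : ℕ}

/-- A numbering of the moments on three intervals. -/
noncomputable def momentIndex (hk : k + 1 = 3 * (m + 1)) : Fin (k + 1) ≃ Fin 3 × Fin (m + 1) :=
  Fintype.equivOfCardEq (by simp [hk])

/-- The matrix of the moments of the monomials on the three intervals between the nodes `t`. -/
noncomputable def momentMatrix (hk : k + 1 = 3 * (m + 1)) (t : Fin 4 → ℝ) :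
    Matrix (Fin (k + 1)) (Fin (k + 1)) ℝ :=
  Matrix.of fun e β => refMoment (t (momentIndex hk e).1.castSucc) (t (momentIndex hk e).1.succ)
    (momentIndex hk e).2 (fun x => x ^ (β : ℕ))

theorem continuous_momentMatrix (hk : k + 1 = 3 * (m + 1)) : Continuous (momentMatrix hk) := by
  refine continuous_matrix fun e β => ?_
  exact (continuous_refMoment_pow ((momentIndex hk e).2 : ℕ) (β : ℕ)).comp
    (by fun_prop : Continuous fun t : Fin 4 → ℝ =>
      (t (momentIndex hk e).1.castSucc, t (momentIndex hk e).1.succ))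

/-- A kernel vector consists of the coefficients of a polynomial of degree at most `k` whose moments
on the three intervals vanish. The Legendre polynomials of degree at most `m` span all polynomials
of that degree, so it is orthogonal to them on each interval and therefore zero. -/
theorem det_momentMatrix_ne_zero (hk : k + 1 = 3 * (m + 1)) {t : Fin 4 → ℝ} (ht : StrictMono t) :
    (momentMatrix hk t).det ≠ 0 := by
  intro hdet
  obtain ⟨c, hc0, hc⟩ := Matrix.exists_mulVec_eq_zero_iff.mpr hdet
  set p : Polynomial ℝ := ∑ β : Fin (k + 1), Polynomial.C (c β) * Polynomial.X ^ (β : ℕ) with hp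
  have hev : ∀ x, p.eval x = ∑ β : Fin (k + 1), c β * x ^ (β : ℕ) := by
    intro x; simp [hp, Polynomial.eval_finsetSum]
  have hcoeff : ∀ β : Fin (k + 1), p.coeff β = c β := by
    intro β
    simp only [hp, Polynomial.finsetSum_coeff, Polynomial.coeff_C_mul_X_pow]
    rw [Finset.sum_eq_single β]
    · simp
    · intro γ _ hγ
      rw [if_neg]
      exact fun h => hγ (Fin.ext h.symm)
    · simp
  have hdegp : p.natDegree < 3 * (m + 1) := by
    rw [← hk, Nat.lt_succ_iff]
    refine Polynomial.natDegree_sum_le_of_forall_le _ _ fun β _ => ?_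
    exact (Polynomial.natDegree_C_mul_X_pow_le _ _).trans (Nat.lt_succ_iff.mp β.2)
  have hmom : ∀ (j : Fin 3) (n : Fin (m + 1)),
      refMoment (t j.castSucc) (t j.succ) n (fun x => p.eval x) = 0 := by
    intro j n
    have h1 := congrFun hc ((momentIndex hk).symm (j, n))
    simp only [Matrix.mulVec, dotProduct, momentMatrix, Matrix.of_apply, Equiv.apply_symm_apply,
      Pi.zero_apply] at h1
    rw [← h1]
    simp only [refMoment, hev, Finset.mul_sum]
    rw [intervalIntegral.integral_finsetSum, Finset.mul_sum]
    · refine Finset.sum_congr rfl fun β _ => ?_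
      rw [mul_assoc, ← intervalIntegral.integral_mul_const]
      congr 2
      ext ξ
      ring
    · intro β _
      have := (legendre n).continuous
      exact Continuous.intervalIntegrable (by fun_prop) _ _
  have hzero : p = 0 := by
    refine eq_zero_of_orthogonal ht hdegp fun j q hq => ?_
    have hlt : t j.castSucc < t j.succ := ht (Fin.castSucc_lt_succ)
    set s := t j.castSucc
    set e := t j.succ
    let Φ : Polynomial ℝ →ₗ[ℝ] ℝ :=
      { toFun := fun q => ∫ ξ in (-1 : ℝ)..1, q.eval ξ * p.eval ((s + e) / 2 + (e - s) / 2 * ξ)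
        map_add' := fun q q' => by
          have h1 := p.continuous
          have h2 := q.continuous
          have h3 := q'.continuous
          simp only [Polynomial.eval_add, add_mul]
          exact intervalIntegral.integral_add (Continuous.intervalIntegrable (by fun_prop) _ _)
            (Continuous.intervalIntegrable (by fun_prop) _ _)
        map_smul' := fun a q => by
          simp only [Polynomial.eval_smul, smul_eq_mul, mul_assoc, RingHom.id_apply]
          exact intervalIntegral.integral_const_mul _ _ }
    have hΦ : ∀ n < m + 1, Φ (legendre n) = 0 := by
      intro n hn
      have h1 := hmom j ⟨n, hn⟩
      unfold refMoment at h1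
      have h2 : ((2 : ℝ) * n + 1) / 2 ≠ 0 := by positivity
      exact (mul_eq_zero.mp h1).resolve_left h2
    have h := intervalIntegral.smul_integral_comp_add_mul (a := -1) (b := 1)
      (fun x => p.eval x * q.eval x) ((e - s) / 2) ((s + e) / 2)
    have e1 : (s + e) / 2 + (e - s) / 2 * (-1) = s := by ring
    have e2 : (s + e) / 2 + (e - s) / 2 * 1 = e := by ring
    rw [e1, e2] at h
    rw [← h]
    -- The test polynomial `q` is pulled back to `[-1, 1]` by the affine map, which does not raise
    -- its degree.
    have hcomp := linearMap_eq_zero_of_legendre Φ hΦ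
      (q.comp (Polynomial.C ((s + e) / 2) + Polynomial.C ((e - s) / 2) * Polynomial.X)) (by
        by_cases hq0 : q = 0
        · simp [hq0]
        refine Polynomial.degree_le_natDegree.trans_lt ?_
        have h1 : q.natDegree < m + 1 := (Polynomial.natDegree_lt_iff_degree_lt hq0).mpr hq
        have h2 := Polynomial.natDegree_comp_le (p := q)
          (q := Polynomial.C ((s + e) / 2) + Polynomial.C ((e - s) / 2) * Polynomial.X)
        have h3 : (Polynomial.C ((s + e) / 2) + Polynomial.C ((e - s) / 2) *
            Polynomial.X).natDegree ≤ 1 := by compute_degree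
        have h4 := Nat.mul_le_mul_left q.natDegree h3
        exact_mod_cast (by omega : (q.comp (Polynomial.C ((s + e) / 2) +
          Polynomial.C ((e - s) / 2) * Polynomial.X)).natDegree < m + 1))
    have h5 : ∫ ξ in (-1 : ℝ)..1, p.eval ((s + e) / 2 + (e - s) / 2 * ξ) *
        q.eval ((s + e) / 2 + (e - s) / 2 * ξ) = 0 := by
      rw [← hcomp]
      change _ = ∫ ξ in (-1 : ℝ)..1, _
      congr 1
      ext ξ
      rw [Polynomial.eval_comp, mul_comm]
      simp only [Polynomial.eval_add, Polynomial.eval_mul, Polynomial.eval_C, Polynomial.eval_X]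
    rw [h5, smul_zero]
  refine hc0 (funext fun β => ?_)
  rw [← hcoeff, hzero]
  simp

/-- The inverse of the moment matrix is bounded uniformly over all node quadruples in `[-R, R]` with
gaps bounded from below. -/
theorem exists_inv_momentMatrix_bound (hk : k + 1 = 3 * (m + 1)) (R : ℝ) {δ : ℝ} (hδ : 0 < δ) :
    ∃ C : ℝ, 0 ≤ C ∧ ∀ t : Fin 4 → ℝ, (∀ j, |t j| ≤ R) →
      (∀ j : Fin 3, δ ≤ t j.succ - t j.castSucc) →
      ∀ β e, |(momentMatrix hk t)⁻¹ β e| ≤ C := by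
  let K : Set (Fin 4 → ℝ) := {t | (∀ j, |t j| ≤ R) ∧ ∀ j : Fin 3, δ ≤ t j.succ - t j.castSucc}
  have hKc : IsCompact K := by
    refine Metric.isCompact_of_isClosed_isBounded ?_ ?_
    · have h1 : IsClosed {t : Fin 4 → ℝ | ∀ j, |t j| ≤ R} := by
        rw [ofPred_forall]
        exact isClosed_iInter fun j => isClosed_le (by fun_prop) continuous_const
      have h2 : IsClosed {t : Fin 4 → ℝ | ∀ j : Fin 3, δ ≤ t j.succ - t j.castSucc} := by
        rw [ofPred_forall]
        exact isClosed_iInter fun j => isClosed_le continuous_const (by fun_prop)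
      exact h1.inter h2
    · refine (Metric.isBounded_closedBall (x := (0 : Fin 4 → ℝ)) (r := |R|)).subset fun t ht => ?_
      rw [mem_closedBall_zero_iff, pi_norm_le_iff_of_nonneg (abs_nonneg R)]
      exact fun j => (ht.1 j).trans (le_abs_self R)
  have hmono : ∀ t ∈ K, StrictMono t := fun t ht =>
    Fin.strictMono_iff_lt_succ.mpr fun j => by linarith [ht.2 j]
  have hcont : ContinuousOn (fun t => (momentMatrix hk t)⁻¹) K := by
    -- By the cofactor formula the inverse is continuous wherever the determinant is nonzero, in
    -- particular on the compact set `K`.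
    simp_rw [Matrix.inv_def, Ring.inverse_eq_inv']
    have h1 := continuous_momentMatrix hk
    have h2 : ContinuousOn (fun t => (momentMatrix hk t).det⁻¹) K :=
      h1.matrix_det.continuousOn.inv₀ fun t ht => det_momentMatrix_ne_zero hk (hmono t ht)
    exact h2.smul h1.matrix_adjugate.continuousOn
  have hex : ∀ β e, ∃ C : ℝ, ∀ t ∈ K, ‖(momentMatrix hk t)⁻¹ β e‖ ≤ C := fun β e =>
    hKc.exists_bound_of_continuousOn
      ((continuous_id.matrix_elem β e).comp_continuousOn hcont)
  choose C hC using hex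
  refine ⟨∑ β, ∑ e, |C β e|, by positivity, fun t h1 h2 β e => ?_⟩
  refine ((hC β e t ⟨h1, h2⟩).trans (le_abs_self _)).trans ?_
  refine (Finset.single_le_sum (f := fun e => |C β e|) (fun _ _ => abs_nonneg _)
    (Finset.mem_univ e)).trans ?_
  exact Finset.single_le_sum (f := fun β => ∑ e, |C β e|)
    (fun _ _ => Finset.sum_nonneg fun _ _ => abs_nonneg _) (Finset.mem_univ β)

end MomentMatrix

end RDG

namespace RDG

/-! ### The tensor product moment problem -/

section TensorProduct

variable {d k m : ℕ}

/-- The action of the tensor product of the matrices `A i`. -/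
def tensorApply {n : ℕ} (A : Fin d → Matrix (Fin n) (Fin n) ℝ) (c : (Fin d → Fin n) → ℝ) :
    (Fin d → Fin n) → ℝ :=
  fun e => ∑ β, (∏ i, A i (e i) (β i)) * c β

/-- The sum over all `β` of products over the directions is the product over the directions of
one-dimensional sums, and each of these is an entry of `A i * B i`. -/
theorem tensorApply_tensorApply {n : ℕ} {A B : Fin d → Matrix (Fin n) (Fin n) ℝ}
    (hAB : ∀ i, A i * B i = 1) (c : (Fin d → Fin n) → ℝ) :
    tensorApply A (tensorApply B c) = c := by
  ext e
  simp only [tensorApply, Finset.mul_sum]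
  rw [Finset.sum_comm]
  have h1 : ∀ e' : Fin d → Fin n, ∑ β : Fin d → Fin n, (∏ i, A i (e i) (β i)) * ((∏ i, B i (β i) (e' i)) * c e') =
      (if e = e' then 1 else 0) * c e' := by
    intro e'
    simp_rw [← mul_assoc, ← Finset.prod_mul_distrib, ← Finset.sum_mul]
    congr 1
    rw [← Fintype.piFinset_univ]
    refine (Finset.prod_univ_sum (fun _ => Finset.univ)
      (fun i b => A i (e i) b * B i b (e' i))).symm.trans ?_
    have h2 : ∀ i, ∑ b, A i (e i) b * B i b (e' i) = if e i = e' i then 1 else 0 := by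
      intro i
      rw [← Matrix.mul_apply, hAB i, Matrix.one_apply]
    simp_rw [h2]
    rw [Finset.prod_ite_zero]
    simp [funext_iff]
  simp_rw [h1]
  simp

theorem abs_tensorApply_le {n : ℕ} {A : Fin d → Matrix (Fin n) (Fin n) ℝ} {a ε : ℝ}
    (hA : ∀ i e β, |A i e β| ≤ a) (ha : 0 ≤ a) {c : (Fin d → Fin n) → ℝ} (hc : ∀ β, |c β| ≤ ε)
    (e : Fin d → Fin n) : |tensorApply A c e| ≤ (n ^ d : ℕ) * (a ^ d * ε) := by
  refine (Finset.abs_sum_le_sum_abs _ _).trans ?_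
  have h1 : ∀ β ∈ (Finset.univ : Finset (Fin d → Fin n)),
      |(∏ i, A i (e i) (β i)) * c β| ≤ a ^ d * ε := by
    intro β _
    rw [abs_mul]
    refine mul_le_mul ?_ (hc β) (abs_nonneg _) (by positivity)
    rw [Finset.abs_prod]
    refine (Finset.prod_le_prod (fun i _ => abs_nonneg _) fun i _ => hA i _ _).trans ?_
    simp
  refine (Finset.sum_le_card_nsmul _ _ _ h1).trans ?_
  simp

/-- Lower corner of the cell number `o` of the `3 × ⋯ × 3` patch with the nodes `τ`. -/
def patchLower (τ : Fin d → Fin 4 → ℝ) (o : Fin d → Fin 3) : Fin d → ℝ :=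
  fun i => τ i (o i).castSucc

/-- Upper corner of the cell number `o` of the `3 × ⋯ × 3` patch with the nodes `τ`. -/
def patchUpper (τ : Fin d → Fin 4 → ℝ) (o : Fin d → Fin 3) : Fin d → ℝ :=
  fun i => τ i (o i).succ

theorem continuous_legendreBasis (l r : Fin d → ℝ) (α : Fin d → ℕ) :
    Continuous (legendreBasis l r α) := by
  unfold legendreBasis
  refine continuous_finsetProd _ fun i _ => ?_
  exact (legendre (α i)).continuous.comp (by fun_prop)

theorem moment_finsetSum {ι : Type*} (s : Finset ι) (l r : Fin d → ℝ) (α : Fin d → ℕ)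
    (c : ι → ℝ) {F : ι → (Fin d → ℝ) → ℝ} (hF : ∀ j, Continuous (F j)) :
    moment l r α (fun x => ∑ j ∈ s, c j * F j x) = ∑ j ∈ s, c j * moment l r α (F j) := by
  unfold moment
  simp_rw [Finset.mul_sum]
  rw [integral_finsetSum, Finset.mul_sum]
  · refine Finset.sum_congr rfl fun j _ => ?_
    rw [mul_left_comm, ← integral_const_mul (c j)]
    congr 2
    ext x
    ring
  · intro j _
    have h1 := continuous_legendreBasis l r α
    have h2 := hF j
    exact (by fun_prop : Continuous fun x => legendreBasis l r α x * (c j * F j x)).continuousOn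
      |>.integrableOn_Icc

theorem moment_sub {l r : Fin d → ℝ} (α : Fin d → ℕ) {u v : (Fin d → ℝ) → ℝ}
    (hu : IntegrableOn u (Icc l r)) (hv : IntegrableOn v (Icc l r)) :
    moment l r α (fun x => u x - v x) = moment l r α u - moment l r α v := by
  unfold moment
  have h1 : ∀ w, IntegrableOn w (Icc l r) →
      IntegrableOn (fun x => legendreBasis l r α x * w x) (Icc l r) := fun w hw =>
    hw.continuousOn_mul (continuous_legendreBasis l r α).continuousOn isCompact_Icc
  simp_rw [mul_sub]
  rw [integral_sub (h1 u hu) (h1 v hv), mul_sub]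

/-- The nodes in the coordinates `(x - x₀) / h`. -/
noncomputable def scaledNodes (τ : Fin d → Fin 4 → ℝ) (x₀ : Fin d → ℝ) (h : ℝ) (i : Fin d) :
    Fin 4 → ℝ := fun j => (τ i j - x₀ i) / h

theorem strictMono_scaledNodes {τ : Fin d → Fin 4 → ℝ} (hτ : ∀ i, StrictMono (τ i))
    (x₀ : Fin d → ℝ) {h : ℝ} (hh : 0 < h) (i : Fin d) : StrictMono (scaledNodes τ x₀ h i) := by
  intro a b hab
  exact div_lt_div_of_pos_right (by linarith [hτ i hab]) hh

/-- By Fubini the moments of a tensor product monomial are products of one-dimensional moments, and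
rescaling the variable just moves the nodes. Thus the map from coefficients to moments is the tensor
product of the one-dimensional matrices. -/
theorem moment_scaled_monomials (hk : k + 1 = 3 * (m + 1)) {τ : Fin d → Fin 4 → ℝ}
    (hτ : ∀ i, StrictMono (τ i)) (x₀ : Fin d → ℝ) (h : ℝ) (c : (Fin d → Fin (k + 1)) → ℝ)
    (e : Fin d → Fin (k + 1)) :
    moment (patchLower τ fun i => (momentIndex hk (e i)).1)
        (patchUpper τ fun i => (momentIndex hk (e i)).1) (fun i => (momentIndex hk (e i)).2)
        (fun x => ∑ β, c β * ∏ i, ((x i - x₀ i) / h) ^ (β i : ℕ)) =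
      tensorApply (fun i => momentMatrix hk (scaledNodes τ x₀ h i)) c e := by
  rw [moment_finsetSum]
  · refine Finset.sum_congr rfl fun β _ => ?_
    rw [mul_comm, moment_prod (l := patchLower τ fun i => (momentIndex hk (e i)).1)
      (r := patchUpper τ fun i => (momentIndex hk (e i)).1)
      (fun i => hτ i Fin.castSucc_lt_succ) _ (fun i x => ((x - x₀ i) / h) ^ (β i : ℕ))]
    congr 1
    refine Finset.prod_congr rfl fun i _ => ?_
    rw [refMoment_pow_scale]
    rfl
  · intro β
    fun_prop

/-- The polynomial with coefficients `c` in the monomials of `(x - x₀) / h`. -/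
noncomputable def scaledPoly (x₀ : Fin d → ℝ) (h : ℝ) (c : (Fin d → Fin (k + 1)) → ℝ) :
    MvPolynomial (Fin d) ℝ :=
  ∑ β, MvPolynomial.C (c β * h⁻¹ ^ (∑ i, (β i : ℕ))) *
    ∏ i, (MvPolynomial.X i - MvPolynomial.C (x₀ i)) ^ (β i : ℕ)

theorem eval_scaledPoly (x₀ : Fin d → ℝ) (h : ℝ) (c : (Fin d → Fin (k + 1)) → ℝ)
    (x : Fin d → ℝ) : MvPolynomial.eval x (scaledPoly x₀ h c) =
      ∑ β, c β * ∏ i, ((x i - x₀ i) / h) ^ (β i : ℕ) := by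
  simp only [scaledPoly, map_sum, map_mul, MvPolynomial.eval_C, map_prod, map_pow, map_sub,
    MvPolynomial.eval_X]
  refine Finset.sum_congr rfl fun β _ => ?_
  rw [← Finset.prod_pow_eq_pow_sum, mul_assoc, ← Finset.prod_mul_distrib]
  congr 1
  refine Finset.prod_congr rfl fun i _ => ?_
  rw [← mul_pow, div_eq_inv_mul]

theorem degreeOf_scaledPoly_le (x₀ : Fin d → ℝ) (h : ℝ) (c : (Fin d → Fin (k + 1)) → ℝ)
    (i : Fin d) : (scaledPoly x₀ h c).degreeOf i ≤ k := by
  refine (MvPolynomial.degreeOf_sum_le _ _ _).trans (Finset.sup_le fun β _ => ?_)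
  refine (MvPolynomial.degreeOf_C_mul_le _ _ _).trans ?_
  refine (degreeOf_prod_pow_le _ ?_ (fun i => (β i : ℕ)) i).trans (Nat.lt_succ_iff.mp (β i).2)
  intro i j
  refine (MvPolynomial.degreeOf_sub_le _ _ _).trans ?_
  simp [MvPolynomial.degreeOf_X, MvPolynomial.degreeOf_C]

theorem abs_eval_scaledPoly_le {x₀ x : Fin d → ℝ} {h R ε : ℝ} (hh : 0 < h) (hR : 1 ≤ R)
    (hx : ∀ i, |x i - x₀ i| ≤ R * h) {c : (Fin d → Fin (k + 1)) → ℝ} (hc : ∀ β, |c β| ≤ ε) :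
    |MvPolynomial.eval x (scaledPoly x₀ h c)| ≤ ((k + 1) ^ d : ℕ) * (ε * (R ^ k) ^ d) := by
  rw [eval_scaledPoly]
  refine (Finset.abs_sum_le_sum_abs _ _).trans ?_
  have h1 : ∀ β ∈ (Finset.univ : Finset (Fin d → Fin (k + 1))),
      |c β * ∏ i, ((x i - x₀ i) / h) ^ (β i : ℕ)| ≤ ε * (R ^ k) ^ d := by
    intro β _
    rw [abs_mul]
    refine mul_le_mul (hc β) ?_ (abs_nonneg _) ((abs_nonneg _).trans (hc β))
    rw [Finset.abs_prod]
    refine (Finset.prod_le_prod (g := fun _ => R ^ k) (fun i _ => abs_nonneg _) fun i _ => ?_).trans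
      (by simp)
    rw [abs_pow, abs_div, abs_of_pos hh]
    refine (pow_le_pow_left₀ (by positivity) ((div_le_iff₀ hh).mpr (hx i)) _).trans ?_
    exact pow_le_pow_right₀ hR (Nat.lt_succ_iff.mp (β i).2)
  refine (Finset.sum_le_card_nsmul _ _ _ h1).trans ?_
  simp

/-- A derivative lowers one exponent, at the cost of that exponent, at most `k`, and of one factor
`1/h`. The remaining scaled factors are bounded by powers of `R` as before. -/
theorem abs_eval_pderiv_scaledPoly_le {x₀ x : Fin d → ℝ} {h R ε : ℝ} (hh : 0 < h) (hR : 1 ≤ R)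
    (hx : ∀ i, |x i - x₀ i| ≤ R * h) {c : (Fin d → Fin (k + 1)) → ℝ} (hc : ∀ β, |c β| ≤ ε)
    (i : Fin d) :
    |MvPolynomial.eval x (MvPolynomial.pderiv i (scaledPoly x₀ h c))| ≤
      ((k + 1) ^ d : ℕ) * (ε * (k * (R ^ k) ^ d / h)) := by
  rw [scaledPoly, map_sum, map_sum]
  refine (Finset.abs_sum_le_sum_abs _ _).trans ?_
  have h1 : ∀ β ∈ (Finset.univ : Finset (Fin d → Fin (k + 1))),
      |MvPolynomial.eval x (MvPolynomial.pderiv i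
        (MvPolynomial.C (c β * h⁻¹ ^ (∑ i, (β i : ℕ))) *
          ∏ i, (MvPolynomial.X i - MvPolynomial.C (x₀ i)) ^ (β i : ℕ)))| ≤
        ε * (k * (R ^ k) ^ d / h) := by
    intro β _
    have hε : 0 ≤ ε := (abs_nonneg _).trans (hc β)
    rw [MvPolynomial.pderiv_C_mul, pderiv_prod_sub_pow i x₀ fun i => (β i : ℕ)]
    rcases Nat.eq_zero_or_pos (β i : ℕ) with h0 | hpos
    · simp only [h0, Nat.cast_zero, map_zero, zero_mul, abs_zero, mul_zero]
      positivity
    simp only [map_mul, MvPolynomial.eval_C, map_pow, map_sub,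
      MvPolynomial.eval_X, map_prod]
    have hsum : ∑ j, (β j : ℕ) = (β i - 1 : ℕ) + 1 + ∑ j ∈ Finset.univ.erase i, (β j : ℕ) := by
      rw [← Finset.add_sum_erase _ _ (Finset.mem_univ i)]
      omega
    have hsplit : c β * h⁻¹ ^ (∑ i, (β i : ℕ)) * ((β i : ℕ) * ((x i - x₀ i) ^ ((β i : ℕ) - 1) *
        ∏ j ∈ Finset.univ.erase i, (x j - x₀ j) ^ (β j : ℕ))) =
        c β * ((β i : ℕ) * (((x i - x₀ i) / h) ^ ((β i : ℕ) - 1) *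
          ∏ j ∈ Finset.univ.erase i, ((x j - x₀ j) / h) ^ (β j : ℕ)) / h) := by
      rw [hsum, pow_add, pow_succ, ← Finset.prod_pow_eq_pow_sum]
      simp_rw [div_eq_mul_inv, mul_pow]
      rw [Finset.prod_mul_distrib]
      ring
    rw [hsplit, abs_mul]
    refine mul_le_mul (hc β) ?_ (abs_nonneg _) hε
    rw [abs_div, abs_of_pos hh]
    refine div_le_div_of_nonneg_right ?_ hh.le
    have hf : ∀ j (n : ℕ), n ≤ k → |((x j - x₀ j) / h) ^ n| ≤ R ^ k := by
      intro j n hn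
      rw [abs_pow, abs_div, abs_of_pos hh]
      refine (pow_le_pow_left₀ (by positivity) ((div_le_iff₀ hh).mpr (hx j)) _).trans ?_
      exact pow_le_pow_right₀ hR hn
    rw [abs_mul, Nat.abs_cast, abs_mul, Finset.abs_prod]
    have hk1 : ((β i : ℕ) : ℝ) ≤ k := by exact_mod_cast Nat.lt_succ_iff.mp (β i).2
    have hβi := (β i).2
    have hR0 : 0 ≤ R ^ k := by positivity
    refine mul_le_mul hk1 ?_ (by positivity) (by positivity)
    calc _ ≤ R ^ k * ∏ _j ∈ Finset.univ.erase i, R ^ k :=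
          mul_le_mul (hf i _ (by omega)) (Finset.prod_le_prod (fun j _ => abs_nonneg _)
            fun j _ => hf j _ (Nat.lt_succ_iff.mp (β j).2)) (by positivity) hR0
      _ = (R ^ k) ^ d := by
          rw [Finset.mul_prod_erase Finset.univ (fun _ => R ^ k) (Finset.mem_univ i)]
          simp
  refine (Finset.sum_le_card_nsmul _ _ _ h1).trans ?_
  simp

/-- A polynomial in `Q^k` is determined by its moments on a patch. -/
theorem eq_zero_of_moment_eq_zero (hk : k + 1 = 3 * (m + 1)) {τ : Fin d → Fin 4 → ℝ}
    (hτ : ∀ i, StrictMono (τ i)) {p : MvPolynomial (Fin d) ℝ} (hp : ∀ i, p.degreeOf i ≤ k)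
    (hmom : ∀ o (α : Fin d → ℕ), (∀ i, α i ≤ m) →
      moment (patchLower τ o) (patchUpper τ o) α (fun x => MvPolynomial.eval x p) = 0) :
    p = 0 := by
  set c := qCoeff k p with hc
  -- Only invertibility matters for uniqueness, so the trivial scaling `x₀ = 0`, `h = 1` is used.
  have h1 : tensorApply (fun i => momentMatrix hk (scaledNodes τ 0 1 i)) c = 0 := by
    ext e
    rw [← moment_scaled_monomials hk hτ]
    simp only [Pi.zero_apply, sub_zero, div_one]
    simp_rw [← eval_coeffPoly, hc, coeffPoly_qCoeff hp]
    exact hmom _ _ fun i => Nat.lt_succ_iff.mp (momentIndex hk (e i)).2.2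
  have h2 : c = 0 := by
    rw [← tensorApply_tensorApply (A := fun i => (momentMatrix hk (scaledNodes τ 0 1 i))⁻¹)
      (B := fun i => momentMatrix hk (scaledNodes τ 0 1 i)) (fun i => Matrix.nonsing_inv_mul _
        (isUnit_iff_ne_zero.mpr (det_momentMatrix_ne_zero hk
          (strictMono_scaledNodes hτ 0 one_pos i)))) c, h1]
    ext e
    simp [tensorApply]
  rw [← coeffPoly_qCoeff hp, ← hc, h2, map_zero]

/-- Solvability of the moment problem on a patch. -/
theorem moment_tensorApply_inv (hk : k + 1 = 3 * (m + 1)) {τ : Fin d → Fin 4 → ℝ}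
    (hτ : ∀ i, StrictMono (τ i)) (x₀ : Fin d → ℝ) {h : ℝ} (hh : 0 < h)
    (V : (Fin d → Fin 3) → (Fin d → ℕ) → ℝ) {o : Fin d → Fin 3} {α : Fin d → ℕ}
    (hα : ∀ i, α i ≤ m) :
    moment (patchLower τ o) (patchUpper τ o) α (fun x => MvPolynomial.eval x (scaledPoly x₀ h
      (tensorApply (fun i => (momentMatrix hk (scaledNodes τ x₀ h i))⁻¹) fun e =>
        V (fun i => (momentIndex hk (e i)).1) fun i => (momentIndex hk (e i)).2))) = V o α := by
  simp_rw [eval_scaledPoly]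
  let e : Fin d → Fin (k + 1) := fun i =>
    (momentIndex hk).symm (o i, ⟨α i, Nat.lt_succ_iff.mpr (hα i)⟩)
  have h1 := moment_scaled_monomials hk hτ x₀ h
    (tensorApply (fun i => (momentMatrix hk (scaledNodes τ x₀ h i))⁻¹) fun e =>
        V (fun i => (momentIndex hk (e i)).1) fun i => (momentIndex hk (e i)).2) e
  rw [tensorApply_tensorApply fun i => Matrix.mul_nonsing_inv _ (isUnit_iff_ne_zero.mpr
    (det_momentMatrix_ne_zero hk (strictMono_scaledNodes hτ x₀ hh i)))] at h1
  simpa only [e, Equiv.apply_symm_apply] using h1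

theorem exists_abs_legendre_le (m : ℕ) :
    ∃ Λ : ℝ, 0 ≤ Λ ∧ ∀ n ≤ m, ∀ ξ ∈ Icc (-1 : ℝ) 1, |(legendre n).eval ξ| ≤ Λ := by
  choose Λ hΛ using fun n : ℕ => isCompact_Icc.exists_bound_of_continuousOn
    (s := Icc (-1 : ℝ) 1) (legendre n).continuous.continuousOn
  refine ⟨∑ n ∈ Finset.range (m + 1), |Λ n|, by positivity, fun n hn ξ hξ => ?_⟩
  refine ((hΛ n ξ hξ).trans (le_abs_self _)).trans ?_
  exact Finset.single_le_sum (f := fun n => |Λ n|) (fun _ _ => abs_nonneg _)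
    (Finset.mem_range.mpr (Nat.lt_succ_iff.mpr hn))

/-- The Legendre basis is bounded by `Λ^d` on the box, and the factors `1 / (r i - l i)` cancel the
volume, so the bound does not depend on the size of the box. -/
theorem abs_moment_le {l r : Fin d → ℝ} (hlr : ∀ i, l i < r i) {Λ : ℝ} (hΛ0 : 0 ≤ Λ)
    (hΛ : ∀ n ≤ m, ∀ ξ ∈ Icc (-1 : ℝ) 1, |(legendre n).eval ξ| ≤ Λ) {α : Fin d → ℕ}
    (hα : ∀ i, α i ≤ m) {w : (Fin d → ℝ) → ℝ} {ε : ℝ}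
    (hw : ∀ᵐ x ∂volume.restrict (Icc l r), |w x| ≤ ε) :
    |moment l r α w| ≤ ((2 * m + 1) * Λ) ^ d * ε := by
  have hbasis : ∀ x ∈ Icc l r, |legendreBasis l r α x| ≤ Λ ^ d := by
    intro x hx
    rw [legendreBasis, Finset.abs_prod]
    refine (Finset.prod_le_prod (g := fun _ => Λ) (fun i _ => abs_nonneg _) fun i _ => ?_).trans
      (by simp)
    refine hΛ _ (hα i) _ ?_
    have h1 := hx.1 i
    have h2 := hx.2 i
    have h3 : 0 < r i - l i := by linarith [hlr i]
    constructor
    · rw [le_div_iff₀ h3]; linarith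
    · rw [div_le_iff₀ h3]; linarith
  have hint : ‖∫ x in Icc l r, legendreBasis l r α x * w x‖ ≤
      Λ ^ d * ε * volume.real (Icc l r) := by
    refine norm_setIntegral_le_of_norm_le_const_ae isCompact_Icc.measure_lt_top ?_
    filter_upwards [hw, ae_restrict_mem measurableSet_Icc] with x h1 h2
    rw [norm_mul]
    exact mul_le_mul (hbasis x h2) h1 (abs_nonneg _) (by positivity)
  have hvol : volume.real (Icc l r) = ∏ i, (r i - l i) := by
    rw [Measure.real, Real.volume_Icc_pi_toReal fun i => (hlr i).le]
  have hV : 0 < ∏ i, (r i - l i) := Finset.prod_pos fun i _ => by linarith [hlr i]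
  rw [moment, abs_mul, Finset.prod_div_distrib, abs_div, abs_of_pos hV, Finset.abs_prod]
  rw [Real.norm_eq_abs, hvol] at hint
  have hε : 0 ≤ Λ ^ d * ε := by
    have := (abs_nonneg _).trans hint
    exact nonneg_of_mul_nonneg_left this hV
  have hpre : ∏ i, |2 * (α i : ℝ) + 1| ≤ (2 * m + 1) ^ d := by
    refine (Finset.prod_le_prod (g := fun _ => (2 * (m : ℝ) + 1)) (fun i _ => abs_nonneg _)
      fun i _ => ?_).trans (by simp)
    have : (α i : ℝ) ≤ m := by exact_mod_cast hα i
    rw [abs_of_nonneg (by positivity)]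
    linarith
  calc _ ≤ (∏ i, |2 * (α i : ℝ) + 1|) / (∏ i, (r i - l i)) * (Λ ^ d * ε * ∏ i, (r i - l i)) := by
        refine mul_le_mul_of_nonneg_left hint ?_
        exact div_nonneg (Finset.prod_nonneg fun i _ => abs_nonneg _) hV.le
    _ = (∏ i, |2 * (α i : ℝ) + 1|) * (Λ ^ d * ε) := by field_simp
    _ ≤ (2 * m + 1) ^ d * (Λ ^ d * ε) := by gcongr
    _ = _ := by rw [mul_pow]; ring

end TensorProduct

end RDG

namespace RDG

/-! ### The error of the reconstruction on a patch -/

section Patch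

variable {d k m : ℕ}

/-- Stability of the moment problem on patches of bounded aspect ratio. -/
theorem exists_patch_stability (d : ℕ) (hk : k + 1 = 3 * (m + 1)) {γ : ℝ} (hγ : 0 < γ) :
    ∃ C : ℝ, 0 ≤ C ∧ ∀ (τ : Fin d → Fin 4 → ℝ) (h : ℝ), 0 < h →
      (∀ i, ∀ j : Fin 3, h / γ ≤ τ i j.succ - τ i j.castSucc ∧ τ i j.succ - τ i j.castSucc ≤ h) →
      ∀ (p : MvPolynomial (Fin d) ℝ) (ε : ℝ), (∀ i, p.degreeOf i ≤ k) →
      (∀ o (α : Fin d → ℕ), (∀ i, α i ≤ m) →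
        |moment (patchLower τ o) (patchUpper τ o) α (fun x => MvPolynomial.eval x p)| ≤ ε) →
      ∀ x ∈ Icc (fun i => τ i 0) (fun i => τ i 3), |MvPolynomial.eval x p| ≤ C * ε ∧
        ∀ i, |MvPolynomial.eval x (MvPolynomial.pderiv i p)| ≤ C * (ε / h) := by
  -- In units of `h`, measured from the first node, the four nodes lie in `[0, 3]` with gaps at
  -- least `1/γ`.
  obtain ⟨a, ha0, ha⟩ := exists_inv_momentMatrix_bound hk 3 (inv_pos.mpr hγ)
  set c₁ : ℝ := ((k + 1) ^ d : ℕ) * a ^ d with hc₁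
  set c₂ : ℝ := ((k + 1) ^ d : ℕ) * ((3 : ℝ) ^ k) ^ d with hc₂
  refine ⟨c₂ * c₁ * (k + 1), by positivity, fun τ h hh hτ p ε hp hmom x hx => ?_⟩
  have hτm : ∀ i, StrictMono (τ i) := fun i => Fin.strictMono_iff_lt_succ.mpr fun j => by
    have := (hτ i j).1
    have : 0 < h / γ := by positivity
    linarith
  have hgap : ∀ i, τ i 1 - τ i 0 ≤ h ∧ τ i 2 - τ i 1 ≤ h ∧ τ i 3 - τ i 2 ≤ h := fun i =>
    ⟨(hτ i 0).2, (hτ i 1).2, (hτ i 2).2⟩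
  have h03 : ∀ i, τ i 3 - τ i 0 ≤ 3 * h := fun i => by
    obtain ⟨h1, h2, h3⟩ := hgap i; linarith
  set x₀ : Fin d → ℝ := fun i => τ i 0 with hx₀
  let V : (Fin d → Fin 3) → (Fin d → ℕ) → ℝ := fun o α =>
    moment (patchLower τ o) (patchUpper τ o) α (fun x => MvPolynomial.eval x p)
  set c : (Fin d → Fin (k + 1)) → ℝ :=
    tensorApply (fun i => (momentMatrix hk (scaledNodes τ x₀ h i))⁻¹) fun e =>
      V (fun i => (momentIndex hk (e i)).1) fun i => (momentIndex hk (e i)).2 with hc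
  -- By uniqueness `p` is the polynomial rebuilt from its own moments. This bounds its scaled
  -- coefficients by the inverse moment matrices.
  have hpc : p = scaledPoly x₀ h c := by
    rw [← sub_eq_zero]
    refine eq_zero_of_moment_eq_zero hk hτm (fun i => ?_) fun o α hα => ?_
    · exact (MvPolynomial.degreeOf_sub_le _ _ _).trans (max_le (hp i) (degreeOf_scaledPoly_le _ _ _ i))
    · simp_rw [map_sub]
      rw [moment_sub α (contDiff_eval _).continuous.continuousOn.integrableOn_Icc
        (contDiff_eval _).continuous.continuousOn.integrableOn_Icc,
        moment_tensorApply_inv hk hτm x₀ hh V hα, sub_self]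
  have hce : ∀ β, |c β| ≤ c₁ * ε := by
    intro β
    refine (abs_tensorApply_le (a := a) (ε := ε) (fun i e β => ?_) ha0 (fun e => ?_) β).trans_eq ?_
    · refine ha _ (fun j => ?_) (fun j => ?_) e β
      · have h1 : τ i 0 ≤ τ i j := (hτm i).monotone (Fin.zero_le j)
        have h2 : τ i j ≤ τ i 3 := (hτm i).monotone (Fin.le_last j)
        have h3 := h03 i
        rw [scaledNodes, abs_div, abs_of_pos hh, div_le_iff₀ hh, abs_of_nonneg (by simpa [hx₀] using h1)]
        simp only [hx₀]
        linarith
      · have h1 := (hτ i j).1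
        simp only [scaledNodes]
        rw [← sub_div, le_div_iff₀ hh, sub_sub_sub_cancel_right]
        rwa [div_eq_inv_mul] at h1
    · exact hmom _ _ fun i => Nat.lt_succ_iff.mp (momentIndex hk (e i)).2.2
    · rw [hc₁]; ring
  have hxx : ∀ i, |x i - x₀ i| ≤ 3 * h := fun i => by
    have h1 := hx.1 i
    have h2 := hx.2 i
    have h3 := h03 i
    simp only at h1 h2
    rw [abs_of_nonneg (by simpa [hx₀] using h1)]
    simp only [hx₀]
    linarith
  have hε : 0 ≤ ε := (abs_nonneg _).trans (hmom (fun _ => 0) 0 (by simp))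
  rw [hpc]
  refine ⟨(abs_eval_scaledPoly_le hh (by norm_num) hxx hce).trans ?_, fun i =>
    (abs_eval_pderiv_scaledPoly_le hh (by norm_num) hxx hce i).trans ?_⟩
  · have h1 : ((k + 1) ^ d : ℕ) * (c₁ * ε * ((3 : ℝ) ^ k) ^ d) = c₂ * c₁ * 1 * ε := by
      rw [hc₂]; ring
    rw [h1]
    gcongr
    have : (0 : ℝ) ≤ k := by positivity
    linarith
  · have h1 : ((k + 1) ^ d : ℕ) * (c₁ * ε * (k * ((3 : ℝ) ^ k) ^ d / h)) =
        c₂ * c₁ * k * (ε / h) := by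
      rw [hc₂]; ring
    rw [h1]
    gcongr
    linarith

/-- The error of the local reconstruction, with uniform bounds for the error and its first
derivatives. -/
theorem exists_patch_estimate (hd : d ≤ 2) (hk : k + 1 = 3 * (m + 1)) {γ : ℝ} (hγ : 0 < γ) :
    ∃ C : ℝ, 0 < C ∧ ∀ (τ : Fin d → Fin 4 → ℝ) (h : ℝ), 0 < h →
      (∀ i, ∀ j : Fin 3, h / γ ≤ τ i j.succ - τ i j.castSucc ∧ τ i j.succ - τ i j.castSucc ≤ h) →
      ∀ (u : (Fin d → ℝ) → ℝ) (B : ℝ),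
      MemSobolev (k + 1) (openBox (fun i => τ i 0) (fun i => τ i 3)) u → 0 ≤ B →
      (∀ α : Fin d → ℕ, ∑ i, α i = k + 1 →
        weakDerivNorm (openBox (fun i => τ i 0) (fun i => τ i 3)) α u ≤ ENNReal.ofReal B) →
      ∀ p : MvPolynomial (Fin d) ℝ, (∀ i, p.degreeOf i ≤ k) →
      (∀ o (α : Fin d → ℕ), (∀ i, α i ≤ m) →
        moment (patchLower τ o) (patchUpper τ o) α (fun x => MvPolynomial.eval x p) =
          moment (patchLower τ o) (patchUpper τ o) α u) →
      ∃ X ⊆ openBox (fun i => τ i 0) (fun i => τ i 3),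
        (∀ᵐ x ∂volume.restrict (openBox (fun i => τ i 0) (fun i => τ i 3)), x ∈ X) ∧
        (∀ x ∈ X, |u x - MvPolynomial.eval x p| ≤ C * (h ^ (k + 1) * B / √(h ^ d))) ∧
        (∃ K : ℝ, 0 ≤ K ∧ ∀ x ∈ X, ∀ y ∈ X, |(u x - MvPolynomial.eval x p) -
          (u y - MvPolynomial.eval y p)| ≤ K * ‖x - y‖) ∧
        ∀ i, ∃ g, IsWeakDeriv (openBox (fun i => τ i 0) (fun i => τ i 3)) (Pi.single i 1) u g ∧
          ∀ x ∈ X, |g x - MvPolynomial.eval x (MvPolynomial.pderiv i p)| ≤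
            C * (h ^ k * B / √(h ^ d)) := by
  obtain ⟨c₂, hc₂, hstab⟩ := exists_patch_stability d hk hγ
  obtain ⟨Λ, hΛ0, hΛ⟩ := exists_abs_legendre_le m
  -- `σ √(h^d)` is a lower bound for the square root of the volume of the patch, since each side is
  -- at least `h/γ`.
  set σ : ℝ := √(γ⁻¹ ^ d) with hσ
  have hσ0 : 0 < σ := Real.sqrt_pos.mpr (by positivity)
  have htc := taylorConst_nonneg d k
  -- The factor `2` pays for the halved volume in `exists_poly_approx`, and `3 ^ k` for patch sides
  -- of length up to `3h`.
  set c₁ : ℝ := 2 * taylorConst d k * 3 ^ k / σ with hc₁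
  have hc₁0 : 0 ≤ c₁ := by positivity
  set c₃ : ℝ := ((2 * m + 1) * Λ) ^ d with hc₃
  have hc₃0 : 0 ≤ c₃ := by positivity
  refine ⟨(1 + 3 * d) * (1 + c₂ * c₃) * c₁ + 1, by positivity,
    fun τ h hh hτ u B hu hB0 hB p hp hmom => ?_⟩
  set l : Fin d → ℝ := fun i => τ i 0 with hl
  set r : Fin d → ℝ := fun i => τ i 3 with hr
  have hτm : ∀ i, StrictMono (τ i) := fun i => Fin.strictMono_iff_lt_succ.mpr fun j => by
    have := (hτ i j).1
    have : 0 < h / γ := by positivity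
    linarith
  have hgap : ∀ i, τ i 1 - τ i 0 ≤ h ∧ τ i 2 - τ i 1 ≤ h ∧ τ i 3 - τ i 2 ≤ h := fun i =>
    ⟨(hτ i 0).2, (hτ i 1).2, (hτ i 2).2⟩
  have hlr : ∀ i, l i < r i := fun i => hτm i (by decide)
  have hρ : ∀ i, r i - l i ≤ 3 * h := fun i => by
    obtain ⟨h1, h2, h3⟩ := hgap i
    simp only [hl, hr]; linarith
  have hlow : ∀ i, h / γ ≤ r i - l i := fun i => by
    have h1 := (hτ i 0).1
    have h2 : τ i 1 < τ i 3 := hτm i (by decide)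
    simp at h1
    simp only [hl, hr]; linarith
  have hsd : 0 < √(h ^ d) := Real.sqrt_pos.mpr (by positivity)
  set H : ℝ := h ^ k * B / √(h ^ d) with hH
  have hH0 : 0 ≤ H := by positivity
  have hE : taylorConst d k * (3 * h) ^ k * B ≤ c₁ * H * (√(∏ i, (r i - l i)) / 2) := by
    have h1 : √(h ^ d) * σ ≤ √(∏ i, (r i - l i)) := by
      rw [hσ, ← Real.sqrt_mul (by positivity), ← mul_pow, ← div_eq_mul_inv]
      refine Real.sqrt_le_sqrt ?_
      refine le_trans (by simp [div_pow]) (Finset.prod_le_prod (s := Finset.univ)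
        (f := fun _ : Fin d => h / γ) (fun i _ => by positivity) fun i _ => hlow i)
    calc taylorConst d k * (3 * h) ^ k * B = c₁ * H * (√(h ^ d) * σ / 2) := by
          rw [hc₁, hH, mul_pow]; field_simp
      _ ≤ _ := by gcongr
  obtain ⟨q, hqd, X, hXU, hX, hq1, hq2, hq3⟩ := exists_poly_approx hd (by omega : 2 ≤ k) hlr
    hρ (by positivity) hu hB0 hB (E := c₁ * H) (by positivity) hE
  set ε : ℝ := d * (c₁ * H) * (3 * h) with hε
  have hε0 : 0 ≤ ε := by positivity
  have hXI : ∀ᵐ x ∂volume.restrict (Icc l r), x ∈ X := by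
    rwa [← Measure.restrict_congr_set (openBox_ae_eq_Icc l r)]
  have huI : IntegrableOn u (Icc l r) := by
    have : IsFiniteMeasure (volume.restrict (openBox l r)) :=
      ⟨by simpa using volume_openBox_lt_top l r⟩
    have h1 : IntegrableOn u (openBox l r) := hu.1.integrable (by norm_num)
    exact h1.congr_set_ae (openBox_ae_eq_Icc l r).symm
  have hcell : ∀ o, Icc (patchLower τ o) (patchUpper τ o) ⊆ Icc l r := fun o =>
    Icc_subset_Icc (fun i => (hτm i).monotone (Fin.zero_le _))
      (fun i => (hτm i).monotone (Fin.le_last _))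
  -- Since `p` and `u` share their moments, those of `p - q` are those of `u - q`, which is bounded
  -- by `ε` almost everywhere. Stability then controls `p - q` and its gradient on the whole patch.
  have hst := hstab τ h hh hτ (p - q) (c₃ * ε)
    (fun i => (MvPolynomial.degreeOf_sub_le _ _ _).trans (max_le (hp i) (hqd i)))
    (fun o α hα => by
      have hcq : IntegrableOn (fun x => MvPolynomial.eval x q)
          (Icc (patchLower τ o) (patchUpper τ o)) :=
        (contDiff_eval _).continuous.continuousOn.integrableOn_Icc
      simp_rw [map_sub]
      rw [moment_sub α (contDiff_eval _).continuous.continuousOn.integrableOn_Icc hcq,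
        hmom o α hα, ← moment_sub α (huI.mono_set (hcell o)) hcq]
      refine abs_moment_le (fun i => hτm i Fin.castSucc_lt_succ) hΛ0 hΛ hα ?_
      filter_upwards [ae_restrict_of_ae_restrict_of_subset (hcell o) hXI] with x hx
        using hq1 x hx)
  have hXIcc : ∀ x ∈ X, x ∈ Icc l r := fun x hx => openBox_subset_Icc l r (hXU hx)
  refine ⟨X, hXU, hX, fun x hx => ?_, ⟨d * (c₁ * H) + d * (c₂ * (c₃ * ε / h)), by positivity,
    fun x hx y hy => ?_⟩, fun i => ?_⟩
  · have h1 := hq1 x hx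
    have h2 := (hst x (hXIcc x hx)).1
    rw [map_sub] at h2
    have h3 : h ^ (k + 1) * B / √(h ^ d) = h * H := by rw [hH]; ring
    rw [h3]
    calc |u x - MvPolynomial.eval x p| ≤ ε + c₂ * (c₃ * ε) := by
          rw [abs_le] at h1 h2 ⊢
          constructor <;> linarith
      _ = (3 * d) * (1 + c₂ * c₃) * c₁ * (h * H) := by rw [hε]; ring
      _ ≤ ((1 + 3 * d) * (1 + c₂ * c₃) * c₁ + 1) * (h * H) := by
          have hnn : 0 ≤ (1 + c₂ * c₃) * c₁ := by positivity
          refine mul_le_mul_of_nonneg_right ?_ (by positivity)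
          linarith
  · have h1 := hq2 x hx y hy
    have h2 := abs_sub_le_of_abs_partialDeriv_le (contDiff_eval (p - q)) (l := l) (r := r)
      (E := c₂ * (c₃ * ε / h)) (fun z hz i => by
        rw [partialDeriv_eval]
        exact (hst z hz).2 i) (by positivity) (hXIcc x hx) (hXIcc y hy)
    simp only [map_sub] at h2
    rw [add_mul]
    rw [abs_le] at h1 h2 ⊢
    constructor <;> linarith
  · obtain ⟨g, hg, hgX⟩ := hq3 i
    refine ⟨g, hg, fun x hx => ?_⟩
    have h1 := hgX x hx
    have h2 := (hst x (hXIcc x hx)).2 i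
    rw [map_sub, map_sub] at h2
    calc |g x - MvPolynomial.eval x (MvPolynomial.pderiv i p)| ≤
        c₁ * H + c₂ * (c₃ * ε / h) := by
          rw [abs_le] at h1 h2 ⊢
          constructor <;> linarith
      _ = (1 + 3 * d * (c₂ * c₃)) * c₁ * H := by
          rw [hε]; field_simp
      _ ≤ ((1 + 3 * d) * (1 + c₂ * c₃) * c₁ + 1) * H := by
          have hnn : 0 ≤ c₂ * c₃ * c₁ := by positivity
          have hnn' : 0 ≤ (d : ℝ) * c₁ := by positivity
          refine mul_le_mul_of_nonneg_right ?_ hH0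
          nlinarith

end Patch

end RDG

namespace RDG

/-! ### Covering a box by the cells of a grid -/

section Covering

variable {d : ℕ}

theorem exists_le_lt_succ {f : ℕ → ℝ} {y : ℝ} {n : ℕ} (h0 : f 0 < y) (hn : y < f n) :
    ∃ j < n, f j ≤ y ∧ y < f (j + 1) := by
  induction n with
  | zero => exact absurd (h0.trans hn) (lt_irrefl _)
  | succ n ih =>
    by_cases h : y < f n
    · obtain ⟨j, hj, h1⟩ := ih h
      exact ⟨j, by omega, h1⟩
    · exact ⟨n, by omega, not_lt.mp h, hn⟩

/-- Only the points on the countably many grid hyperplanes are missed, and these form a null set. -/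
theorem ae_mem_cell (t : Fin d → ℕ → ℝ) (n : Fin d → ℕ) :
    ∀ᵐ x ∂volume.restrict (openBox (fun i => t i 0) (fun i => t i (n i))),
      ∃ θ : (i : Fin d) → Fin (n i),
        x ∈ openBox (fun i => t i (θ i)) (fun i => t i ((θ i : ℕ) + 1)) := by
  have hnull : ∀ᵐ x : Fin d → ℝ, ∀ i, ∀ j : ℕ, x i ≠ t i j := by
    rw [ae_all_iff]
    intro i
    rw [ae_all_iff]
    intro j
    exact Measure.ae_eval_ne (μ := fun _ : Fin d => (volume : Measure ℝ)) i (t i j)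
  filter_upwards [ae_restrict_of_ae hnull, ae_restrict_mem (measurableSet_openBox _ _)] with x h1 h2
  choose θ hθ h3 h4 using fun i => exists_le_lt_succ (mem_openBox.mp h2 i).1 (mem_openBox.mp h2 i).2
  exact ⟨fun i => ⟨θ i, hθ i⟩, mem_openBox.mpr fun i => ⟨(h3 i).lt_of_ne (h1 i _).symm, h4 i⟩⟩

theorem lintegral_openBox_le_sum (t : Fin d → ℕ → ℝ) (n : Fin d → ℕ)
    (F : (Fin d → ℝ) → ℝ≥0∞) :
    ∫⁻ x in openBox (fun i => t i 0) (fun i => t i (n i)), F x ≤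
      ∑ θ : (i : Fin d) → Fin (n i),
        ∫⁻ x in openBox (fun i => t i (θ i)) (fun i => t i ((θ i : ℕ) + 1)), F x := by
  set U := openBox (fun i => t i 0) (fun i => t i (n i))
  set V := fun θ : (i : Fin d) → Fin (n i) =>
    openBox (fun i => t i (θ i)) (fun i => t i ((θ i : ℕ) + 1))
  calc ∫⁻ x in U, F x ≤ ∫⁻ x in ⋃ θ, V θ, F x := by
        refine lintegral_mono' (Measure.restrict_mono_ae ?_) le_rfl
        have := (ae_restrict_iff' (measurableSet_openBox _ _)).mp (ae_mem_cell t n)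
        filter_upwards [this] with x hx hxU
        exact mem_iUnion.mpr (hx hxU)
    _ ≤ ∑' θ, ∫⁻ x in V θ, F x := lintegral_iUnion_le _ _
    _ = _ := tsum_fintype _

end Covering

/-! ### Nodes and stencils of the periodically extended mesh -/

namespace RectMesh

variable {d : ℕ} {a b : Fin d → ℝ} (M : RectMesh a b)

theorem gap_le_h (i : Fin d) (j : ℕ) (hj : j < M.N i) : M.x i (j + 1) - M.x i j ≤ M.h :=
  le_ciSup (f := fun p : (Σ i : Fin d, Fin (M.N i)) =>
    M.x p.1 ((p.2 : ℕ) + 1) - M.x p.1 (p.2 : ℕ)) (Set.finite_range _).bddAbove ⟨i, ⟨j, hj⟩⟩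

theorem hMin_le_gap (i : Fin d) (j : ℕ) (hj : j < M.N i) : M.hMin ≤ M.x i (j + 1) - M.x i j :=
  ciInf_le (f := fun p : (Σ i : Fin d, Fin (M.N i)) =>
    M.x p.1 ((p.2 : ℕ) + 1) - M.x p.1 (p.2 : ℕ)) (Set.finite_range _).bddBelow ⟨i, ⟨j, hj⟩⟩

theorem h_pos (i : Fin d) : 0 < M.h :=
  (sub_pos.mpr (M.x_lt i 0 (M.N_pos i))).trans_le (M.gap_le_h i 0 (M.N_pos i))

theorem hMin_pos (i : Fin d) : 0 < M.hMin := by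
  have : Nonempty (Σ i : Fin d, Fin (M.N i)) := ⟨⟨i, ⟨0, M.N_pos i⟩⟩⟩
  obtain ⟨p, hp⟩ := exists_eq_ciInf_of_finite (f := fun p : (Σ i : Fin d, Fin (M.N i)) =>
    M.x p.1 ((p.2 : ℕ) + 1) - M.x p.1 (p.2 : ℕ))
  rw [hMin, ← hp]
  exact sub_pos.mpr (M.x_lt p.1 p.2 p.2.2)

theorem node_add_mul (i : Fin d) (j q : ℤ) :
    M.node i (j + q * M.N i) = M.node i j + q * (b i - a i) := by
  have hN : (M.N i : ℤ) ≠ 0 := by exact_mod_cast (M.N_pos i).ne'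
  unfold node
  rw [Int.add_mul_emod_self_right, Int.add_mul_ediv_right _ _ hN]
  push_cast
  ring

theorem node_natCast (i : Fin d) (j : ℕ) (hj : j ≤ M.N i) : M.node i j = M.x i j := by
  rcases hj.eq_or_lt with rfl | hj
  · have h1 := M.node_add_mul i 0 1
    simp only [zero_add, one_mul, Int.cast_one] at h1
    rw [h1]
    simp [node, M.x_zero, M.x_last]
  · unfold node
    rw [Int.emod_eq_of_lt (by positivity) (by exact_mod_cast hj),
      Int.ediv_eq_zero_of_lt (by positivity) (by exact_mod_cast hj)]
    simp

theorem node_zero (i : Fin d) : M.node i 0 = a i := by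
  have := M.node_natCast i 0 (Nat.zero_le _)
  simpa [M.x_zero] using this

theorem node_N (i : Fin d) : M.node i (M.N i) = b i := by
  rw [M.node_natCast i _ le_rfl, M.x_last]

/-- Reduction of `j` modulo `N i` shifts both nodes by the same number of periods. For the last
interval the right end point is node `N i`, which `node_natCast` includes. -/
theorem exists_node_gap_eq (i : Fin d) (j : ℤ) :
    ∃ r < M.N i, M.node i (j + 1) - M.node i j = M.x i (r + 1) - M.x i r := by
  have hN : (0 : ℤ) < M.N i := by exact_mod_cast M.N_pos i
  have hr0 := Int.emod_nonneg j hN.ne'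
  have hr1 := Int.emod_lt_of_pos j hN
  obtain ⟨r, hr⟩ := Int.eq_ofNat_of_zero_le hr0
  have hrN : r < M.N i := by omega
  refine ⟨r, hrN, ?_⟩
  have hj : j = (r : ℤ) + (j / M.N i) * M.N i := by
    have := Int.emod_add_mul_ediv j (M.N i)
    rw [← hr]
    linarith
  have h1 : M.node i j = M.x i r + (j / M.N i : ℤ) * (b i - a i) := by
    conv_lhs => rw [hj, M.node_add_mul, M.node_natCast i r hrN.le]
  have h2 : M.node i (j + 1) = M.x i (r + 1) + (j / M.N i : ℤ) * (b i - a i) := by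
    have : j + 1 = ((r + 1 : ℕ) : ℤ) + (j / M.N i) * M.N i := by
      push_cast
      linarith
    conv_lhs => rw [this, M.node_add_mul, M.node_natCast i (r + 1) hrN]
  rw [h1, h2]
  ring

theorem node_gap_le_h (i : Fin d) (j : ℤ) : M.node i (j + 1) - M.node i j ≤ M.h := by
  obtain ⟨r, hr, h⟩ := M.exists_node_gap_eq i j
  rw [h]
  exact M.gap_le_h i r hr

theorem hMin_le_node_gap (i : Fin d) (j : ℤ) : M.hMin ≤ M.node i (j + 1) - M.node i j := by
  obtain ⟨r, hr, h⟩ := M.exists_node_gap_eq i j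
  rw [h]
  exact M.hMin_le_gap i r hr

theorem strictMono_node (i : Fin d) : StrictMono (M.node i) :=
  strictMono_int_of_lt_succ fun j => by
    have := M.hMin_le_node_gap i j
    have := M.hMin_pos i
    linarith

/-- The first of the three intervals in the stencil of the interval number `j`. -/
def stencilStart (bc : BoundaryKind) (n : ℕ) (j : ℤ) : ℤ :=
  match bc with
  | .periodic => j - 1
  | .biased => if j = 0 then 0 else if j = (n : ℤ) - 1 then (n : ℤ) - 3 else j - 1

/-- Periodic, centered and one-sided stencils all consist of three consecutive intervals. The local
analysis therefore never has to distinguish them. -/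
theorem mem_stencil1_iff (bc : BoundaryKind) (n : ℕ) (j z : ℤ) :
    z ∈ stencil1 bc n j ↔ ∃ o : Fin 3, z = stencilStart bc n j + (o : ℕ) := by
  have key : ∀ s : ℤ, (∃ o : Fin 3, z = s + (o : ℕ)) ↔ z = s ∨ z = s + 1 ∨ z = s + 2 := by
    intro s
    simp [Fin.exists_fin_succ]
  rw [key]
  cases bc with
  | periodic =>
    simp only [stencil1, stencilStart, Finset.mem_insert, Finset.mem_singleton]
    omega
  | biased =>
    simp only [stencil1, stencilStart]
    split_ifs <;> simp only [Finset.mem_insert, Finset.mem_singleton] <;> omega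

/-- The index of the first element in the stencil of `K_θ`. -/
def stencilBase (bc : BoundaryKind) (θ : M.Index) : Fin d → ℤ :=
  fun i => stencilStart bc (M.N i) (θ.toInt i)

theorem mem_stencil_iff (bc : BoundaryKind) (θ : M.Index) (η : Fin d → ℤ) :
    η ∈ M.stencil bc θ ↔ ∃ o : Fin d → Fin 3, η = fun i => M.stencilBase bc θ i + (o i : ℕ) := by
  simp only [stencil, Fintype.mem_piFinset, mem_stencil1_iff, stencilBase]
  constructor
  · intro h
    choose o ho using h
    exact ⟨o, funext ho⟩
  · rintro ⟨o, rfl⟩ i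
    exact ⟨o i, rfl⟩

variable {M} in
theorem Index.toInt_nonneg (θ : M.Index) (i : Fin d) : 0 ≤ θ.toInt i := by simp [Index.toInt]

variable {M} in
theorem Index.toInt_lt (θ : M.Index) (i : Fin d) : θ.toInt i < M.N i := by
  simp [Index.toInt]

theorem exists_eq_stencilBase_add {bc : BoundaryKind} (hM : M.Admits bc) (θ : M.Index) :
    ∃ o : Fin d → Fin 3, θ.toInt = fun i => M.stencilBase bc θ i + (o i : ℕ) := by
  rw [← M.mem_stencil_iff]
  simp only [stencil, Fintype.mem_piFinset]
  intro i
  have h0 := θ.toInt_nonneg i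
  have h1 := θ.toInt_lt i
  cases bc with
  | periodic => simp [stencil1]
  | biased =>
    simp only [stencil1]
    split_ifs with h4 h5
    · simp [h4]
    · simp [h5]
    · simp

theorem stencilBase_bounds {bc : BoundaryKind} (hM : M.Admits bc) (θ : M.Index) (i : Fin d) :
    θ.toInt i - 2 ≤ M.stencilBase bc θ i ∧ M.stencilBase bc θ i ≤ θ.toInt i := by
  obtain ⟨o, ho⟩ := M.exists_eq_stencilBase_add hM θ
  have h1 : θ.toInt i = M.stencilBase bc θ i + (o i : ℕ) := congrFun ho i
  have h2 := (o i).2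
  omega

theorem stencilBase_biased_bounds (hM : M.Admits .biased) (θ : M.Index) (i : Fin d) :
    0 ≤ M.stencilBase .biased θ i ∧ M.stencilBase .biased θ i + 3 ≤ M.N i := by
  have h0 := θ.toInt_nonneg i
  have h1 := θ.toInt_lt i
  have h3 : 3 ≤ M.N i := hM i
  simp only [stencilBase, stencilStart]
  split_ifs <;> omega

/-- The nodes of the patch formed by the stencil of `K_θ`. -/
noncomputable def patchNodes (bc : BoundaryKind) (θ : M.Index) (i : Fin d) (j : Fin 4) : ℝ :=
  M.node i (M.stencilBase bc θ i + (j : ℕ))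

theorem patchNodes_gap (bc : BoundaryKind) (θ : M.Index) (i : Fin d) (j : Fin 3) :
    M.hMin ≤ M.patchNodes bc θ i j.succ - M.patchNodes bc θ i j.castSucc ∧
      M.patchNodes bc θ i j.succ - M.patchNodes bc θ i j.castSucc ≤ M.h := by
  have h1 := M.hMin_le_node_gap i (M.stencilBase bc θ i + (j : ℕ))
  have h2 := M.node_gap_le_h i (M.stencilBase bc θ i + (j : ℕ))
  simp only [patchNodes, Fin.val_succ, Fin.val_castSucc]
  push_cast
  rw [← add_assoc]
  exact ⟨h1, h2⟩

theorem strictMono_patchNodes (bc : BoundaryKind) (θ : M.Index) (i : Fin d) :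
    StrictMono (M.patchNodes bc θ i) := fun j j' hjj' =>
  M.strictMono_node i (by
    have : (j : ℕ) < (j' : ℕ) := hjj'
    omega)

theorem lower_stencil (bc : BoundaryKind) (θ : M.Index) (o : Fin d → Fin 3) :
    M.lower (fun i => M.stencilBase bc θ i + (o i : ℕ)) = patchLower (M.patchNodes bc θ) o := rfl

theorem upper_stencil (bc : BoundaryKind) (θ : M.Index) (o : Fin d → Fin 3) :
    M.upper (fun i => M.stencilBase bc θ i + (o i : ℕ)) = patchUpper (M.patchNodes bc θ) o := by
  ext i
  simp only [upper, patchUpper, patchNodes, Fin.val_succ]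
  push_cast
  rw [add_assoc]

theorem isLocalReconstruction_iff (bc : BoundaryKind) (k m : ℕ) (u : (Fin d → ℝ) → ℝ)
    (θ : M.Index) (p : MvPolynomial (Fin d) ℝ) :
    M.IsLocalReconstruction bc k m u θ p ↔ (∀ i, p.degreeOf i ≤ k) ∧
      ∀ o (α : Fin d → ℕ), (∀ i, α i ≤ m) →
        moment (patchLower (M.patchNodes bc θ) o) (patchUpper (M.patchNodes bc θ) o) α
            (fun x => MvPolynomial.eval x p) =
          moment (patchLower (M.patchNodes bc θ) o) (patchUpper (M.patchNodes bc θ) o) α u := by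
  refine and_congr_right fun _ => ⟨fun h o => ?_, fun h η hη => ?_⟩
  · rw [← M.lower_stencil, ← M.upper_stencil]
    exact h _ ((M.mem_stencil_iff bc θ _).mpr ⟨o, rfl⟩)
  · obtain ⟨o, rfl⟩ := (M.mem_stencil_iff bc θ η).mp hη
    rw [M.lower_stencil, M.upper_stencil]
    exact h o

/-- The function `u` enters only through finitely many prescribed moments, so this is solvability
and uniqueness of the square linear system on the patch. -/
theorem existsUnique_isLocalReconstruction (bc : BoundaryKind) {k m : ℕ}
    (hk : k + 1 = 3 * (m + 1)) (u : (Fin d → ℝ) → ℝ) (θ : M.Index) :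
    ∃! p, M.IsLocalReconstruction bc k m u θ p := by
  simp_rw [isLocalReconstruction_iff]
  have hτ := M.strictMono_patchNodes bc θ
  refine existsUnique_of_exists_of_unique ?_ fun p q hp hq => ?_
  · exact ⟨_, degreeOf_scaledPoly_le 0 1 _, fun o α hα =>
      moment_tensorApply_inv hk hτ 0 one_pos (fun o α => moment (patchLower (M.patchNodes bc θ) o)
        (patchUpper (M.patchNodes bc θ) o) α u) hα⟩
  · rw [← sub_eq_zero]
    refine eq_zero_of_moment_eq_zero hk hτ (fun i => (MvPolynomial.degreeOf_sub_le _ _ _).trans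
      (max_le (hp.1 i) (hq.1 i))) fun o α hα => ?_
    simp_rw [map_sub]
    rw [moment_sub α (contDiff_eval _).continuous.continuousOn.integrableOn_Icc
        (contDiff_eval _).continuous.continuousOn.integrableOn_Icc, hp.2 o α hα, hq.2 o α hα,
      sub_self]

theorem isLocalReconstruction_localReconstruction (bc : BoundaryKind) {k m : ℕ}
    (hk : k + 1 = 3 * (m + 1)) (u : (Fin d → ℝ) → ℝ) (θ : M.Index) :
    M.IsLocalReconstruction bc k m u θ (M.localReconstruction bc k m u θ) :=
  Classical.epsilon_spec (M.existsUnique_isLocalReconstruction bc hk u θ).exists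

theorem disjoint_openBox_of_ne {η η' : Fin d → ℤ} (h : η ≠ η') :
    Disjoint (openBox (M.lower η) (M.upper η)) (openBox (M.lower η') (M.upper η')) := by
  rw [Set.disjoint_left]
  intro x hx hx'
  refine h (funext fun i => ?_)
  have h1 := mem_openBox.mp hx i
  have h2 := mem_openBox.mp hx' i
  simp only [lower, upper] at h1 h2
  have h3 := (M.strictMono_node i).lt_iff_lt.mp (h1.1.trans h2.2)
  have h4 := (M.strictMono_node i).lt_iff_lt.mp (h2.1.trans h1.2)
  omega

theorem toInt_injective : Function.Injective (Index.toInt : M.Index → Fin d → ℤ) := by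
  intro θ θ' h
  ext i
  have := congrFun h i
  simpa [Index.toInt] using this

theorem reconstruction_eq_of_mem_cell (bc : BoundaryKind) (k m : ℕ) (u : (Fin d → ℝ) → ℝ)
    {θ : M.Index} {x : Fin d → ℝ} (hx : x ∈ M.cell θ) :
    M.reconstruction bc k m u x = MvPolynomial.eval x (M.localReconstruction bc k m u θ) := by
  unfold reconstruction
  rw [Finset.sum_eq_single θ]
  · rw [indicator_of_mem hx]
  · intro θ' _ hne
    refine indicator_of_notMem (fun hx' => ?_) _
    exact Set.disjoint_left.mp (M.disjoint_openBox_of_ne (M.toInt_injective.ne hne)) hx' hx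
  · simp

theorem lower_toInt (θ : M.Index) : M.lower θ.toInt = fun i => M.x i (θ i) :=
  funext fun i => M.node_natCast i _ (θ i).2.le

theorem upper_toInt (θ : M.Index) : M.upper θ.toInt = fun i => M.x i ((θ i : ℕ) + 1) :=
  funext fun i => M.node_natCast i ((θ i : ℕ) + 1) (θ i).2

theorem ae_exists_mem_cell : ∀ᵐ x ∂volume.restrict (openBox a b), ∃ θ : M.Index, x ∈ M.cell θ := by
  have h := ae_mem_cell M.x M.N
  simp_rw [M.x_zero, M.x_last] at h
  filter_upwards [h] with x ⟨θ, hθ⟩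
  exact ⟨θ, by rwa [cell, lower_toInt, upper_toInt]⟩

theorem lintegral_openBox_le_sum_cell (F : (Fin d → ℝ) → ℝ≥0∞) :
    ∫⁻ x in openBox a b, F x ≤ ∑ θ : M.Index, ∫⁻ x in M.cell θ, F x := by
  have h := lintegral_openBox_le_sum M.x M.N F
  simp_rw [M.x_zero, M.x_last] at h
  simpa only [cell, lower_toInt, upper_toInt] using h

theorem cell_subset (θ : M.Index) : M.cell θ ⊆ openBox a b := by
  intro x hx
  refine mem_openBox.mpr fun i => ?_
  have h1 := mem_openBox.mp hx i
  have h2 := (M.strictMono_node i).monotone (θ.toInt_nonneg i)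
  have h3 := (M.strictMono_node i).monotone (Int.add_one_le_iff.mpr (θ.toInt_lt i))
  rw [M.node_zero] at h2
  rw [M.node_N] at h3
  exact ⟨h2.trans_lt h1.1, h1.2.trans_le h3⟩

theorem sum_lintegral_cell_le (F : (Fin d → ℝ) → ℝ≥0∞) :
    ∑ θ : M.Index, ∫⁻ x in M.cell θ, F x ≤ ∫⁻ x in openBox a b, F x := by
  rw [← tsum_fintype (L := SummationFilter.unconditional _), ← lintegral_iUnion]
  · exact lintegral_mono_set (iUnion_subset M.cell_subset)
  · exact fun θ => measurableSet_openBox _ _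
  · exact fun θ θ' hne => M.disjoint_openBox_of_ne (M.toInt_injective.ne hne)

end RectMesh

end RDG

namespace RDG

/-! ### Restriction and translation of weak derivatives -/

section Restriction

variable {d : ℕ} {α : Fin d → ℕ} {s : ℕ} {U V : Set (Fin d → ℝ)} {u : (Fin d → ℝ) → ℝ}

theorem eLpNorm_two_sq (g : (Fin d → ℝ) → ℝ) (μ : Measure (Fin d → ℝ)) :
    eLpNorm g 2 μ ^ 2 = ∫⁻ x, ‖g x‖ₑ ^ 2 ∂μ := by
  have h := eLpNorm_nnreal_pow_eq_lintegral (f := g) (μ := μ) (p := 2) two_ne_zero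
  rw [ENNReal.coe_ofNat, NNReal.coe_ofNat] at h
  simpa only [ENNReal.rpow_two] using h

theorem MemSobolev.mono (hVU : V ⊆ U) (hU : MeasurableSet U) (h : MemSobolev s U u) :
    MemSobolev s V u := by
  refine ⟨h.1.mono_measure (Measure.restrict_mono_set _ hVU), fun α hα => ?_⟩
  obtain ⟨g, hg, hw⟩ := h.2 α hα
  exact ⟨g, hg.mono_measure (Measure.restrict_mono_set _ hVU), isWeakDeriv_mono hVU hU hw⟩

theorem partialDeriv_comp_add (i : Fin d) (f : (Fin d → ℝ) → ℝ) (z : Fin d → ℝ) :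
    partialDeriv i (fun y => f (y + z)) = fun y => partialDeriv i f (y + z) := by
  ext y
  simp only [partialDeriv]
  rw [fderiv_comp_add_right]

theorem multiDeriv_comp_add {f : (Fin d → ℝ) → ℝ} (hf : ContDiff ℝ ∞ f) (α : Fin d → ℕ)
    (z : Fin d → ℝ) :
    multiDeriv α (fun y => f (y + z)) = fun y => multiDeriv α f (y + z) := by
  have hf' : ContDiff ℝ ∞ fun y => f (y + z) := hf.comp (contDiff_id.add contDiff_const)
  induction α using multiIndex_induction with
  | zero => simp
  | add α i ih =>
    rw [← partialDeriv_multiDeriv hf', ih, partialDeriv_comp_add, partialDeriv_multiDeriv hf]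

theorem preimage_sub_openBox (l r z : Fin d → ℝ) :
    (fun x => x - z) ⁻¹' openBox l r = openBox (l + z) (r + z) := by
  ext x
  simp only [mem_preimage, mem_openBox, Pi.sub_apply, Pi.add_apply, lt_sub_iff_add_lt,
    sub_lt_iff_lt_add]

theorem measurePreserving_sub_openBox (l r z : Fin d → ℝ) :
    MeasurePreserving (fun x => x - z) (volume.restrict (openBox (l + z) (r + z)))
      (volume.restrict (openBox l r)) := by
  rw [← preimage_sub_openBox]
  exact (measurePreserving_sub_right volume z).restrict_preimage (measurableSet_openBox l r)

theorem locallyIntegrableOn_openBox_of_memLp {g : (Fin d → ℝ) → ℝ} {l r : Fin d → ℝ}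
    (hg : MemLp g 2 (volume.restrict (openBox l r))) :
    LocallyIntegrableOn g (openBox l r) volume := by
  have : IsFiniteMeasure (volume.restrict (openBox l r)) :=
    ⟨by simpa using volume_openBox_lt_top l r⟩
  have h : IntegrableOn g (openBox l r) volume := hg.integrable (by norm_num)
  exact h.locallyIntegrableOn

/-- Translation of a box by a period of `u` does not change the norms of weak derivatives. -/
theorem weakDerivNorm_translate_le {l r z : Fin d → ℝ} (hz : ∀ x, u (x + z) = u x)
    (h : MemSobolev s (openBox l r) u) (hα : ∑ i, α i ≤ s) :
    weakDerivNorm (openBox (l + z) (r + z)) α u ≤ weakDerivNorm (openBox l r) α u := by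
  have hz' : ∀ x, u (x - z) = u x := fun x => by rw [← hz (x - z), sub_add_cancel]
  obtain ⟨g, hg, hw⟩ := h.2 α hα
  have hmp := measurePreserving_sub_openBox l r z
  have hemb : MeasurableEmbedding fun x : Fin d → ℝ => x - z := measurableEmbedding_subRight z
  have hint : ∀ F : (Fin d → ℝ) → ℝ,
      ∫ x in openBox (l + z) (r + z), F (x - z) = ∫ x in openBox l r, F x := fun F =>
    hmp.integral_comp hemb F
  have hu' : MemLp u 2 (volume.restrict (openBox (l + z) (r + z))) := by
    have := h.1.comp_measurePreserving hmp
    rwa [show u ∘ (fun x => x - z) = u from funext hz'] at this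
  have hw' : IsWeakDeriv (openBox (l + z) (r + z)) α u fun x => g (x - z) := by
    refine ⟨locallyIntegrableOn_openBox_of_memLp hu',
      locallyIntegrableOn_openBox_of_memLp (hg.comp_measurePreserving hmp), fun φ hφ hc hs => ?_⟩
    have hφ' : ContDiff ℝ ∞ fun y => φ (y + z) := hφ.comp (contDiff_id.add contDiff_const)
    have hts : tsupport (fun y => φ (y + z)) ⊆ (fun y => y + z) ⁻¹' tsupport φ :=
      tsupport_comp_subset_preimage φ (by fun_prop)
    have hsub : tsupport (fun y => φ (y + z)) ⊆ openBox l r := by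
      intro y hy
      have h1 : y + z ∈ openBox (l + z) (r + z) := hs (hts hy)
      rw [← preimage_sub_openBox] at h1
      simpa using h1
    have key := hw.2.2 _ hφ' (hc.comp_homeomorph (Homeomorph.addRight z)) hsub
    rw [multiDeriv_comp_add hφ, ← hint, ← hint] at key
    simpa only [sub_add_cancel, hz'] using key
  rw [weakDerivNorm_eq (isOpen_openBox _ _) hw]
  refine (iInf₂_le _ hw').trans_eq ?_
  exact eLpNorm_comp_measurePreserving hg.1 hmp

/-- One weak derivative on the patch restricts to every cell, and the cells cover the patch up to a
null set; squared `L²` norms are integrals, hence subadditive over the cover. -/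
theorem weakDerivNorm_patch_sq_le (t : Fin d → ℕ → ℝ) (ht : ∀ i, StrictMono (t i))
    (n : Fin d → ℕ) (h : MemSobolev s (openBox (fun i => t i 0) (fun i => t i (n i))) u)
    (hα : ∑ i, α i ≤ s) :
    weakDerivNorm (openBox (fun i => t i 0) (fun i => t i (n i))) α u ^ 2 ≤
      ∑ θ : (i : Fin d) → Fin (n i),
        weakDerivNorm (openBox (fun i => t i (θ i)) (fun i => t i ((θ i : ℕ) + 1))) α u ^ 2 := by
  obtain ⟨g, -, hw⟩ := h.2 α hα
  have hsub : ∀ θ : (i : Fin d) → Fin (n i),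
      openBox (fun i => t i (θ i)) (fun i => t i ((θ i : ℕ) + 1)) ⊆
        openBox (fun i => t i 0) (fun i => t i (n i)) := by
    intro θ x hx
    refine mem_openBox.mpr fun i => ?_
    have h1 := mem_openBox.mp hx i
    exact ⟨((ht i).monotone (Nat.zero_le _)).trans_lt h1.1,
      h1.2.trans_le ((ht i).monotone (θ i).2)⟩
  rw [weakDerivNorm_eq (isOpen_openBox _ _) hw, eLpNorm_two_sq]
  refine (lintegral_openBox_le_sum t n _).trans (Finset.sum_le_sum fun θ _ => ?_)
  rw [weakDerivNorm_eq (isOpen_openBox _ _)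
    (isWeakDeriv_mono (hsub θ) (measurableSet_openBox _ _) hw), eLpNorm_two_sq]

theorem sobolevSeminorm_sq (s : ℕ) (U : Set (Fin d → ℝ)) (u : (Fin d → ℝ) → ℝ) :
    sobolevSeminorm s U u ^ 2 =
      ∑ α ∈ Finset.piAntidiag (Finset.univ : Finset (Fin d)) s, weakDerivNorm U α u ^ 2 := by
  rw [sobolevSeminorm, ← ENNReal.rpow_two, ← ENNReal.rpow_mul]
  norm_num

end Restriction

/-! ### Finite overlap of the stencils -/

namespace RectMesh

variable {d : ℕ} {a b : Fin d → ℝ} (M : RectMesh a b) {bc : BoundaryKind} {s : ℕ}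
  {u : (Fin d → ℝ) → ℝ}

/-- The interior of the union of the stencil of `K_θ`. -/
def patch (bc : BoundaryKind) (θ : M.Index) : Set (Fin d → ℝ) :=
  openBox (fun i => M.patchNodes bc θ i 0) (fun i => M.patchNodes bc θ i 3)

theorem memSobolev_openBox (hu : MemData bc s a b u) : MemSobolev s (openBox a b) u := by
  cases bc with
  | periodic => exact hu.2 a b
  | biased => exact hu

theorem memSobolev_patch (hM : M.Admits bc) (hu : MemData bc s a b u) (θ : M.Index) :
    MemSobolev s (M.patch bc θ) u := by
  cases bc with
  | periodic => exact hu.2 _ _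
  | biased =>
    refine MemSobolev.mono (U := openBox a b) ?_ (measurableSet_openBox _ _) hu
    intro x hx
    refine mem_openBox.mpr fun i => ?_
    have h1 := mem_openBox.mp hx i
    have h2 := M.stencilBase_biased_bounds hM θ i
    have h3 := (M.strictMono_node i).monotone h2.1
    have h4 := (M.strictMono_node i).monotone h2.2
    rw [M.node_zero] at h3
    rw [M.node_N] at h4
    refine ⟨h3.trans_lt ?_, lt_of_lt_of_le ?_ h4⟩
    · simpa [patchNodes] using h1.1
    · simpa [patchNodes] using h1.2

/-- The element of the mesh that is congruent to the element `η` of the extended mesh. -/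
def wrap (η : Fin d → ℤ) : M.Index := fun i =>
  ⟨(η i % (M.N i : ℤ)).toNat, by
    have hN : (0 : ℤ) < M.N i := by exact_mod_cast M.N_pos i
    have hr0 := Int.emod_nonneg (η i) hN.ne'
    have hr1 := Int.emod_lt_of_pos (η i) hN
    omega⟩

theorem toInt_wrap (η : Fin d → ℤ) (i : Fin d) : (M.wrap η).toInt i = η i % (M.N i : ℤ) := by
  have hN : (0 : ℤ) < M.N i := by exact_mod_cast M.N_pos i
  have hr0 := Int.emod_nonneg (η i) hN.ne'
  simp only [Index.toInt, wrap]
  omega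

/-- Translation modulo `N i` is injective in each direction, and the index set is finite. -/
theorem bijective_wrap_add (c : Fin d → ℤ) :
    Function.Bijective fun θ : M.Index => M.wrap (θ.toInt + c) := by
  refine Finite.injective_iff_bijective.mp fun θ θ' h => M.toInt_injective (funext fun i => ?_)
  have h1 := congrArg (fun ζ : M.Index => ζ.toInt i) h
  simp only [toInt_wrap, Pi.add_apply] at h1
  have h2 := Int.emod_add_cancel_right (c i) |>.mp h1
  rwa [Int.emod_eq_of_lt (θ.toInt_nonneg i) (θ.toInt_lt i),
    Int.emod_eq_of_lt (θ'.toInt_nonneg i) (θ'.toInt_lt i)] at h2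

theorem weakDerivNorm_le_wrap_periodic (hu : MemData .periodic s a b u) {α : Fin d → ℕ}
    (hα : ∑ i, α i ≤ s) (η : Fin d → ℤ) :
    weakDerivNorm (openBox (M.lower η) (M.upper η)) α u ≤
      weakDerivNorm (M.cell (M.wrap η)) α u := by
  set z : Fin d → ℝ := fun i => (η i / (M.N i : ℤ) : ℤ) * (b i - a i) with hz
  have hη : ∀ i, η i = (M.wrap η).toInt i + (η i / (M.N i : ℤ)) * M.N i := fun i => by
    rw [toInt_wrap]
    have := Int.emod_add_mul_ediv (η i) (M.N i)
    linarith
  have hl : M.lower η = M.lower (M.wrap η).toInt + z := by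
    ext i
    simp only [lower, Pi.add_apply, hz]
    rw [← M.node_add_mul, ← hη]
  have hr : M.upper η = M.upper (M.wrap η).toInt + z := by
    ext i
    simp only [upper, Pi.add_apply, hz]
    rw [← M.node_add_mul, add_right_comm, ← hη]
  have hper : ∀ (t : Finset (Fin d)) x,
      u (x + ∑ i ∈ t, Pi.single i (z i)) = u x := by
    intro t
    induction t using Finset.induction_on with
    | empty => simp
    | insert i t hi ih =>
      intro x
      rw [Finset.sum_insert hi, add_comm _ (∑ j ∈ t, _), ← add_assoc]
      have h1 := (hu.1 i).int_mul (η i / (M.N i : ℤ)) (x + ∑ j ∈ t, Pi.single j (z j))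
      have h2 : (Pi.single i (z i) : Fin d → ℝ) =
          ((η i / (M.N i : ℤ) : ℤ) : Fin d → ℝ) * Pi.single i (b i - a i) := by
        ext j
        by_cases hj : j = i
        · subst hj
          simp [hz]
        · simp [hj]
      rw [h2, h1, ih]
  rw [hl, hr]
  refine weakDerivNorm_translate_le (fun x => ?_) (hu.2 _ _) hα
  have := hper Finset.univ x
  rwa [Finset.univ_sum_single] at this

/-- In the periodic case the stencil cell is a translate by periods of a cell of the mesh. In the
biased case its indices already lie in the range, and wrapping changes nothing. -/
theorem weakDerivNorm_stencil_le_wrap (hM : M.Admits bc) (hu : MemData bc s a b u)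
    {α : Fin d → ℕ} (hα : ∑ i, α i ≤ s) (θ : M.Index) (o : Fin d → Fin 3) :
    weakDerivNorm (openBox (M.lower fun i => M.stencilBase bc θ i + (o i : ℕ))
        (M.upper fun i => M.stencilBase bc θ i + (o i : ℕ))) α u ≤
      weakDerivNorm (M.cell (M.wrap fun i => M.stencilBase bc θ i + (o i : ℕ))) α u := by
  cases bc with
  | periodic => exact M.weakDerivNorm_le_wrap_periodic hu hα _
  | biased =>
    have : (M.wrap fun i => M.stencilBase .biased θ i + (o i : ℕ)).toInt =
        fun i => M.stencilBase .biased θ i + (o i : ℕ) := by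
      ext i
      have h := M.stencilBase_biased_bounds hM θ i
      have h2 := (o i).2
      rw [toInt_wrap]
      exact Int.emod_eq_of_lt (by omega) (by omega)
    rw [cell, this]

/-- A stencil cell differs from its central index by an offset in `{-2, …, 2}` in each direction.
For a fixed offset, wrapping permutes the cells. Bounding each of the `3^d` stencil terms by the sum
over all `5^d` offsets gives the generous constant `15^d`. -/
theorem sum_stencil_le {bc : BoundaryKind} (hM : M.Admits bc) (G : M.Index → ℝ≥0∞) :
    ∑ θ : M.Index, ∑ o : Fin d → Fin 3, G (M.wrap fun i => M.stencilBase bc θ i + (o i : ℕ)) ≤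
      15 ^ d * ∑ θ : M.Index, G θ := by
  set c : (Fin d → Fin 5) → Fin d → ℤ := fun w i => (w i : ℕ) - 2 with hc
  have h1 : ∀ (θ : M.Index) (o : Fin d → Fin 3),
      G (M.wrap fun i => M.stencilBase bc θ i + (o i : ℕ)) ≤
        ∑ w, G (M.wrap (θ.toInt + c w)) := by
    intro θ o
    have hb := M.stencilBase_bounds hM θ
    have ho := fun i => (o i).2
    set w : Fin d → Fin 5 := fun i =>
      ⟨(M.stencilBase bc θ i + (o i : ℕ) - θ.toInt i + 2).toNat, by
        have := hb i
        have := ho i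
        omega⟩ with hw
    have : (fun i => M.stencilBase bc θ i + (o i : ℕ)) = θ.toInt + c w := by
      ext i
      have := hb i
      simp only [hc, hw, Pi.add_apply]
      omega
    rw [this]
    exact Finset.single_le_sum (f := fun w => G (M.wrap (θ.toInt + c w)))
      (fun _ _ => zero_le) (Finset.mem_univ w)
  calc _ ≤ ∑ θ : M.Index, ∑ o : Fin d → Fin 3, ∑ w, G (M.wrap (θ.toInt + c w)) :=
        Finset.sum_le_sum fun θ _ => Finset.sum_le_sum fun o _ => h1 θ o
    _ = 3 ^ d * ∑ w, ∑ θ : M.Index, G (M.wrap (θ.toInt + c w)) := by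
        rw [Finset.sum_comm (s := (Finset.univ : Finset (Fin d → Fin 5))), Finset.mul_sum]
        simp
    _ = 3 ^ d * ∑ w : Fin d → Fin 5, ∑ θ : M.Index, G θ := by
        congr 1
        exact Finset.sum_congr rfl fun w _ => (M.bijective_wrap_add (c w)).sum_comp G
    _ = 15 ^ d * ∑ θ : M.Index, G θ := by
        simp only [Finset.sum_const, Finset.card_univ, Fintype.card_pi, Fintype.card_fin,
          Finset.prod_const, nsmul_eq_mul, ← mul_assoc]
        push_cast
        rw [← mul_pow]
        norm_num

theorem sum_weakDerivNorm_cell_sq_le (hu : MemData bc s a b u) {α : Fin d → ℕ}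
    (hα : ∑ i, α i ≤ s) :
    ∑ θ : M.Index, weakDerivNorm (M.cell θ) α u ^ 2 ≤ weakDerivNorm (openBox a b) α u ^ 2 := by
  obtain ⟨g, -, hw⟩ := (memSobolev_openBox hu).2 α hα
  rw [weakDerivNorm_eq (isOpen_openBox _ _) hw, eLpNorm_two_sq]
  refine le_trans (Finset.sum_le_sum fun θ _ => ?_) (M.sum_lintegral_cell_le _)
  rw [weakDerivNorm_eq (U := M.cell θ) (isOpen_openBox _ _)
    (isWeakDeriv_mono (M.cell_subset θ) (measurableSet_openBox _ _) hw), eLpNorm_two_sq]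

theorem weakDerivNorm_patch_sq_le_sum (hM : M.Admits bc) (hu : MemData bc s a b u)
    {α : Fin d → ℕ} (hα : ∑ i, α i ≤ s) (θ : M.Index) :
    weakDerivNorm (M.patch bc θ) α u ^ 2 ≤ ∑ o : Fin d → Fin 3,
      weakDerivNorm (M.cell (M.wrap fun i => M.stencilBase bc θ i + (o i : ℕ))) α u ^ 2 := by
  have h := weakDerivNorm_patch_sq_le (s := s) (u := u)
    (fun i j => M.node i (M.stencilBase bc θ i + (j : ℕ)))
    (fun i j j' hj => M.strictMono_node i (by omega)) (fun _ => 3)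
    (M.memSobolev_patch hM hu θ) hα
  refine h.trans (Finset.sum_le_sum fun o _ => ?_)
  refine pow_le_pow_left' (le_trans (le_of_eq ?_)
    (M.weakDerivNorm_stencil_le_wrap hM hu hα θ o)) 2
  congr 2
  ext i
  simp only [upper]
  push_cast
  rw [add_assoc]

theorem sum_sobolevSeminorm_patch_sq_le (hM : M.Admits bc) (hu : MemData bc s a b u) :
    ∑ θ : M.Index, sobolevSeminorm s (M.patch bc θ) u ^ 2 ≤
      (15 ^ d * sobolevSeminorm s (openBox a b) u) ^ 2 := by
  -- Used to replace `15^d` by its square, so that the right-hand side becomes a perfect square, as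
  -- the `ℓ²` summation requires.
  have h15 : (1 : ℝ≥0∞) ≤ 15 ^ d := one_le_pow₀ (by norm_num)
  calc _ = ∑ α ∈ Finset.piAntidiag (Finset.univ : Finset (Fin d)) s,
        ∑ θ : M.Index, weakDerivNorm (M.patch bc θ) α u ^ 2 := by
        rw [Finset.sum_comm]
        simp_rw [sobolevSeminorm_sq]
    _ ≤ ∑ α ∈ Finset.piAntidiag (Finset.univ : Finset (Fin d)) s,
        15 ^ d * weakDerivNorm (openBox a b) α u ^ 2 := by
        refine Finset.sum_le_sum fun α hα => ?_
        have hα' := (mem_piAntidiag_univ.mp hα).le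
        refine (Finset.sum_le_sum fun θ _ =>
          M.weakDerivNorm_patch_sq_le_sum hM hu hα' θ).trans ?_
        refine (M.sum_stencil_le hM fun θ => weakDerivNorm (M.cell θ) α u ^ 2).trans ?_
        gcongr
        exact M.sum_weakDerivNorm_cell_sq_le hu hα'
    _ = 15 ^ d * sobolevSeminorm s (openBox a b) u ^ 2 := by
        rw [sobolevSeminorm_sq, Finset.mul_sum]
    _ ≤ _ := by
        rw [mul_pow]
        exact mul_le_mul_left (le_self_pow₀ h15 two_ne_zero) _

end RectMesh

end RDG

namespace RDG

/-! ### Weak derivatives of sums and of smooth functions -/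

section WeakDeriv

variable {d : ℕ} {α : Fin d → ℕ} {U : Set (Fin d → ℝ)}

theorem integrable_mul_of_tsupport_subset {w ψ : (Fin d → ℝ) → ℝ}
    (hw : LocallyIntegrableOn w U volume) (hψ : Continuous ψ) (hc : HasCompactSupport ψ)
    (hs : tsupport ψ ⊆ U) : Integrable (fun x => w x * ψ x) volume := by
  have h2 : IntegrableOn (fun x => w x * ψ x) (tsupport ψ) volume :=
    (hw.integrableOn_compact_subset hs hc).mul_continuousOn hψ.continuousOn hc
  refine (integrableOn_iff_integrable_of_support_subset ?_).mp h2
  exact (Function.support_mul_subset_right _ _).trans (subset_tsupport ψ)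

theorem IsWeakDeriv.sub {u g v f : (Fin d → ℝ) → ℝ} (h : IsWeakDeriv U α u g)
    (h' : IsWeakDeriv U α v f) : IsWeakDeriv U α (u - v) (g - f) := by
  refine ⟨h.1.sub h'.1, h.2.1.sub h'.2.1, fun φ hφ hc hs => ?_⟩
  have hψ := (contDiff_multiDeriv hφ α).continuous
  have hψc := hasCompactSupport_multiDeriv hφ hc α
  have hψs := (tsupport_multiDeriv_subset hφ α).trans hs
  simp only [Pi.sub_apply, sub_mul]
  rw [integral_sub (integrable_mul_of_tsupport_subset h.1 hψ hψc hψs).integrableOn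
      (integrable_mul_of_tsupport_subset h'.1 hψ hψc hψs).integrableOn,
    integral_sub (integrable_mul_of_tsupport_subset h.2.1 hφ.continuous hc hs).integrableOn
      (integrable_mul_of_tsupport_subset h'.2.1 hφ.continuous hc hs).integrableOn,
    h.2.2 φ hφ hc hs, h'.2.2 φ hφ hc hs, mul_sub]

theorem isWeakDeriv_single_of_contDiff (U : Set (Fin d → ℝ)) {f : (Fin d → ℝ) → ℝ}
    (hf : ContDiff ℝ ∞ f) (i : Fin d) :
    IsWeakDeriv U (Pi.single i 1) f (partialDeriv i f) := by
  have hf' := contDiff_partialDeriv hf i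
  refine ⟨hf.continuous.locallyIntegrable.locallyIntegrableOn U,
    hf'.continuous.locallyIntegrable.locallyIntegrableOn U, fun φ hφ hc hs => ?_⟩
  have hres : ∀ w ψ : (Fin d → ℝ) → ℝ, tsupport ψ ⊆ tsupport φ →
      ∫ x in U, w x * ψ x = ∫ x, w x * ψ x := by
    intro w ψ hψ
    refine setIntegral_eq_integral_of_forall_compl_eq_zero fun x hx => ?_
    rw [image_eq_zero_of_notMem_tsupport fun h => hx (hs (hψ h)), mul_zero]
  have hint : ∀ w ψ : (Fin d → ℝ) → ℝ, Continuous w → Continuous ψ → HasCompactSupport ψ →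
      Integrable (fun x => w x * ψ x) volume := fun w ψ hw hψ hψc =>
    (hw.mul hψ).integrable_of_hasCompactSupport hψc.mul_left
  have hm := tsupport_multiDeriv_subset hφ (Pi.single i 1)
  have hmc := hasCompactSupport_multiDeriv hφ hc (Pi.single i 1)
  rw [multiDeriv_single hφ] at hm hmc ⊢
  rw [hres _ _ hm, hres _ _ subset_rfl, Finset.sum_pi_single']
  simp only [Finset.mem_univ, if_true, pow_one, neg_mul, one_mul]
  refine integral_mul_fderiv_eq_neg_fderiv_mul_of_integrable
    (hint _ _ hf'.continuous hφ.continuous hc)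
    (hint _ _ hf.continuous (contDiff_partialDeriv hφ i).continuous hmc)
    (hint _ _ hf.continuous hφ.continuous hc)
    (fun x _ => (hf.differentiable (by simp)).differentiableAt)
    (fun x _ => (hφ.differentiable (by simp)).differentiableAt)

theorem IsWeakDeriv.congr {u v g : (Fin d → ℝ) → ℝ} (hU : MeasurableSet U)
    (h : IsWeakDeriv U α u g) (huv : EqOn u v U) : IsWeakDeriv U α v g := by
  refine ⟨fun x hx => ?_, h.2.1, fun φ hφ hc hs => ?_⟩
  · obtain ⟨t, ht, hi⟩ := h.1 x hx
    refine ⟨t ∩ U, Filter.inter_mem ht self_mem_nhdsWithin,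
      (hi.mono_set inter_subset_left).congr ?_⟩
    exact ae_mono (Measure.restrict_mono_set _ inter_subset_right)
      ((ae_restrict_mem hU).mono huv)
  · rw [← h.2.2 φ hφ hc hs]
    exact setIntegral_congr_fun hU fun x hx => by simp only [huv hx]

theorem exists_eq_single_of_sum_eq_one (hα : ∑ i, α i = 1) : ∃ i, α = Pi.single i 1 := by
  obtain ⟨i, -, hi⟩ := Finset.exists_ne_zero_of_sum_ne_zero (hα.trans_ne one_ne_zero)
  refine ⟨i, funext fun j => ?_⟩
  have h1 := Finset.add_sum_erase Finset.univ α (Finset.mem_univ i)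
  by_cases hj : j = i
  · subst hj
    rw [Pi.single_eq_same]
    omega
  · rw [Pi.single_eq_of_ne hj]
    have h2 := Finset.single_le_sum (f := α) (fun _ _ => Nat.zero_le _)
      (Finset.mem_erase.mpr ⟨hj, Finset.mem_univ j⟩)
    omega

/-- There are at most `d` multi-indices of order one, and `d c² ≤ (d c)²`. -/
theorem sobolevSeminorm_one_le {u : (Fin d → ℝ) → ℝ} {c : ℝ≥0∞}
    (h : ∀ i, weakDerivNorm U (Pi.single i 1) u ≤ c) :
    sobolevSeminorm 1 U u ≤ d * c := by
  have hsub : Finset.piAntidiag (Finset.univ : Finset (Fin d)) 1 ⊆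
      Finset.univ.image fun i => Pi.single i 1 := by
    intro α hα
    obtain ⟨i, rfl⟩ := exists_eq_single_of_sum_eq_one (mem_piAntidiag_univ.mp hα)
    exact Finset.mem_image_of_mem _ (Finset.mem_univ i)
  have hcard : ((Finset.piAntidiag (Finset.univ : Finset (Fin d)) 1).card : ℝ≥0∞) ≤ d := by
    have := (Finset.card_le_card hsub).trans Finset.card_image_le
    rw [Finset.card_univ, Fintype.card_fin] at this
    exact_mod_cast this
  rw [← ENNReal.pow_le_pow_left_iff two_ne_zero, sobolevSeminorm_sq]
  calc _ ≤ ∑ α ∈ Finset.piAntidiag (Finset.univ : Finset (Fin d)) 1, c ^ 2 := by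
        refine Finset.sum_le_sum fun α hα => ?_
        obtain ⟨i, rfl⟩ := exists_eq_single_of_sum_eq_one (mem_piAntidiag_univ.mp hα)
        exact pow_le_pow_left' (h i) 2
    _ ≤ d * c ^ 2 := by
        rw [Finset.sum_const, nsmul_eq_mul]
        gcongr
    _ ≤ _ := by
        rw [mul_pow]
        gcongr
        exact_mod_cast Nat.le_self_pow two_ne_zero d

end WeakDeriv

/-! ### Norms on a box and on its boundary -/

section Norms

variable {d : ℕ} {l r : Fin d → ℝ} {h e : ℝ}

theorem eLpNorm_two_le_of_ae_bound {μ : Measure (Fin d → ℝ)} {V : ℝ} {f : (Fin d → ℝ) → ℝ}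
    (hμ : μ univ ≤ ENNReal.ofReal V) (hV : 0 ≤ V) (hf : ∀ᵐ x ∂μ, |f x| ≤ e) :
    eLpNorm f 2 μ ≤ ENNReal.ofReal (√V * e) := by
  refine (eLpNorm_le_of_ae_bound hf).trans ?_
  rw [ENNReal.ofReal_mul (Real.sqrt_nonneg _), Real.sqrt_eq_rpow,
    ← ENNReal.ofReal_rpow_of_nonneg hV (by norm_num)]
  gcongr
  norm_num
  gcongr

theorem volume_openBox_le (hh : ∀ i, r i - l i ≤ h) (h0 : 0 ≤ h) :
    volume (openBox l r) ≤ ENNReal.ofReal (h ^ d) := by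
  rw [measure_congr (openBox_ae_eq_Icc l r), Real.volume_Icc_pi, ENNReal.ofReal_pow h0]
  calc _ ≤ ∏ _i : Fin d, ENNReal.ofReal h :=
        Finset.prod_le_prod' fun i _ => ENNReal.ofReal_le_ofReal (hh i)
    _ = _ := by simp

theorem eLpNorm_two_openBox_le {f : (Fin d → ℝ) → ℝ} (hh : ∀ i, r i - l i ≤ h) (h0 : 0 ≤ h)
    (hf : ∀ᵐ x ∂volume.restrict (openBox l r), |f x| ≤ e) :
    eLpNorm f 2 (volume.restrict (openBox l r)) ≤ ENNReal.ofReal (√(h ^ d) * e) :=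
  eLpNorm_two_le_of_ae_bound (by simpa using volume_openBox_le hh h0) (by positivity) hf

theorem faceMeasure_univ_le (hh : ∀ i, r i - l i ≤ h) (h0 : 0 ≤ h) (i : Fin d) (c : ℝ) :
    faceMeasure l r i c univ ≤ ENNReal.ofReal (h ^ (d - 1)) := by
  have hfin : ∀ j, SigmaFinite (Function.update
      (fun j => (volume : Measure ℝ).restrict (Icc (l j) (r j))) i (Measure.dirac c) j) := by
    intro j
    by_cases hj : j = i
    · subst hj
      rw [Function.update_self]
      infer_instance
    · rw [Function.update_of_ne hj]
      infer_instance
  rw [faceMeasure, Measure.pi_univ, ← Finset.mul_prod_erase _ _ (Finset.mem_univ i),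
    Function.update_self, measure_univ, one_mul, ENNReal.ofReal_pow h0]
  calc _ ≤ ∏ _j ∈ Finset.univ.erase i, ENNReal.ofReal h := by
        refine Finset.prod_le_prod' fun j hj => ?_
        rw [Function.update_of_ne (Finset.ne_of_mem_erase hj)]
        simpa using ENNReal.ofReal_le_ofReal (hh j)
    _ = _ := by simp

theorem boundaryMeasure_univ_le (hh : ∀ i, r i - l i ≤ h) (h0 : 0 ≤ h) :
    boundaryMeasure l r univ ≤ ENNReal.ofReal (2 * d * h ^ (d - 1)) := by
  rw [boundaryMeasure, Measure.finsetSum_apply]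
  calc _ ≤ ∑ _i : Fin d, ENNReal.ofReal (2 * h ^ (d - 1)) := by
        refine Finset.sum_le_sum fun i _ => ?_
        rw [Measure.add_apply, two_mul, ENNReal.ofReal_add (by positivity) (by positivity)]
        exact add_le_add (faceMeasure_univ_le hh h0 i _) (faceMeasure_univ_le hh h0 i _)
    _ = _ := by
        rw [Finset.sum_const, Finset.card_univ, Fintype.card_fin, ← ENNReal.ofReal_nsmul]
        congr 1
        rw [nsmul_eq_mul]
        ring

/-- A function that is bounded and Lipschitz continuous up to a null set has a trace, with the
same bound. -/
theorem traceNorm_le {v : (Fin d → ℝ) → ℝ} {X : Set (Fin d → ℝ)} {K : ℝ}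
    (hh : ∀ i, r i - l i ≤ h) (h0 : 0 ≤ h) (he : 0 ≤ e) (hK : 0 ≤ K)
    (hX : ∀ᵐ x ∂volume.restrict (openBox l r), x ∈ X) (hb : ∀ x ∈ X, |v x| ≤ e)
    (hL : ∀ x ∈ X, ∀ y ∈ X, |v x - v y| ≤ K * ‖x - y‖) :
    traceNorm l r v ≤ ENNReal.ofReal (√(2 * d * h ^ (d - 1)) * e) := by
  have hlip : LipschitzOnWith ⟨K, hK⟩ v X := LipschitzOnWith.of_dist_le_mul fun x hx y hy => by
    rw [Real.dist_eq, dist_eq_norm]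
    exact hL x hx y hy
  obtain ⟨w₀, hw₀, hEq⟩ := hlip.extend_real
  -- Truncating the Lipschitz extension at `±e` preserves continuity and its values on `X`, and
  -- makes the bound valid everywhere, in particular on the boundary.
  set w : (Fin d → ℝ) → ℝ := fun x => max (-e) (min e (w₀ x)) with hw
  have hwc : Continuous w := continuous_const.max (continuous_const.min hw₀.continuous)
  have hwe : ∀ x, |w x| ≤ e := fun x => abs_le.mpr
    ⟨le_max_left _ _, max_le (by linarith) (min_le_left _ _)⟩
  have hvw : v =ᵐ[volume.restrict (Icc l r)] w := by
    rw [← Measure.restrict_congr_set (openBox_ae_eq_Icc l r)]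
    filter_upwards [hX] with x hx
    have h1 := abs_le.mp (hb x hx)
    simp only [hw]
    rw [← hEq hx, min_eq_right h1.2, max_eq_right h1.1]
  refine (iInf₂_le w ⟨hwc.continuousOn, hvw⟩).trans ?_
  exact eLpNorm_two_le_of_ae_bound (boundaryMeasure_univ_le hh h0) (by positivity)
    (Filter.Eventually.of_forall hwe)

theorem traceNorm_congr {v v' : (Fin d → ℝ) → ℝ} (hv : EqOn v v' (openBox l r)) :
    traceNorm l r v = traceNorm l r v' := by
  have h1 : v =ᵐ[volume.restrict (Icc l r)] v' := by
    rw [← Measure.restrict_congr_set (openBox_ae_eq_Icc l r)]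
    exact (ae_restrict_mem (measurableSet_openBox l r)).mono hv
  unfold traceNorm
  congr 1
  ext w
  have : (v =ᵐ[volume.restrict (Icc l r)] w) ↔ (v' =ᵐ[volume.restrict (Icc l r)] w) :=
    ⟨fun h => h1.symm.trans h, fun h => h1.trans h⟩
  simp only [this]

end Norms

end RDG

namespace RDG

/-! ### Estimates on a single element -/

section Element

variable {d : ℕ}

theorem weakDerivNorm_le_sobolevSeminorm {s : ℕ} (U : Set (Fin d → ℝ)) (u : (Fin d → ℝ) → ℝ)
    {α : Fin d → ℕ} (hα : ∑ i, α i = s) : weakDerivNorm U α u ≤ sobolevSeminorm s U u := by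
  rw [← ENNReal.pow_le_pow_left_iff two_ne_zero, sobolevSeminorm_sq]
  exact Finset.single_le_sum (f := fun α => weakDerivNorm U α u ^ 2) (fun _ _ => zero_le)
    (mem_piAntidiag_univ.mpr hα)

theorem sobolevSeminorm_ne_top {s : ℕ} {U : Set (Fin d → ℝ)} {u : (Fin d → ℝ) → ℝ}
    (h : MemSobolev s U u) : sobolevSeminorm s U u ≠ ⊤ := by
  refine ENNReal.rpow_ne_top_of_nonneg (by norm_num) (ENNReal.sum_ne_top.mpr fun α hα => ?_)
  obtain ⟨g, hg, hw⟩ := h.2 α (mem_piAntidiag_univ.mp hα).le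
  exact ENNReal.pow_ne_top ((iInf₂_le g hw).trans_lt hg.2).ne

theorem RectMesh.cell_subset_patch {a b : Fin d → ℝ} (M : RectMesh a b) {bc : BoundaryKind}
    (hM : M.Admits bc) (θ : M.Index) : M.cell θ ⊆ M.patch bc θ := by
  intro x hx
  refine mem_openBox.mpr fun i => ?_
  have h1 := mem_openBox.mp hx i
  obtain ⟨o, ho⟩ := M.exists_eq_stencilBase_add hM θ
  have h2 : θ.toInt i = M.stencilBase bc θ i + (o i : ℕ) := congrFun ho i
  have h3 := (o i).2
  refine ⟨lt_of_le_of_lt ?_ h1.1, h1.2.trans_le ?_⟩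
  · refine (M.strictMono_node i).monotone ?_
    rw [h2]
    simp
  · refine (M.strictMono_node i).monotone ?_
    rw [h2]
    show _ ≤ M.stencilBase bc θ i + ((3 : ℕ) : ℤ)
    omega

/-- All local error estimates, in terms of the seminorm of `u` on the stencil. -/
theorem exists_element_estimates {k m : ℕ} (hd : d ≤ 2) (hd0 : 0 < d)
    (hk : k + 1 = 3 * (m + 1)) {γ : ℝ} (hγ : 0 < γ) :
    ∃ C : ℝ, 0 < C ∧ ∀ (bc : BoundaryKind) (a b : Fin d → ℝ) (M : RectMesh a b)
      (u : (Fin d → ℝ) → ℝ), M.Regular γ → M.Admits bc → MemData bc (k + 1) a b u →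
      ∀ θ : M.Index,
        eLpNorm (u - M.reconstruction bc k m u) 2 (volume.restrict (M.cell θ)) ≤
          ENNReal.ofReal (C * M.h ^ (k + 1)) * sobolevSeminorm (k + 1) (M.patch bc θ) u ∧
        sobolevSeminorm 1 (M.cell θ) (u - M.reconstruction bc k m u) ≤
          ENNReal.ofReal (C * M.h ^ k) * sobolevSeminorm (k + 1) (M.patch bc θ) u ∧
        (∀ᵐ x ∂volume.restrict (M.cell θ),
          ENNReal.ofReal (M.h ^ ((d : ℝ) / 2)) * ‖(u - M.reconstruction bc k m u) x‖ₑ ≤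
            ENNReal.ofReal (C * M.h ^ (k + 1)) * sobolevSeminorm (k + 1) (M.patch bc θ) u) ∧
        ENNReal.ofReal (M.h ^ (1 / 2 : ℝ)) * traceNorm (M.lower θ.toInt) (M.upper θ.toInt)
            (u - M.reconstruction bc k m u) ≤
          ENNReal.ofReal (C * M.h ^ (k + 1)) * sobolevSeminorm (k + 1) (M.patch bc θ) u := by
  obtain ⟨C, hC, hest⟩ := exists_patch_estimate hd hk hγ
  -- The factor `2d + 1` dominates the losses in the four estimates: `1` for `L²` and `L^∞`, `d` for
  -- the seminorm and `√(2d)` for the trace.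
  refine ⟨C * (2 * d + 1), by positivity, fun bc a b M u hreg hM hu θ => ?_⟩
  have hh := M.h_pos ⟨0, hd0⟩
  have hmin : M.h / γ ≤ M.hMin := by
    rw [div_le_iff₀' hγ]
    exact hreg
  have hS := M.memSobolev_patch hM hu θ
  set β := sobolevSeminorm (k + 1) (M.patch bc θ) u with hβ
  have hβtop : β ≠ ⊤ := sobolevSeminorm_ne_top hS
  set B := β.toReal with hB
  have hBβ : ENNReal.ofReal B = β := ENNReal.ofReal_toReal hβtop
  have hB0 : 0 ≤ B := ENNReal.toReal_nonneg
  have hp := (M.isLocalReconstruction_iff bc k m u θ _).mp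
    (M.isLocalReconstruction_localReconstruction bc hk u θ)
  set p := M.localReconstruction bc k m u θ with hpdef
  obtain ⟨X, hXU, hX, hXb, ⟨K, hK0, hXL⟩, hXd⟩ := hest (M.patchNodes bc θ) M.h hh
    (fun i j => ⟨hmin.trans (M.patchNodes_gap bc θ i j).1, (M.patchNodes_gap bc θ i j).2⟩)
    u B hS hB0 (fun α hα => hBβ.symm ▸ weakDerivNorm_le_sobolevSeminorm _ u hα) p hp.1 hp.2
  have hsub := M.cell_subset_patch hM θ
  have hXc : ∀ᵐ x ∂volume.restrict (M.cell θ), x ∈ X :=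
    ae_restrict_of_ae_restrict_of_subset hsub hX
  -- Agreement on the open cell suffices: weak derivatives, almost everywhere bounds and traces do
  -- not see the zero values of the global reconstruction on the element boundaries.
  have hEq : EqOn (fun x => u x - MvPolynomial.eval x p) (u - M.reconstruction bc k m u)
      (M.cell θ) := fun x hx => by
    rw [Pi.sub_apply, M.reconstruction_eq_of_mem_cell bc k m u hx]
  have hgap : ∀ i, M.upper θ.toInt i - M.lower θ.toInt i ≤ M.h := fun i => M.node_gap_le_h i _
  have hs0 : 0 < √(M.h ^ d) := Real.sqrt_pos.mpr (by positivity)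
  have hcancel : ∀ z : ℝ, √(M.h ^ d) * (C * (z * B / √(M.h ^ d))) = C * z * B := fun z => by
    field_simp
  have hd1 : (1 : ℝ) ≤ 2 * d + 1 := by linarith [(Nat.cast_nonneg d : (0 : ℝ) ≤ d)]
  have hfin : ∀ z y : ℝ, 0 ≤ z → y ≤ (2 * d + 1) * (C * z * B) →
      ENNReal.ofReal y ≤ ENNReal.ofReal (C * (2 * d + 1) * z) * β := fun z y hz hy => by
    rw [← hBβ, ← ENNReal.ofReal_mul (by positivity)]
    exact ENNReal.ofReal_le_ofReal (hy.trans_eq (by ring))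
  have hz0 : ∀ n : ℕ, 0 ≤ C * M.h ^ n * B := fun n => by positivity
  have hXc' : ∀ᵐ x ∂volume.restrict (M.cell θ), |(u - M.reconstruction bc k m u) x| ≤
      C * (M.h ^ (k + 1) * B / √(M.h ^ d)) := by
    filter_upwards [hXc, ae_restrict_mem (measurableSet_openBox _ _)] with x hx hxc
    rw [← hEq hxc]
    exact hXb x hx
  refine ⟨?_, ?_, ?_, ?_⟩
  · refine (eLpNorm_two_openBox_le hgap hh.le hXc').trans (hfin _ _ (by positivity) ?_)
    rw [hcancel]
    exact le_mul_of_one_le_left (hz0 _) hd1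
  · refine (sobolevSeminorm_one_le (c := ENNReal.ofReal (C * M.h ^ k * B)) fun i => ?_).trans ?_
    · obtain ⟨g, hg, hgX⟩ := hXd i
      have hw := ((isWeakDeriv_mono hsub (measurableSet_openBox _ _) hg).sub
        (isWeakDeriv_single_of_contDiff (M.cell θ) (contDiff_eval p) i)).congr
        (measurableSet_openBox _ _) hEq
      refine (iInf₂_le _ hw).trans ?_
      rw [← hcancel]
      refine eLpNorm_two_openBox_le hgap hh.le ?_
      filter_upwards [hXc] with x hx
      rw [Pi.sub_apply, partialDeriv_eval]
      exact hgX x hx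
    · rw [← ENNReal.ofReal_natCast d, ← ENNReal.ofReal_mul (by positivity)]
      refine hfin _ _ (by positivity) (mul_le_mul_of_nonneg_right ?_ (hz0 _))
      linarith [(Nat.cast_nonneg d : (0 : ℝ) ≤ d)]
  · filter_upwards [hXc'] with x hx
    have hpow : M.h ^ ((d : ℝ) / 2) = √(M.h ^ d) := by
      rw [Real.sqrt_eq_rpow, ← Real.rpow_natCast, ← Real.rpow_mul hh.le]
      congr 1
      ring
    rw [hpow, ← ofReal_norm, ← ENNReal.ofReal_mul hs0.le, Real.norm_eq_abs]
    refine hfin _ _ (by positivity) ((mul_le_mul_of_nonneg_left hx hs0.le).trans ?_)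
    rw [hcancel]
    exact le_mul_of_one_le_left (hz0 _) hd1
  · rw [← traceNorm_congr hEq]
    have ht := traceNorm_le hgap hh.le (by positivity) hK0 hXc hXb hXL
    refine (mul_le_mul_right ht _).trans ?_
    rw [← ENNReal.ofReal_mul (by positivity)]
    refine hfin _ _ (by positivity) ?_
    -- The surface measure scales like `h^{d-1}`; the weight `h^{1/2}` restores `h^{d/2}`, which
    -- cancels the denominator of the sup bound.
    have h1 : M.h ^ (1 / 2 : ℝ) * √(2 * d * M.h ^ (d - 1)) = √(2 * d) * √(M.h ^ d) := by
      rw [← Real.sqrt_eq_rpow, ← Real.sqrt_mul hh.le, ← Real.sqrt_mul (by positivity)]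
      congr 1
      rw [← mul_pow_sub_one hd0.ne' M.h]
      ring
    rw [← mul_assoc, h1, mul_assoc, hcancel]
    refine mul_le_mul_of_nonneg_right ?_ (hz0 _)
    refine Real.sqrt_le_iff.mpr ⟨by positivity, ?_⟩
    nlinarith [(Nat.cast_nonneg d : (0 : ℝ) ≤ d)]

end Element

/-! ### Summation over the mesh -/

section Global

theorem sq_rpow_half (c : ℝ≥0∞) : (c ^ 2) ^ (1 / 2 : ℝ) = c := by
  rw [← ENNReal.rpow_two, ← ENNReal.rpow_mul]
  norm_num

/-- Passes from element estimates to global ones: squaring, summing and using the finite overlap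
bound keeps the common factor `c`. -/
theorem rpow_half_sum_sq_le {ι : Type*} (t : Finset ι) {A β : ι → ℝ≥0∞} {c S : ℝ≥0∞}
    (hA : ∀ j ∈ t, A j ≤ c * β j) (hβ : ∑ j ∈ t, β j ^ 2 ≤ S ^ 2) :
    (∑ j ∈ t, A j ^ 2) ^ (1 / 2 : ℝ) ≤ c * S := by
  rw [← sq_rpow_half (c * S)]
  refine ENNReal.rpow_le_rpow ?_ (by norm_num)
  calc ∑ j ∈ t, A j ^ 2 ≤ ∑ j ∈ t, c ^ 2 * β j ^ 2 :=
        Finset.sum_le_sum fun j hj => (pow_le_pow_left' (hA j hj) 2).trans_eq (mul_pow _ _ _)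
    _ ≤ (c * S) ^ 2 := by
        rw [← Finset.mul_sum, mul_pow]
        gcongr

/-- The global estimates with a positive regularity parameter. -/
theorem exists_global_estimates {d k m : ℕ} (hd : d ≤ 2) (hd0 : 0 < d)
    (hk : k + 1 = 3 * (m + 1)) {γ : ℝ} (hγ : 0 < γ) :
    ∃ C : ℝ, 0 < C ∧ ∀ (bc : BoundaryKind) (a b : Fin d → ℝ) (M : RectMesh a b)
      (u : (Fin d → ℝ) → ℝ), M.Regular γ → M.Admits bc → MemData bc (k + 1) a b u →
        eLpNorm (u - M.reconstruction bc k m u) 2 (volume.restrict (openBox a b)) ≤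
          ENNReal.ofReal (C * M.h ^ (k + 1)) * sobolevSeminorm (k + 1) (openBox a b) u ∧
        M.brokenSeminorm (u - M.reconstruction bc k m u) ≤
          ENNReal.ofReal (C * M.h ^ k) * sobolevSeminorm (k + 1) (openBox a b) u ∧
        ENNReal.ofReal (M.h ^ ((d : ℝ) / 2)) *
            eLpNorm (u - M.reconstruction bc k m u) ⊤ (volume.restrict (openBox a b)) ≤
          ENNReal.ofReal (C * M.h ^ (k + 1)) * sobolevSeminorm (k + 1) (openBox a b) u ∧
        ENNReal.ofReal (M.h ^ (1 / 2 : ℝ)) * M.edgeNorm (u - M.reconstruction bc k m u) ≤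
          ENNReal.ofReal (C * M.h ^ (k + 1)) * sobolevSeminorm (k + 1) (openBox a b) u := by
  obtain ⟨C, hC, hest⟩ := exists_element_estimates hd hd0 hk hγ
  refine ⟨C * 15 ^ d, by positivity, fun bc a b M u hreg hM hu => ?_⟩
  have hh := M.h_pos ⟨0, hd0⟩
  have hloc := hest bc a b M u hreg hM hu
  have hsum := M.sum_sobolevSeminorm_patch_sq_le hM hu
  set v := u - M.reconstruction bc k m u with hv
  have hconst : ∀ n : ℕ, ENNReal.ofReal (C * 15 ^ d * M.h ^ n) *
      sobolevSeminorm (k + 1) (openBox a b) u =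
      ENNReal.ofReal (C * M.h ^ n) * (15 ^ d * sobolevSeminorm (k + 1) (openBox a b) u) := by
    intro n
    rw [mul_right_comm, ENNReal.ofReal_mul (by positivity), mul_assoc,
      ENNReal.ofReal_pow (by norm_num)]
    norm_num
  simp_rw [hconst]
  refine ⟨?_, ?_, ?_, ?_⟩
  · refine le_trans ?_ (rpow_half_sum_sq_le Finset.univ (fun θ _ => (hloc θ).1) hsum)
    rw [← sq_rpow_half (eLpNorm v 2 (volume.restrict (openBox a b)))]
    simp_rw [eLpNorm_two_sq]
    exact ENNReal.rpow_le_rpow (M.lintegral_openBox_le_sum_cell _) (by norm_num)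
  · exact rpow_half_sum_sq_le Finset.univ (fun θ _ => (hloc θ).2.1) hsum
  · have hc0 : ENNReal.ofReal (M.h ^ ((d : ℝ) / 2)) ≠ 0 := by
      rw [Ne, ENNReal.ofReal_eq_zero, not_le]
      positivity
    rw [mul_comm, ← ENNReal.le_div_iff_mul_le (Or.inl hc0) (Or.inl ENNReal.ofReal_ne_top),
      eLpNorm_exponent_top]
    refine eLpNormEssSup_le_of_ae_enorm_bound ?_
    have hall : ∀ᵐ x, ∀ θ : M.Index, x ∈ M.cell θ →
        ENNReal.ofReal (M.h ^ ((d : ℝ) / 2)) * ‖v x‖ₑ ≤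
          ENNReal.ofReal (C * M.h ^ (k + 1)) * sobolevSeminorm (k + 1) (M.patch bc θ) u :=
      ae_all_iff.mpr fun θ =>
        (ae_restrict_iff' (measurableSet_openBox _ _)).mp (hloc θ).2.2.1
    filter_upwards [M.ae_exists_mem_cell, ae_restrict_of_ae hall] with x ⟨θ, hθ⟩ hx
    rw [ENNReal.le_div_iff_mul_le (Or.inl hc0) (Or.inl ENNReal.ofReal_ne_top), mul_comm]
    -- For the sup norm no summation is needed: the seminorm on a single patch is one term of the
    -- sum that bounds all of them.
    refine (hx θ hθ).trans (mul_le_mul_right ?_ _)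
    rw [← ENNReal.pow_le_pow_left_iff two_ne_zero]
    exact (Finset.single_le_sum (f := fun θ => sobolevSeminorm (k + 1) (M.patch bc θ) u ^ 2)
      (fun _ _ => zero_le) (Finset.mem_univ θ)).trans hsum
  · refine le_trans (le_of_eq ?_)
      (rpow_half_sum_sq_le Finset.univ (fun θ _ => (hloc θ).2.2.2) hsum)
    simp_rw [mul_pow]
    rw [← Finset.mul_sum, ENNReal.mul_rpow_of_nonneg _ _ (by norm_num), sq_rpow_half]
    rfl

end Global

end RDG

theorem theorem2 (d k m : ℕ) (hd : d = 1 ∨ d = 2) (hk : k + 1 = 3 * (m + 1)) (γ : ℝ) :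
    ∃ C : ℝ, 0 < C ∧
      ∀ (bc : RDG.BoundaryKind) (a b : Fin d → ℝ) (M : RDG.RectMesh a b) (u : (Fin d → ℝ) → ℝ),
        M.Regular γ → M.Admits bc → RDG.MemData bc (k + 1) a b u →
        (∀ θ : M.Index, ∃! p, M.IsLocalReconstruction bc k m u θ p) ∧
        eLpNorm (u - M.reconstruction bc k m u) 2 (volume.restrict (RDG.openBox a b)) ≤
          ENNReal.ofReal (C * M.h ^ (k + 1)) *
            RDG.sobolevSeminorm (k + 1) (RDG.openBox a b) u ∧
        M.brokenSeminorm (u - M.reconstruction bc k m u) ≤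
          ENNReal.ofReal (C * M.h ^ k) * RDG.sobolevSeminorm (k + 1) (RDG.openBox a b) u ∧
        eLpNorm (u - M.reconstruction bc k m u) 2 (volume.restrict (RDG.openBox a b)) +
            ENNReal.ofReal (M.h ^ ((d : ℝ) / 2)) *
              eLpNorm (u - M.reconstruction bc k m u) ⊤ (volume.restrict (RDG.openBox a b)) +
            ENNReal.ofReal (M.h ^ (1 / 2 : ℝ)) *
              M.edgeNorm (u - M.reconstruction bc k m u) ≤
          ENNReal.ofReal (C * M.h ^ (k + 1)) *
            RDG.sobolevSeminorm (k + 1) (RDG.openBox a b) u := by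
  have hd2 : d ≤ 2 := by omega
  have hd0 : 0 < d := by omega
  by_cases hγ : 0 < γ
  · obtain ⟨C, hC, hest⟩ := RDG.exists_global_estimates hd2 hd0 hk hγ
    -- The combined estimate adds three quantities, each bounded with the constant `C`.
    refine ⟨3 * C, by positivity, fun bc a b M u hreg hM hu => ?_⟩
    obtain ⟨h1, h2, h3, h4⟩ := hest bc a b M u hreg hM hu
    have hh := M.h_pos ⟨0, hd0⟩
    have hmono : ∀ n : ℕ, ENNReal.ofReal (C * M.h ^ n) ≤ ENNReal.ofReal (3 * C * M.h ^ n) :=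
      fun n => ENNReal.ofReal_le_ofReal (by
        have : 0 < C * M.h ^ n := by positivity
        linarith)
    refine ⟨M.existsUnique_isLocalReconstruction bc hk u,
      h1.trans (mul_le_mul_left (hmono _) _), h2.trans (mul_le_mul_left (hmono _) _), ?_⟩
    refine (add_le_add (add_le_add h1 h3) h4).trans_eq ?_
    rw [mul_assoc 3 C, ENNReal.ofReal_mul (by norm_num : (0 : ℝ) ≤ 3), mul_assoc]
    norm_num
    ring
  -- For `γ ≤ 0` no mesh is regular, because the mesh sizes are positive; any constant works.
  · refine ⟨1, one_pos, fun bc a b M u hreg _ _ => absurd hreg ?_⟩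
    have h1 := M.h_pos ⟨0, hd0⟩
    have h2 := M.hMin_pos ⟨0, hd0⟩
    rw [RDG.RectMesh.Regular, not_le]
    exact (mul_nonpos_of_nonpos_of_nonneg (not_lt.mp hγ) h2.le).trans_lt h1
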